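/- **Theorem (sharp weighted fractional Hardy inequality on $\mathbb{R}^d$ with a remainder, $1<p<2$).** Let $d\ge 1$, $0<s<1$, $1<p<2$, and let $\alpha,\beta\in\mathbb{R}$ satisfy $\alpha,\ \beta,\ \alpha+\beta\in(-sp,d)$ and $sp+\alpha+\beta\neq d$. Put $\Omega=\mathbb{R}^d$ if $sp+\alpha+\beta<d$ and $\Omega=\mathbb{R}^d\setminus\{0\}$ if $sp+\alpha+\beta>d$, and let $C_c^1(\Omega)$ be the space of continuously differentiable functions with compact support in $\Omega$ (extended by zero to $\mathbb{R}^d$). For $a\in\mathbb{R}$, $k>0$ write $a^{\langle k\rangle}=|a|^k\,\mathrm{sgn}(a)$. Let $$C_p=\max\Big\{\tfrac{p-1}{p},\tfrac{p(p-1)}{2}\Big\},\qquad \mathcal{C}=\int_0^1 r^{sp-1}\,(r^\alpha+r^\beta)\,\Big|1-r^{\frac{d-\alpha-\beta-sp}{p}}\Big|^p\,\Phi_{d,s,p}(r)\,dr,$$ where, for $0<r<1$, $$\Phi_{d,s,p}(r)=|\mathbb{S}^{d-2}|\int_{-1}^1\frac{(1-t^2)^{\frac{d-3}{2}}}{(1-2tr+r^2)^{\frac{d+sp}{2}}}\,dt\quad(d\ge2),\qquad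 \Phi_{1,s,p}(r)=(1-r)^{-1-sp}+(1+r)^{-1-sp},$$ and $|\mathbb{S}^{d-2}|$ is the surface measure of the unit sphere of $\mathbb{R}^{d-1}$. Let $w(x)=|x|^{-\frac{d-\alpha-\beta-sp}{p}}$ and $W(x,y)=\min\{w(x),w(y)\}\,\max\{w(x),w(y)\}^{p-1}$. Then $0<\mathcal{C}<\infty$, and for every real-valued $u\in C_c^1(\Omega)$, with $v(x)=u(x)|x|^{\frac{d-\alpha-\beta-sp}{p}}$, and for every complex-valued $u\in C_c^1(\Omega)$, with $v(x)=|u(x)|\,|x|^{\frac{d-\alpha-\beta-sp}{p}}$, all three integrals below are finite and $$\int_{\mathbb{R}^d}\!\int_{\mathbb{R}^d}\frac{|u(x)-u(y)|^p}{|x-y|^{d+sp}}\,|x|^{-\alpha}|y|^{-\beta}\,dy\,dx-\mathcal{C}\int_{\mathbb{R}^d}\frac{|u(x)|^p}{|x|^{sp+\alpha+\beta}}\,dx$$ $$\ge\ C_p\int_{\mathbb{R}^d}\!\int_{\mathbb{R}^d}\frac{\big(v(x)^{\langle p/2\rangle}-v(y)^{\langle p/2\rangle}\big)^2}{|x-y|^{d+sp}}\,W(x,y)\,|x|^{-\alpha}|y|^{-\beta}\,dy\,dx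 .$$ If $u\ge0$, or if $u$ is complex-valued and $v$ is defined with $|u|$ as above, then $C_p$ can be replaced by $p-1$ in this inequality. The constant $\mathcal{C}$ is sharp: it is the largest constant for which the left-hand side is nonnegative for all real-valued $u\in C_c^1(\Omega)$. -/

import Mathlib

open MeasureTheory Set

noncomputable section

/-- The French power `a^⟨k⟩ = |a|^k sgn a`. -/
def frenchPow (a k : ℝ) : ℝ := |a| ^ k * Real.sign a

/-- The class `C_c^1(Ω)` for `Ω ⊆ ℝ^d` open: continuously differentiable functions whose support is
a compact subset of `Ω`, regarded as functions on `ℝ^d` through extension by zero. -/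
def IsCc1 {d : ℕ} {F : Type*} [NormedAddCommGroup F] [NormedSpace ℝ F]
    (Ω : Set (EuclideanSpace ℝ (Fin d))) (u : EuclideanSpace ℝ (Fin d) → F) : Prop :=
  ContDiff ℝ 1 u ∧ HasCompactSupport u ∧ tsupport u ⊆ Ω

/-- The surface measure `|𝕊^{n-1}|` of the unit sphere of `ℝ^n`. -/
def unitSphereArea (n : ℕ) : ℝ :=
  (volume : Measure (EuclideanSpace ℝ (Fin n))).toSphere.real univ

/-- The function `Φ_{d,s,p}` on `(0,1)`, for `d ≥ 1`. -/
def Phi (d : ℕ) (s p r : ℝ) : ℝ :=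
  if 2 ≤ d then
    unitSphereArea (d - 1) *
      ∫ t in Ioo (-1 : ℝ) 1,
        (1 - t ^ 2) ^ (((d : ℝ) - 3) / 2) / (1 - 2 * t * r + r ^ 2) ^ (((d : ℝ) + s * p) / 2)
  else
    (1 - r) ^ (-1 - s * p) + (1 + r) ^ (-1 - s * p)

/-- The weighted fractional Hardy constant `𝒞(d,s,p,α,β)`. -/
def hardyConst (d : ℕ) (s p α β : ℝ) : ℝ :=
  ∫ r in Ioo (0 : ℝ) 1,
    r ^ (s * p - 1) * (r ^ α + r ^ β) * |1 - r ^ (((d : ℝ) - α - β - s * p) / p)| ^ p *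
      Phi d s p r

/-- The constant `C_p = max{(p-1)/p, p(p-1)/2}`. -/
def remainderConst (p : ℝ) : ℝ := max ((p - 1) / p) (p * (p - 1) / 2)

/-- The integrand `|u(x)-u(y)|^p |x-y|^{-d-sp} |x|^{-α} |y|^{-β}`. -/
def gagliardoIntegrand {d : ℕ} {F : Type*} [NormedAddCommGroup F] (s p α β : ℝ)
    (u : EuclideanSpace ℝ (Fin d) → F) (x y : EuclideanSpace ℝ (Fin d)) : ℝ :=
  ‖u x - u y‖ ^ p / ‖x - y‖ ^ ((d : ℝ) + s * p) * ‖x‖ ^ (-α) * ‖y‖ ^ (-β)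

/-- The integrand `|u(x)|^p / |x|^{sp+α+β}`. -/
def hardyIntegrand {d : ℕ} {F : Type*} [NormedAddCommGroup F] (s p α β : ℝ)
    (u : EuclideanSpace ℝ (Fin d) → F) (x : EuclideanSpace ℝ (Fin d)) : ℝ :=
  ‖u x‖ ^ p / ‖x‖ ^ (s * p + α + β)

/-- The weight `w(x) = |x|^{-(d-α-β-sp)/p}`. -/
def groundState {d : ℕ} (s p α β : ℝ) (x : EuclideanSpace ℝ (Fin d)) : ℝ :=
  ‖x‖ ^ (-(((d : ℝ) - α - β - s * p) / p))

/-- `W(x,y) = min{w(x),w(y)} max{w(x),w(y)}^{p-1}`. -/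
def pairWeight {d : ℕ} (s p α β : ℝ) (x y : EuclideanSpace ℝ (Fin d)) : ℝ :=
  min (groundState s p α β x) (groundState s p α β y) *
    max (groundState s p α β x) (groundState s p α β y) ^ (p - 1)

/-- The integrand `(v(x)^⟨p/2⟩ - v(y)^⟨p/2⟩)^2 |x-y|^{-d-sp} W(x,y) |x|^{-α} |y|^{-β}`. -/
def remainderIntegrand {d : ℕ} (s p α β : ℝ)
    (v : EuclideanSpace ℝ (Fin d) → ℝ) (x y : EuclideanSpace ℝ (Fin d)) : ℝ :=
  (frenchPow (v x) (p / 2) - frenchPow (v y) (p / 2)) ^ 2 / ‖x - y‖ ^ ((d : ℝ) + s * p) *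
    pairWeight s p α β x y * ‖x‖ ^ (-α) * ‖y‖ ^ (-β)

/-- `v(x) = u(x) |x|^{(d-α-β-sp)/p}`, the function of the remainder term. -/
def transform {d : ℕ} (s p α β : ℝ) (u : EuclideanSpace ℝ (Fin d) → ℝ)
    (x : EuclideanSpace ℝ (Fin d)) : ℝ :=
  u x * ‖x‖ ^ (((d : ℝ) - α - β - s * p) / p)

/-- The Hardy difference
`∬ |u(x)-u(y)|^p |x-y|^{-d-sp} |x|^{-α} |y|^{-β} dy dx - c ∫ |u(x)|^p |x|^{-sp-α-β} dx`. -/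
def hardyDifference {d : ℕ} {F : Type*} [NormedAddCommGroup F] (s p α β c : ℝ)
    (u : EuclideanSpace ℝ (Fin d) → F) : ℝ :=
  (∫ x, ∫ y, gagliardoIntegrand s p α β u x y) - c * ∫ x, hardyIntegrand s p α β u x

/-- The remainder term
`∬ (v(x)^⟨p/2⟩ - v(y)^⟨p/2⟩)^2 |x-y|^{-d-sp} W(x,y) |x|^{-α} |y|^{-β} dy dx`. -/
def remainderTerm {d : ℕ} (s p α β : ℝ) (v : EuclideanSpace ℝ (Fin d) → ℝ) : ℝ :=
  ∫ x, ∫ y, remainderIntegrand s p α β v x y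

/-- The three integrals of the inequality converge absolutely (over `ℝ^d × ℝ^d`, `ℝ^d` and
`ℝ^d × ℝ^d`), so that none of them has a junk value. -/
def IntegralsConverge {d : ℕ} {F : Type*} [NormedAddCommGroup F] (s p α β : ℝ)
    (u : EuclideanSpace ℝ (Fin d) → F) (v : EuclideanSpace ℝ (Fin d) → ℝ) : Prop :=
  Integrable (fun z : EuclideanSpace ℝ (Fin d) × EuclideanSpace ℝ (Fin d) =>
      gagliardoIntegrand s p α β u z.1 z.2) (volume.prod volume) ∧
    Integrable (fun x : EuclideanSpace ℝ (Fin d) => hardyIntegrand s p α β u x) ∧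
    Integrable (fun z : EuclideanSpace ℝ (Fin d) × EuclideanSpace ℝ (Fin d) =>
      remainderIntegrand s p α β v z.1 z.2) (volume.prod volume)

end

/-! Put g = (d-α-β-sp)/p. The weight w(x) = |x|^(-g) acts as a ground state: writing u = wv splits
the energy of u into the Hardy term and a nonnegative remainder. The splitting is pointwise
(`pointwise_weights`): for W > w > 0, |Wa-wb|^p is at least (W-w)^(p-1) (W|a|^p - w|b|^p) plus C w
W^(p-1) times the squared difference of the half powers of a and b, with C = p-1 if ab ≥ 0 and C =
C_p in general. By homogeneity only t = w/W and b = 1 matter, apart from b = 0. For equal signs the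
gap between the two sides is a sum of two Bregman expressions y^p + (p-1)a^p - p a^(p-1) y, and
`bregman_ge` compares each with half powers. For opposite signs two elementary estimates produce the
two members of the maximum C_p.

Next the inequality is integrated over |y| < |x| against the kernel symmetrized in α and β. The
kernel is homogeneous and rotation invariant, so each ground state term is the Hardy integral times
a radial constant, an integral over the ratio r = |y|/|x| (`lintegral_groundState_term`), and the
two constants differ by 𝒞 up to sign. They may both be infinite, since only p-1 powers of |1-r|
offset the singularity at r = 1. The integration is therefore restricted to |y| < η|x|, the smaller
constant, then finite, is cancelled (`truncated_hardy`), and η → 1 by monotone convergence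
(`hardy_lintegral`). The inversion r ↦ 1/r (`kernelInt_inv`) lets all constants be written on r < 1,
where polar coordinates identify them with integrals of Φ.

A complex u is replaced by |u|, which has the same Hardy integral and no larger energy; being
nonnegative, it admits the constant p-1.

For sharpness the ground state is cut off on a logarithmic scale, |x|^(-g) χ(log|x|/N). Its Hardy
integral is at least the mass of |x|^(-d) on the plateau, while the energy is at most a factor close
to 1 times 𝒞 times that integral, plus an error whose ratio to the integral vanishes as N → ∞
(`le_hardyConst`). -/

namespace FracHardy

/-! ### Scalar inequalities for powers with exponent between 1 and 2 -/

/-- Weighted arithmetic-geometric mean inequality for two powers of one number. -/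
lemma rpow_convex_comb_le {a : ℝ} (ha : 0 < a) {θ η e f : ℝ} (hθ : 0 ≤ θ) (hη : 0 ≤ η)
    (h : θ + η = 1) : a ^ (θ * e + η * f) ≤ θ * a ^ e + η * a ^ f := by
  have := Real.geom_mean_le_arith_mean2_weighted hθ hη (Real.rpow_nonneg ha.le e)
    (Real.rpow_nonneg ha.le f) h
  rwa [← Real.rpow_mul ha.le, ← Real.rpow_mul ha.le, ← Real.rpow_add ha, mul_comm e,
    mul_comm f] at this

lemma rpow_half_sq {a : ℝ} (ha : 0 ≤ a) (p : ℝ) : (a ^ (p / 2)) ^ 2 = a ^ p := by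
  rw [← Real.rpow_natCast, ← Real.rpow_mul ha]; congr 1; push_cast; ring

/-- The Bregman distance of `z ↦ z ^ p` dominates the squared distance of the half powers. -/
lemma bregman_ge {p : ℝ} (hp : p ∈ Ioo (1 : ℝ) 2) {y a : ℝ} (hy : 0 ≤ y) (ha : 0 ≤ a) :
    (p - 1) * (y ^ (p / 2) - a ^ (p / 2)) ^ 2 ≤ y ^ p + (p - 1) * a ^ p - p * a ^ (p - 1) * y := by
  obtain ⟨h1, h2⟩ := hp
  have hp0 : 0 < p := by linarith
  -- Expanding the square, the claim is p a^(p-1) y ≤ (2-p) y^p + 2(p-1) (ya)^(p/2). The weights are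
  -- chosen so that the geometric mean of y^p and (ya)^(p/2) is a^(p-1) y.
  have key := Real.geom_mean_le_arith_mean2_weighted (w₁ := (2 - p) / p) (w₂ := 2 * (p - 1) / p)
    (by apply div_nonneg <;> linarith) (by apply div_nonneg <;> linarith)
    (Real.rpow_nonneg hy p) (mul_nonneg (Real.rpow_nonneg hy (p / 2)) (Real.rpow_nonneg ha (p / 2)))
    (by field_simp; ring)
  rw [Real.mul_rpow (Real.rpow_nonneg hy _) (Real.rpow_nonneg ha _), ← Real.rpow_mul hy,
    ← Real.rpow_mul hy, ← Real.rpow_mul ha, ← mul_assoc,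
    ← Real.rpow_add_of_nonneg hy (by field_simp; linarith) (by field_simp; linarith)] at key
  have e1 : p * ((2 - p) / p) + p / 2 * (2 * (p - 1) / p) = 1 := by field_simp; ring
  have e2 : p / 2 * (2 * (p - 1) / p) = p - 1 := by field_simp
  rw [e1, e2, Real.rpow_one] at key
  have := rpow_half_sq hy p
  have := rpow_half_sq ha p
  have k2 := mul_le_mul_of_nonneg_left key hp0.le
  have e3 : p * ((2 - p) / p * y ^ p + 2 * (p - 1) / p * (y ^ (p / 2) * a ^ (p / 2)))
      = (2 - p) * y ^ p + 2 * (p - 1) * (y ^ (p / 2) * a ^ (p / 2)) := by field_simp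
  rw [e3] at k2
  nlinarith

/-- The difference of the sides has derivative p(1 + x^(p-1) - (1+x)^(p-1)), nonnegative because
x^(p-1) is subadditive. -/
lemma one_add_rpow_le {p : ℝ} (hp : p ∈ Ioo (1 : ℝ) 2) {b : ℝ} (hb : 0 ≤ b) : (1 + b) ^ p ≤ 1 + p * b + b ^ p := by
  obtain ⟨h1, h2⟩ := hp
  let f : ℝ → ℝ := fun b => 1 + p * b + b ^ p - (1 + b) ^ p
  have hder : ∀ x ∈ Ioi (0:ℝ), HasDerivAt f (p + p * x ^ (p - 1) - p * (1 + x) ^ (p - 1)) x := by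
    intro x hx
    have a1 : HasDerivAt (fun b : ℝ => b ^ p) (p * x ^ (p - 1)) x :=
      Real.hasDerivAt_rpow_const (Or.inr h1.le)
    have a2 : HasDerivAt (fun b : ℝ => (1 + b) ^ p) (p * (1 + x) ^ (p - 1)) x := by
      have := ((hasDerivAt_id x).const_add 1).rpow_const (p := p) (Or.inr h1.le)
      simpa using this
    have a3 : HasDerivAt (fun b : ℝ => 1 + p * b) p x := by
      simpa using ((hasDerivAt_id x).const_mul p).const_add 1
    exact (a3.add a1).sub a2
  have hmono : MonotoneOn f (Ici 0) := by
    apply monotoneOn_of_deriv_nonneg (convex_Ici 0)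
    · apply Continuous.continuousOn
      have : Continuous fun b : ℝ => b ^ p := Real.continuous_rpow_const (by linarith)
      have : Continuous fun b : ℝ => (1 + b) ^ p := this.comp (by fun_prop)
      fun_prop
    · rw [interior_Ici]
      exact fun x hx => (hder x hx).differentiableAt.differentiableWithinAt
    · rw [interior_Ici]
      intro x hx
      rw [(hder x hx).deriv]
      have := Real.rpow_add_le_add_rpow zero_le_one (le_of_lt hx) (by linarith : 0 ≤ p - 1)
        (by linarith)
      rw [Real.one_rpow] at this
      nlinarith
  have := hmono (mem_Ici.2 le_rfl) (mem_Ici.2 hb) hb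
  simp only [f, Real.zero_rpow (by linarith : p ≠ 0)] at this
  norm_num at this
  linarith

/-! ### The pointwise remainder inequality with b = 1, by sign of a -/

section Pointwise
variable {p t : ℝ} (hp : p ∈ Ioo (1 : ℝ) 2) (ht : t ∈ Ioo (0 : ℝ) 1)
include hp ht

/-- After expansion this says that (1-t)^(p/2) is at most the mean of 1-t and (1-t)^(p-1). It bounds
the root of the left side by the drop of z ↦ (1-tz)^(p/2) over [0,1]; `one_sub_rpow_le_mul` bounds
it by 2/p times the slope at z = 1, up to sign. -/
lemma one_sub_rpow_le_sq :
    t * (1 - (1 - t) ^ (p - 1)) ≤ (1 - (1 - t) ^ (p / 2)) ^ 2 := by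
  obtain ⟨h1, h2⟩ := hp
  obtain ⟨t0, t1⟩ := ht
  have hm : 0 < 1 - t := by linarith
  have e := rpow_half_sq hm.le p
  have e' : (1 - t) ^ p = (1 - t) * (1 - t) ^ (p - 1) := by
    rw [← Real.rpow_one_add' hm.le (by linarith)]; congr 1; ring
  have := rpow_convex_comb_le hm (θ := 1 / 2) (η := 1 / 2) (e := 1) (f := p - 1)
    (by norm_num) (by norm_num) (by norm_num)
  rw [show (1 / 2 * 1 + 1 / 2 * (p - 1)) = p / 2 by ring, Real.rpow_one] at this
  nlinarith

lemma one_sub_rpow_le_mul :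
    t * (1 - (1 - t) ^ (p - 1)) ≤ (t * (1 - t) ^ (p / 2 - 1)) ^ 2 := by
  obtain ⟨h1, h2⟩ := hp
  obtain ⟨t0, t1⟩ := ht
  have hm : 0 < 1 - t := by linarith
  have e : ((1 - t) ^ (p / 2 - 1)) ^ 2 = (1 - t) ^ (p - 2) := by
    rw [← Real.rpow_natCast, ← Real.rpow_mul hm.le]; congr 1; push_cast; ring
  have e' : (1 - t) ^ (p - 1) = (1 - t) * (1 - t) ^ (p - 2) := by
    nth_rewrite 2 [← Real.rpow_one (1 - t)]
    rw [← Real.rpow_add hm]; congr 1; ring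
  have : 1 ≤ (1 - t) ^ (p - 2) :=
    Real.one_le_rpow_of_pos_of_le_one_of_nonpos hm (by linarith) (by linarith)
  rw [mul_pow, e, e']
  nlinarith

lemma one_le_rpow_add_rpow : 1 ≤ t ^ (p - 1) + (1 - t) ^ (p - 1) := by
  obtain ⟨h1, h2⟩ := hp
  obtain ⟨t0, t1⟩ := ht
  have := Real.rpow_add_le_add_rpow t0.le (by linarith : 0 ≤ 1 - t) (by linarith : 0 ≤ p - 1)
    (by linarith)
  simpa using this

lemma one_sub_rpow_le_rpow : t * (1 - (1 - t) ^ (p - 1)) ≤ t ^ p := by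
  have := one_le_rpow_add_rpow hp ht
  obtain ⟨h1, h2⟩ := hp
  obtain ⟨t0, t1⟩ := ht
  have e' : t ^ p = t * t ^ (p - 1) := by
    rw [← Real.rpow_one_add' t0.le (by linarith)]; congr 1; ring
  rw [e']
  nlinarith

/-- The half-power estimate behind the first-order remainder, for `t ≤ a`. -/
lemma half_power_gap {a : ℝ} (ha : t ≤ a) :
    t * (1 - (1 - t) ^ (p - 1)) * (a ^ (p / 2) - 1) ^ 2 ≤
      ((a - t) ^ (p / 2) - ((1 - t) * a) ^ (p / 2)) ^ 2 := by
  have f1 := one_sub_rpow_le_mul hp ht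
  have f2 := one_sub_rpow_le_sq hp ht
  obtain ⟨h1, h2⟩ := hp
  obtain ⟨t0, t1⟩ := ht
  have ha0 : 0 < a := by linarith
  have hm : 0 < 1 - t := by linarith
  have hM : (1 - t) ^ (p - 1) ≤ 1 := Real.rpow_le_one hm.le (by linarith) (by linarith)
  have hmq : (1 - t) ^ (p / 2) ≤ 1 := Real.rpow_le_one hm.le (by linarith) (by linarith)
  have hc0 : 0 ≤ t * (1 - (1 - t) ^ (p - 1)) := mul_nonneg t0.le (by linarith)
  obtain ⟨c, hc, hc2⟩ : ∃ c, 0 ≤ c ∧ c ^ 2 = t * (1 - (1 - t) ^ (p - 1)) :=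
    ⟨_, Real.sqrt_nonneg _, Real.sq_sqrt hc0⟩
  rw [← hc2] at f1 f2 ⊢
  have g1 : c ≤ t * (1 - t) ^ (p / 2 - 1) :=
    le_of_sq_le_sq f1 (mul_nonneg t0.le (Real.rpow_nonneg hm.le _))
  have g2 : c ≤ 1 - (1 - t) ^ (p / 2) := le_of_sq_le_sq f2 (by linarith)
  have hz : 0 < a⁻¹ := inv_pos.2 ha0
  have hS : 0 < a ^ (p / 2) := Real.rpow_pos_of_pos ha0 _
  have hzS : (a⁻¹) ^ (p / 2) * a ^ (p / 2) = 1 := by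
    rw [← Real.mul_rpow hz.le ha0.le, inv_mul_cancel₀ ha0.ne', Real.one_rpow]
  have hd : (a - t) ^ (p / 2) = (1 - t * a⁻¹) ^ (p / 2) * a ^ (p / 2) := by
    rw [← Real.mul_rpow _ ha0.le]
    · congr 1; field_simp
    · rw [sub_nonneg, ← div_eq_mul_inv, div_le_one ha0]; exact ha
  rw [hd, Real.mul_rpow hm.le ha0.le, ← sub_mul, mul_pow, ← mul_pow]
  have hS1 : a ^ (p / 2) - 1 = (1 - (a⁻¹) ^ (p / 2)) * a ^ (p / 2) := by rw [sub_mul, hzS]; ring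
  rw [hS1, ← mul_assoc, mul_pow]
  apply mul_le_mul_of_nonneg_right _ (by positivity)
  have hz_nonneg : 0 ≤ 1 - t * a⁻¹ := by
    rw [sub_nonneg, ← div_eq_mul_inv, div_le_one ha0]; exact ha
  -- After division by a^p the claim compares c|1 - z^(p/2)| with the increment of z ↦ (1-tz)^(p/2)
  -- between z and 1. This function is concave: its chord over [0,1] serves for z ≤ 1 (through g2),
  -- its tangent at 1 for z ≥ 1 (through g1).
  set z := a⁻¹
  rcases le_total z 1 with hz1 | hz1
  · have h5 : (1 - z) + z * (1 - t) ^ (p / 2) ≤ (1 - t * z) ^ (p / 2) := by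
      have := (Real.concaveOn_rpow (p := p / 2) (by linarith) (by linarith)).2
        (show (1 : ℝ) ∈ Ici 0 by simp) (show 1 - t ∈ Ici (0 : ℝ) by simpa using hm.le)
        (show 0 ≤ 1 - z by linarith) hz.le (by ring)
      simp only [smul_eq_mul, Real.one_rpow, mul_one] at this
      rwa [show 1 - t * z = 1 - z + z * (1 - t) by ring]
    have h6 : z ≤ z ^ (p / 2) := by
      have := Real.rpow_le_rpow_of_exponent_ge hz hz1 (show p / 2 ≤ 1 by linarith)
      rwa [Real.rpow_one] at this
    have h7 : z ^ (p / 2) ≤ 1 := Real.rpow_le_one hz.le hz1 (by linarith)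
    apply pow_le_pow_left₀ (mul_nonneg hc (by linarith))
    nlinarith
  · have h5 : (1 - t * z) ^ (p / 2) ≤ (1 - t) ^ (p / 2)
        - p / 2 * (t * (1 - t) ^ (p / 2 - 1)) * (z - 1) := by
      have hle : -1 ≤ -(t * (z - 1) / (1 - t)) := by
        rw [neg_le_neg_iff, div_le_one hm]; nlinarith
      have := rpow_one_add_le_one_add_mul_self hle
        (p := p / 2) (by linarith) (by linarith)
      have hh : 1 - t * z = (1 - t) * (1 + -(t * (z - 1) / (1 - t))) := by field_simp; ring
      rw [hh, Real.mul_rpow hm.le (by linarith)]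
      refine (mul_le_mul_of_nonneg_left this (Real.rpow_nonneg hm.le _)).trans (le_of_eq ?_)
      rw [Real.rpow_sub_one hm.ne']; field_simp; ring
    have h6 : z ^ (p / 2) ≤ 1 + p / 2 * (z - 1) := by
      have := rpow_one_add_le_one_add_mul_self (s := z - 1) (by linarith)
        (p := p / 2) (by linarith) (by linarith)
      simpa using this
    have h7 : 1 ≤ z ^ (p / 2) := Real.one_le_rpow hz1 (by linarith)
    have h8 : c * (z ^ (p / 2) - 1) ≤ (1 - t) ^ (p / 2) - (1 - t * z) ^ (p / 2) := by
      have h9 : c * (z ^ (p / 2) - 1) ≤ c * (p / 2 * (z - 1)) :=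
        mul_le_mul_of_nonneg_left (by linarith) hc
      have h10 : c * (p / 2 * (z - 1)) ≤ (t * (1 - t) ^ (p / 2 - 1)) * (p / 2 * (z - 1)) :=
        mul_le_mul_of_nonneg_right g1 (mul_nonneg (by linarith) (by linarith))
      linarith
    have := pow_le_pow_left₀ (mul_nonneg hc (by linarith)) h8 2
    nlinarith

/-- The sharp pointwise inequality for numbers of the same sign. -/
lemma pointwise_same_sign_one {a : ℝ} (ha : 0 ≤ a) :
    (1 - t) ^ (p - 1) * a ^ p + (p - 1) * t * (a ^ (p / 2) - 1) ^ 2 ≤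
      |a - t| ^ p + (1 - t) ^ (p - 1) * t := by
  obtain ⟨h1, h2⟩ := id hp
  obtain ⟨t0, t1⟩ := id ht
  have hm : 0 < 1 - t := by linarith
  have hB1 := bregman_ge hp zero_le_one ha
  rw [Real.one_rpow, Real.one_rpow] at hB1
  have hMpos : 0 < (1 - t) ^ (p - 1) := Real.rpow_pos_of_pos hm _
  have e1 : (1 - t) ^ p = (1 - t) * (1 - t) ^ (p - 1) := by
    rw [← Real.rpow_one_add' hm.le (by linarith)]; congr 1; ring
  have e2 : a ^ p = a * a ^ (p - 1) := by
    rw [← Real.rpow_one_add' ha (by linarith)]; congr 1; ring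
  have hM1 := one_sub_rpow_le_rpow hp ht
  -- With M = (1-t)^(p-1), the quantity |a-t|^p - M a^p + M t is exactly tM times the Bregman
  -- expression at (1, a) plus the one at (a-t, (1-t)a). The first yields the part tM of the
  -- coefficient t of (p-1)(a^(p/2)-1)^2; the second has to yield t(1-M).
  suffices h : (p - 1) * (t * (1 - (1 - t) ^ (p - 1)) * (a ^ (p / 2) - 1) ^ 2) ≤
      |a - t| ^ p + (p - 1) * ((1 - t) * a) ^ p - p * ((1 - t) * a) ^ (p - 1) * (a - t) by
    rw [Real.mul_rpow hm.le ha, Real.mul_rpow hm.le ha, e1] at h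
    have k := mul_le_mul_of_nonneg_left hB1 (mul_nonneg t0.le hMpos.le)
    rw [e2] at k h ⊢
    nlinarith
  rcases le_or_gt t a with hta | hta
  · rw [abs_of_nonneg (by linarith)]
    refine (mul_le_mul_of_nonneg_left (half_power_gap hp ht hta) (by linarith)).trans ?_
    exact bregman_ge hp (by linarith) (mul_nonneg hm.le ha)
  -- The first Bregman argument is now negative, -Q with Q = t-a. With P = (1-t)a one has P + Q =
  -- t(1-a), so the required term is at most (p-1)(P+Q)^p, and (P+Q)^p ≤ P^p + p P^(p-1) Q + Q^p
  -- finishes.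
  · have hP : 0 ≤ (1 - t) * a := mul_nonneg hm.le ha
    have hQ : 0 < t - a := by linarith
    rw [abs_of_neg (by linarith), neg_sub]
    have c1 : (a ^ (p / 2) - 1) ^ 2 ≤ (1 - a) ^ p := by
      have h3 := Real.rpow_add_le_add_rpow ha (by linarith : 0 ≤ 1 - a)
        (by linarith : 0 ≤ p / 2) (by linarith)
      rw [add_sub_cancel, Real.one_rpow] at h3
      have h4 : a ^ (p / 2) ≤ 1 := Real.rpow_le_one ha (by linarith) (by linarith)
      rw [← rpow_half_sq (by linarith : 0 ≤ 1 - a)]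
      nlinarith
    have c2 : t * (1 - (1 - t) ^ (p - 1)) * (a ^ (p / 2) - 1) ^ 2 ≤
        ((1 - t) * a + (t - a)) ^ p := by
      rw [show (1 - t) * a + (t - a) = t * (1 - a) by ring,
        Real.mul_rpow t0.le (by linarith)]
      exact mul_le_mul hM1 c1 (sq_nonneg _) (Real.rpow_nonneg t0.le _)
    refine (mul_le_mul_of_nonneg_left c2 (by linarith)).trans ?_
    rcases hP.eq_or_lt with h0 | h0
    · rw [← h0, zero_add, Real.zero_rpow (by linarith), Real.zero_rpow (by linarith)]
      have := Real.rpow_nonneg hQ.le p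
      nlinarith
    · set P := (1 - t) * a
      set Q := t - a
      have k := one_add_rpow_le hp (div_nonneg hQ.le h0.le)
      have eq : (P + Q) ^ p = P ^ p * (1 + Q / P) ^ p := by
        rw [← Real.mul_rpow h0.le (by positivity)]; congr 1; field_simp
      have hPp : 0 < P ^ p := Real.rpow_pos_of_pos h0 _
      have k2 := mul_le_mul_of_nonneg_left k hPp.le
      have e3 : P ^ p * (Q / P) ^ p = Q ^ p := by
        rw [← Real.mul_rpow h0.le (by positivity)]; congr 1; field_simp
      have e4 : P ^ p * (p * (Q / P)) = p * P ^ (p - 1) * Q := by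
        rw [Real.rpow_sub_one h0.ne']; field_simp
      rw [mul_add, mul_add, e3, e4, mul_one, ← eq] at k2
      have hQp : 0 < Q ^ p := Real.rpow_pos_of_pos hQ _
      have hPQ : 0 ≤ p * P ^ (p - 1) * Q :=
        mul_nonneg (mul_nonneg (by linarith) (Real.rpow_nonneg h0.le _)) hQ.le
      have aeq : a - t = -Q := by simp [Q]
      rw [aeq]
      nlinarith

/-- The pointwise inequality for numbers of opposite signs, with constant `(p - 1) / p`. -/
lemma pointwise_opposite_sign_one_left {a : ℝ} (ha : 0 ≤ a) :
    (1 - t) ^ (p - 1) * a ^ p + (p - 1) / p * t * (a ^ (p / 2) + 1) ^ 2 ≤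
      (a + t) ^ p + (1 - t) ^ (p - 1) * t := by
  have hM1 := one_sub_rpow_le_rpow hp ht
  obtain ⟨h1, h2⟩ := id hp
  obtain ⟨t0, t1⟩ := id ht
  have hm : 0 < 1 - t := by linarith
  have hs := rpow_half_sq ha p
  -- The gap, multiplied by p, is the square ((p-1) a^(p/2) - 1)^2; this is where the constant
  -- (p-1)/p arises.
  have h3 : (p - 1) / p * (a ^ (p / 2) + 1) ^ 2 ≤ (p - 1) * a ^ p + 1 := by
    rw [← hs, div_mul_eq_mul_div, div_le_iff₀ (by linarith)]
    nlinarith [sq_nonneg ((p - 1) * a ^ (p / 2) - 1)]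
  have h4 : (1 - t) ^ (p - 1) ≤ 1 - (p - 1) * t := by
    have := rpow_one_add_le_one_add_mul_self (s := -t) (by linarith) (p := p - 1)
      (by linarith) (by linarith)
    rw [← sub_eq_add_neg] at this
    linarith
  have h5 := Real.add_rpow_le_rpow_add ha t0.le h1.le
  have h6 := Real.rpow_nonneg ha p
  have h7 := mul_le_mul_of_nonneg_left h3 t0.le
  have h8 := mul_le_mul_of_nonneg_right h4 h6
  linarith

/-- The right side is the second Taylor polynomial at 0; monotonicity of the gap reduces to
(1-x)^(p-2) ≥ 1 + (2-p)x. -/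
lemma one_sub_rpow_le_quadratic :
    (1 - t) ^ (p - 1) ≤ 1 - (p - 1) * t - (p - 1) * (2 - p) / 2 * t ^ 2 := by
  obtain ⟨h1, h2⟩ := id hp
  obtain ⟨t0, t1⟩ := id ht
  let f : ℝ → ℝ := fun t => 1 - (p - 1) * t - (p - 1) * (2 - p) / 2 * t ^ 2 - (1 - t) ^ (p - 1)
  have hder : ∀ x ∈ Ioo (0:ℝ) 1, HasDerivAt f (0 - (p - 1) - (p - 1) * (2 - p) / 2 * (2 * x)
      - -((p - 1) * (1 - x) ^ (p - 1 - 1))) x := by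
    intro x hx
    have a2 : HasDerivAt (fun b : ℝ => (1 - b) ^ (p - 1)) (-((p - 1) * (1 - x) ^ (p - 1 - 1))) x := by
      have := ((hasDerivAt_id x).const_sub 1).rpow_const (p := p - 1)
        (Or.inl (by simpa using (sub_pos.2 hx.2).ne'))
      exact this.congr_deriv (by simp; ring)
    have a3 : HasDerivAt (fun b : ℝ => (p - 1) * b) (p - 1) x := by
      simpa using (hasDerivAt_id x).const_mul (p - 1)
    have a4 : HasDerivAt (fun b : ℝ => (p - 1) * (2 - p) / 2 * b ^ 2)
        ((p - 1) * (2 - p) / 2 * (2 * x)) x := by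
      simpa using ((hasDerivAt_id x).pow 2).const_mul ((p - 1) * (2 - p) / 2)
    exact (((hasDerivAt_const x 1).sub a3).sub a4).sub a2
  have hmono : MonotoneOn f (Icc 0 1) := by
    apply monotoneOn_of_deriv_nonneg (convex_Icc 0 1)
    · apply Continuous.continuousOn
      have : Continuous fun b : ℝ => b ^ (p - 1) := Real.continuous_rpow_const (by linarith)
      have : Continuous fun b : ℝ => (1 - b) ^ (p - 1) := this.comp (by fun_prop)
      fun_prop
    · rw [interior_Icc]
      exact fun x hx => (hder x hx).differentiableAt.differentiableWithinAt
    · rw [interior_Icc]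
      intro x hx
      rw [(hder x hx).deriv]
      have hx1 : 0 < 1 - x := sub_pos.2 hx.2
      have k : 1 + (2 - p) * x ≤ (1 - x) ^ (p - 1 - 1) := by
        rw [Real.rpow_def_of_pos hx1]
        have l1 := Real.log_le_sub_one_of_pos hx1
        have l2 := Real.add_one_le_exp (Real.log (1 - x) * (p - 1 - 1))
        nlinarith
      nlinarith
  have := hmono (left_mem_Icc.2 zero_le_one) ⟨t0.le, t1.le⟩ t0.le
  simp only [f] at this
  norm_num at this
  linarith

/-- Concavity of x^(p-1) gives (a+tτ)^(p-1) ≥ (1-t) a^(p-1) + t (a+τ)^(p-1). Multiplying by tp and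
integrating over 0 ≤ τ ≤ 1 gives the claim; the integration is carried out as monotonicity of f. -/
lemma add_rpow_ge_interp {a : ℝ} (ha : 0 ≤ a) :
    a ^ p + t * ((1 - t) * (p * a ^ (p - 1)) + t * ((a + 1) ^ p - a ^ p)) ≤ (a + t) ^ p := by
  obtain ⟨h1, h2⟩ := id hp
  obtain ⟨t0, t1⟩ := id ht
  let f : ℝ → ℝ := fun τ => (a + t * τ) ^ p - t * (1 - t) * (p * a ^ (p - 1)) * τ
    - t ^ 2 * (a + τ) ^ p
  have hder : ∀ x, HasDerivAt f (t * p * (a + t * x) ^ (p - 1)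
      - t * (1 - t) * (p * a ^ (p - 1)) - t ^ 2 * (p * (a + x) ^ (p - 1))) x := by
    intro x
    have a1 : HasDerivAt (fun τ : ℝ => (a + t * τ) ^ p) (t * p * (a + t * x) ^ (p - 1)) x := by
      have := (((hasDerivAt_id x).const_mul t).const_add a).rpow_const (p := p) (Or.inr h1.le)
      simpa using this
    have a2 : HasDerivAt (fun τ : ℝ => (a + τ) ^ p) (p * (a + x) ^ (p - 1)) x := by
      have := ((hasDerivAt_id x).const_add a).rpow_const (p := p) (Or.inr h1.le)
      simpa using this
    have a3 : HasDerivAt (fun b : ℝ => t * (1 - t) * (p * a ^ (p - 1)) * b)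
        (t * (1 - t) * (p * a ^ (p - 1))) x := by
      simpa using (hasDerivAt_id x).const_mul (t * (1 - t) * (p * a ^ (p - 1)))
    exact (a1.sub a3).sub (a2.const_mul (t ^ 2))
  have hmono : MonotoneOn f (Icc 0 1) := by
    apply monotoneOn_of_deriv_nonneg (convex_Icc 0 1)
    · exact fun x _ => (hder x).continuousAt.continuousWithinAt
    · exact fun x _ => (hder x).differentiableAt.differentiableWithinAt
    · rw [interior_Icc]
      intro x hx
      rw [(hder x).deriv]
      have := (Real.concaveOn_rpow (p := p - 1) (by linarith) (by linarith)).2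
        (show a ∈ Ici (0:ℝ) from ha) (show a + x ∈ Ici (0 : ℝ) from add_nonneg ha hx.1.le)
        (show 0 ≤ 1 - t by linarith) t0.le (by ring)
      simp only [smul_eq_mul] at this
      rw [show (1 - t) * a + t * (a + x) = a + t * x by ring] at this
      have k := mul_le_mul_of_nonneg_left this (show 0 ≤ t * p by nlinarith)
      linarith
  have := hmono (left_mem_Icc.2 zero_le_one) (right_mem_Icc.2 zero_le_one) zero_le_one
  simp only [f, mul_zero, mul_one, add_zero] at this
  linarith

-- The Taylor coefficient p(p-1)/2 is weakened by a factor p-1 to make the bound valid up to y = 1.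
-- The derivative needs (1+x)^(p-1) ≥ 1 + (p-1)^2 x, obtained by writing the left side as
-- (1+x)/(1+x)^(2-p) and applying Bernoulli to the denominator.
omit ht in
lemma one_add_rpow_ge_quadratic {y : ℝ} (hy : y ∈ Icc (0 : ℝ) 1) :
    1 + p * y + p * (p - 1) ^ 2 / 2 * y ^ 2 ≤ (1 + y) ^ p := by
  obtain ⟨h1, h2⟩ := id hp
  let f : ℝ → ℝ := fun y => (1 + y) ^ p - p * y - p * (p - 1) ^ 2 / 2 * y ^ 2
  have hder : ∀ x, HasDerivAt f (p * (1 + x) ^ (p - 1) - p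
      - p * (p - 1) ^ 2 / 2 * (2 * x)) x := by
    intro x
    have a2 : HasDerivAt (fun τ : ℝ => (1 + τ) ^ p) (p * (1 + x) ^ (p - 1)) x := by
      have := ((hasDerivAt_id x).const_add 1).rpow_const (p := p) (Or.inr h1.le)
      simpa using this
    have a3 : HasDerivAt (fun b : ℝ => p * b) p x := by
      simpa using (hasDerivAt_id x).const_mul p
    have a4 : HasDerivAt (fun b : ℝ => p * (p - 1) ^ 2 / 2 * b ^ 2)
        (p * (p - 1) ^ 2 / 2 * (2 * x)) x := by
      simpa using ((hasDerivAt_id x).pow 2).const_mul (p * (p - 1) ^ 2 / 2)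
    exact (a2.sub a3).sub a4
  have hmono : MonotoneOn f (Icc 0 1) := by
    apply monotoneOn_of_deriv_nonneg (convex_Icc 0 1)
    · exact fun x _ => (hder x).continuousAt.continuousWithinAt
    · exact fun x _ => (hder x).differentiableAt.differentiableWithinAt
    · rw [interior_Icc]
      intro x hx
      rw [(hder x).deriv]
      have hx1 : 0 < 1 + x := by linarith [hx.1]
      have k1 : (1 + x) ^ (2 - p) ≤ 1 + (2 - p) * x :=
        rpow_one_add_le_one_add_mul_self (by linarith [hx.1]) (by linarith) (by linarith)
      have k2 : (1 + x) ^ (p - 1) * (1 + x) ^ (2 - p) = 1 + x := by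
        rw [← Real.rpow_add hx1, show p - 1 + (2 - p) = 1 by ring, Real.rpow_one]
      have k3 : 0 < (1 + x) ^ (p - 1) := Real.rpow_pos_of_pos hx1 _
      have k4 : 0 < 1 + (2 - p) * x := by nlinarith [hx.1]
      have k5 : 1 + (p - 1) ^ 2 * x ≤ (1 + x) ^ (p - 1) := by
        have k6 : 1 + x ≤ (1 + x) ^ (p - 1) * (1 + (2 - p) * x) := by
          rw [← k2]
          rw [k2]
          calc 1 + x = (1 + x) ^ (p - 1) * (1 + x) ^ (2 - p) := k2.symm
            _ ≤ _ := mul_le_mul_of_nonneg_left k1 k3.le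
        have k7 : (1 + (p - 1) ^ 2 * x) * (1 + (2 - p) * x) ≤ 1 + x := by
          have k8 : 0 ≤ (p - 1) * (2 - p) * x := by
            have := hx.1; apply mul_nonneg _ this.le; nlinarith
          have k9 : (p - 1) * x ≤ 1 := by nlinarith [hx.1, hx.2]
          nlinarith [mul_le_mul_of_nonneg_left k9 k8]
        exact le_of_mul_le_mul_right (k7.trans k6) k4
      nlinarith
  have := hmono (left_mem_Icc.2 zero_le_one) hy hy.1
  simp only [f] at this
  norm_num at this
  linarith

omit ht in
lemma half_power_le_first_order {a : ℝ} (ha : 0 < a) :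
    p * (p - 1) / 2 * (a ^ (p / 2) + 1) ^ 2 ≤ p * a ^ (p - 1) + (p - 1) * a ^ p + 1 := by
  obtain ⟨h1, h2⟩ := id hp
  have hp0 : 0 < p := by linarith
  -- The factors 1/p and p^(2/p-1) cancel in the geometric mean, leaving a^(p/2). The 1/p is chosen
  -- so that the a^p terms add up to exactly (p-1) a^p; the a^(p-1) term then has to satisfy hK2.
  have key := Real.geom_mean_le_arith_mean2_weighted (w₁ := 1 - p / 2) (w₂ := p / 2)
    (p₁ := a ^ p / p) (p₂ := a ^ (p - 1) * p ^ (2 / p - 1))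
    (by linarith) (by linarith) (by positivity) (by positivity) (by ring)
  have e1 : (a ^ p / p) ^ (1 - p / 2) * (a ^ (p - 1) * p ^ (2 / p - 1)) ^ (p / 2) = a ^ (p / 2) := by
    rw [Real.mul_rpow (by positivity) (by positivity), Real.div_rpow (by positivity) hp0.le,
      ← Real.rpow_mul ha.le, ← Real.rpow_mul ha.le, ← Real.rpow_mul hp0.le,
      show (2 / p - 1) * (p / 2) = 1 - p / 2 by field_simp]
    have : (p : ℝ) ^ (1 - p / 2) ≠ 0 := by positivity
    rw [div_mul_eq_mul_div, ← mul_assoc, mul_div_assoc, div_self this, mul_one,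
      ← Real.rpow_add ha]
    congr 1; ring
  rw [e1] at key
  have hK : p ^ (2 / p - 1) ≤ 1 + (2 / p - 1) * (p - 1) := by
    have h3 : 1 ≤ 2 / p := by rw [le_div_iff₀ hp0]; linarith
    have h4 : 2 / p ≤ 2 := by rw [div_le_iff₀ hp0]; linarith
    have := rpow_one_add_le_one_add_mul_self (s := p - 1) (by linarith) (p := 2 / p - 1)
      (by linarith) (by linarith)
    simpa using this
  have hK2 : p * (p - 1) * (p / 2 * p ^ (2 / p - 1)) ≤ p := by
    have k1 : p * (1 + (2 / p - 1) * (p - 1)) = 2 - (2 - p) ^ 2 + 0 := by field_simp; ring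
    have k2 := mul_le_mul_of_nonneg_left hK hp0.le
    have k3 : p * p ^ (2 / p - 1) ≤ 2 := by nlinarith [sq_nonneg (2 - p)]
    have k4 : 0 ≤ p * p ^ (2 / p - 1) := by positivity
    nlinarith
  have hs := rpow_half_sq ha.le p
  have hA : 0 < a ^ p := by positivity
  have hB : 0 < a ^ (p - 1) := by positivity
  have k5 := mul_le_mul_of_nonneg_left key (show 0 ≤ p * (p - 1) by nlinarith)
  have k6 := mul_le_mul_of_nonneg_right hK2 hB.le
  have e2 : p * (p - 1) * ((1 - p / 2) * (a ^ p / p)) = (p - 1) * (1 - p / 2) * a ^ p := by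
    field_simp
  have k7 : p * (p - 1) / 2 ≤ 1 := by nlinarith
  rw [mul_add, e2] at k5
  rw [add_sq, hs]
  nlinarith

omit ht in
lemma half_power_le_second_order {a : ℝ} (ha : 0 < a) (h : a ≤ 1) :
    p * (p - 1) / 2 * (a ^ (p / 2) + 1) ^ 2 ≤ ((a + 1) ^ p - a ^ p)
      + (p - 1) * (4 - p) / 2 * a ^ p := by
  have hs := rpow_half_sq ha.le p
  have hA : 0 < a ^ p := by have := ha; positivity
  obtain ⟨h1, h2⟩ := id hp
  have h70 : 0 ≤ p * (p - 1) := by nlinarith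
  have k1 := one_add_rpow_ge_quadratic hp (y := a) ⟨ha.le, h⟩
  rw [add_comm 1 a] at k1
  have k3 := rpow_convex_comb_le ha (θ := 1 - p / 2) (η := p / 2) (e := 0) (f := 1)
    (by linarith) (by linarith) (by ring)
  rw [show (1 - p / 2) * 0 + p / 2 * 1 = p / 2 by ring, Real.rpow_zero, Real.rpow_one] at k3
  have k4 := rpow_convex_comb_le ha (θ := 2 - p) (η := p - 1) (e := 1) (f := 2)
    (by linarith) (by linarith) (by ring)
  rw [show (2 - p) * 1 + (p - 1) * 2 = p by ring, Real.rpow_one, Real.rpow_two] at k4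
  have k3' := mul_le_mul_of_nonneg_left k3 h70
  have hp12 : 0 ≤ (p - 1) * (2 - p) := by nlinarith
  have k5 : 0 ≤ (2 - p) * (2 - (p - 1) ^ 2) / 2 := by
    apply div_nonneg (mul_nonneg (by linarith) (by nlinarith)) (by norm_num)
  have k6 : 0 ≤ (p - 1) * (2 - p) * (p + 1) * (a * (1 - a)) :=
    mul_nonneg (mul_nonneg hp12 (by linarith)) (mul_nonneg ha.le (by linarith))
  have k7 := mul_nonneg hp12 hA.le
  have k8 := mul_nonneg hp12 ha.le
  rw [add_sq, hs]
  linarith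

omit ht in
lemma half_power_le_second_order_of_one_le {a : ℝ} (h : 1 ≤ a) :
    p * (p - 1) / 2 * (a ^ (p / 2) + 1) ^ 2 ≤ p * a ^ (p - 1)
      + p * (p - 1) ^ 2 / 2 * a ^ (p - 2) + (p - 1) * (4 - p) / 2 * a ^ p := by
  have ha : 0 < a := by linarith
  have hs := rpow_half_sq ha.le p
  have hA : 0 < a ^ p := by have := ha; positivity
  have hB : 0 < a ^ (p - 1) := by have := ha; positivity
  obtain ⟨h1, h2⟩ := id hp
  have h70 : 0 ≤ p * (p - 1) := by nlinarith
  have k3 := rpow_convex_comb_le ha (θ := 1 - p / 2) (η := p / 2) (e := p) (f := p - 1)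
    (by linarith) (by linarith) (by ring)
  rw [show (1 - p / 2) * p + p / 2 * (p - 1) = p / 2 by ring] at k3
  have k4 := rpow_convex_comb_le ha (θ := 2 - p) (η := p - 1) (e := p - 1) (f := p - 2)
    (by linarith) (by linarith) (by ring)
  rw [show (2 - p) * (p - 1) + (p - 1) * (p - 2) = 0 by ring, Real.rpow_zero] at k4
  have k3' := mul_le_mul_of_nonneg_left k3 h70
  have k4' := mul_le_mul_of_nonneg_left k4 (div_nonneg h70 zero_le_two)
  have hA' : 0 ≤ (p - 1) * (2 - p) ^ 2 / 2 * a ^ p :=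
    mul_nonneg (by have := sq_nonneg (2 - p); nlinarith) hA.le
  have hB' : 0 ≤ p * (2 - p) * a ^ (p - 1) := mul_nonneg (by nlinarith) hB.le
  rw [add_sq, hs]
  linarith

/-- The pointwise inequality for numbers of opposite signs, with constant `p (p - 1) / 2`. -/
lemma pointwise_opposite_sign_one_right {a : ℝ} (ha : 0 ≤ a) :
    (1 - t) ^ (p - 1) * a ^ p + p * (p - 1) / 2 * t * (a ^ (p / 2) + 1) ^ 2 ≤
      (a + t) ^ p + (1 - t) ^ (p - 1) * t := by
  -- Each bound is arranged as t((1-t)A + tB): the quadratic bound on (1-t)^(p-1), the bound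
  -- (1-t)^(p-1) ≥ 1-t, and a lower bound for (a+t)^p. It then suffices to dominate p(p-1)/2
  -- (a^(p/2)+1)^2 by A (first order) and by B (second order) separately.
  have hq := one_sub_rpow_le_quadratic hp ht
  have hM1 := one_sub_rpow_le_rpow hp ht
  have hint := add_rpow_ge_interp hp ht ha
  have hquad := fun y hy => one_add_rpow_ge_quadratic hp (y := y) hy
  obtain ⟨h1, h2⟩ := id hp
  obtain ⟨t0, t1⟩ := id ht
  have hm : 0 < 1 - t := by linarith
  have h7 : p * (p - 1) / 2 ≤ 1 := by nlinarith
  have h70 : 0 ≤ p * (p - 1) := by nlinarith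
  rcases ha.eq_or_lt with rfl | ha
  · rw [Real.zero_rpow (by linarith), Real.zero_rpow (by linarith)]
    norm_num
    nlinarith
  have hZ0 := half_power_le_first_order hp ha
  have hs := rpow_half_sq ha.le p
  have hA : 0 < a ^ p := by positivity
  have hB : 0 < a ^ (p - 1) := by positivity
  have hMt : 1 - t ≤ (1 - t) ^ (p - 1) := by
    have := Real.rpow_le_rpow_of_exponent_ge hm (by linarith) (show p - 1 ≤ 1 by linarith)
    rwa [Real.rpow_one] at this
  have hqA := mul_le_mul_of_nonneg_right hq hA.le
  have hZ0' := mul_le_mul_of_nonneg_left hZ0 (mul_nonneg t0.le hm.le)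
  have hMt' := mul_le_mul_of_nonneg_left hMt t0.le
  rcases le_total 1 a with h | h
  -- For a ≥ 1 the quadratic bound at y = t/a replaces the interpolation bound; B then contains p
  -- a^(p-1) + p(p-1)^2/2 a^(p-2) in place of (a+1)^p - a^p.
  · have hy : a⁻¹ ∈ Icc (0 : ℝ) 1 := ⟨by positivity, inv_le_one_of_one_le₀ h⟩
    have hty : t * a⁻¹ ∈ Icc (0 : ℝ) 1 := ⟨mul_nonneg t0.le hy.1, by nlinarith [hy.1, hy.2]⟩
    have k1 := mul_le_mul_of_nonneg_left (hquad _ hty) hA.le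
    have e1 : a ^ p * (1 + t * a⁻¹) ^ p = (a + t) ^ p := by
      rw [← Real.mul_rpow ha.le (by linarith [hty.1])]; congr 1; field_simp
    have e2 : a ^ (p - 1) = a ^ p * a⁻¹ := by rw [Real.rpow_sub_one ha.ne']; rfl
    have e3 : a ^ (p - 2) = a ^ p * a⁻¹ ^ 2 := by
      rw [Real.rpow_sub ha, div_eq_mul_inv, inv_pow]; norm_cast
    have k2 : a ^ p + t * (p * a ^ (p - 1)) + t ^ 2 * (p * (p - 1) ^ 2 / 2 * a ^ (p - 2)) ≤
        (a + t) ^ p := by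
      rw [← e1, e2, e3]; refine le_trans (le_of_eq ?_) k1; ring
    have hZ1 := half_power_le_second_order_of_one_le hp h
    have hZ1' := mul_le_mul_of_nonneg_left hZ1 (mul_nonneg t0.le t0.le)
    linarith
  · have hZ1 := half_power_le_second_order hp ha h
    have hZ1' := mul_le_mul_of_nonneg_left hZ1 (mul_nonneg t0.le t0.le)
    linarith

end Pointwise

/-! ### French powers and the pointwise inequality for general a, b and weights -/

lemma real_sign_mul (x y : ℝ) : Real.sign (x * y) = Real.sign x * Real.sign y := by
  rcases lt_trichotomy x 0 with hx | rfl | hx <;> rcases lt_trichotomy y 0 with hy | rfl | hy <;>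
    simp [Real.sign_of_neg, Real.sign_of_pos, mul_pos_of_neg_of_neg, mul_neg_of_neg_of_pos,
      mul_neg_of_pos_of_neg, *]

lemma frenchPow_mul (x y k : ℝ) : frenchPow (x * y) k = frenchPow x k * frenchPow y k := by
  unfold frenchPow
  rw [abs_mul, Real.mul_rpow (abs_nonneg _) (abs_nonneg _), real_sign_mul]; ring

lemma frenchPow_of_nonneg {x k : ℝ} (hx : 0 ≤ x) (hk : k ≠ 0) : frenchPow x k = x ^ k := by
  unfold frenchPow
  rcases hx.eq_or_lt with rfl | h
  · simp [Real.zero_rpow hk]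
  · rw [abs_of_pos h, Real.sign_of_pos h, mul_one]

lemma frenchPow_of_neg {x k : ℝ} (hx : x < 0) : frenchPow x k = -(|x| ^ k) := by
  unfold frenchPow
  rw [Real.sign_of_neg hx]; ring

lemma frenchPow_half_sq {x p : ℝ} (hp : 0 < p) : frenchPow x (p / 2) ^ 2 = |x| ^ p := by
  rcases le_or_gt 0 x with h | h
  · rw [frenchPow_of_nonneg h (by linarith), rpow_half_sq h, abs_of_nonneg h]
  · rw [frenchPow_of_neg h, neg_sq, rpow_half_sq (abs_nonneg x)]

lemma remainderConst_le {p : ℝ} (hp : p ∈ Ioo (1 : ℝ) 2) : remainderConst p ≤ p - 1 := by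
  obtain ⟨h1, h2⟩ := hp
  refine max_le ?_ ?_
  · rw [div_le_iff₀ (by linarith)]; nlinarith
  · nlinarith

lemma remainderConst_pos {p : ℝ} (hp : p ∈ Ioo (1 : ℝ) 2) : 0 < remainderConst p :=
  lt_max_of_lt_left (div_pos (by linarith [hp.1]) (by linarith [hp.1]))

/-- The pointwise remainder inequality, for a ratio `t ∈ (0, 1)` of the weights. -/
lemma pointwise_ratio {p t : ℝ} (hp : p ∈ Ioo (1 : ℝ) 2) (ht : t ∈ Ioo (0 : ℝ) 1) {C a b : ℝ}
    (hC : C ≤ p - 1) (hab : 0 ≤ a * b ∨ C ≤ remainderConst p) :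
    (1 - t) ^ (p - 1) * |a| ^ p + C * t * (frenchPow a (p / 2) - frenchPow b (p / 2)) ^ 2 ≤
      |a - t * b| ^ p + (1 - t) ^ (p - 1) * (t * |b| ^ p) := by
  obtain ⟨h1, h2⟩ := id hp
  obtain ⟨t0, t1⟩ := id ht
  have hp0 : 0 < p := by linarith
  rcases eq_or_ne b 0 with rfl | hb
  · have h4 : (1 - t) ^ (p - 1) ≤ 1 - (p - 1) * t := by
      have := rpow_one_add_le_one_add_mul_self (s := -t) (by linarith) (p := p - 1)
        (by linarith) (by linarith)
      rw [← sub_eq_add_neg] at this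
      linarith
    have h0 : frenchPow 0 (p / 2) = 0 := by simp [frenchPow]
    rw [h0, sub_zero, frenchPow_half_sq hp0, abs_zero, Real.zero_rpow hp0.ne']
    have h6 := Real.rpow_nonneg (abs_nonneg a) p
    simp only [mul_zero, add_zero, sub_zero]
    have := mul_le_mul_of_nonneg_right hC t0.le
    nlinarith
  -- Both sides are homogeneous of degree p in (a, b), which reduces the claim to b = 1 and a = z.
  · obtain ⟨z, rfl⟩ : ∃ z, a = z * b := ⟨a / b, by field_simp⟩
    have hB : 0 < |b| ^ p := Real.rpow_pos_of_pos (abs_pos.2 hb) _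
    have e : z * b - t * b = (z - t) * b := by ring
    have e2 : frenchPow z (p / 2) * frenchPow b (p / 2) - frenchPow b (p / 2) =
      (frenchPow z (p / 2) - 1) * frenchPow b (p / 2) := by ring
    rw [frenchPow_mul, e, e2, mul_pow, frenchPow_half_sq hp0, abs_mul, abs_mul,
      Real.mul_rpow (abs_nonneg _) (abs_nonneg _), Real.mul_rpow (abs_nonneg _) (abs_nonneg _)]
    suffices h : (1 - t) ^ (p - 1) * |z| ^ p + C * t * (frenchPow z (p / 2) - 1) ^ 2 ≤
        |z - t| ^ p + (1 - t) ^ (p - 1) * t by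
      have := mul_le_mul_of_nonneg_right h hB.le
      linarith
    rcases le_or_gt 0 z with hz | hz
    · rw [frenchPow_of_nonneg hz (by linarith), abs_of_nonneg hz]
      have k := mul_le_mul_of_nonneg_right hC
        (mul_nonneg t0.le (sq_nonneg (z ^ (p / 2) - 1)))
      have := pointwise_same_sign_one hp ht hz
      linarith
    · have hC' : C ≤ remainderConst p := by
        rcases hab with h | h
        · exfalso
          have : 0 < b * b := mul_self_pos.2 hb
          nlinarith
        · exact h
      rw [frenchPow_of_neg hz, abs_of_neg (by linarith : z - t < 0), abs_of_neg hz,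
        show -(z - t) = -z + t by ring, show -(-z) ^ (p / 2) - 1 = -((-z) ^ (p / 2) + 1) by ring,
        neg_sq]
      have k := mul_le_mul_of_nonneg_right hC'
        (mul_nonneg t0.le (sq_nonneg ((-z) ^ (p / 2) + 1)))
      have hz' : 0 ≤ -z := by linarith
      rcases max_choice ((p - 1) / p) (p * (p - 1) / 2) with h | h
      · have := pointwise_opposite_sign_one_left hp ht hz'
        rw [remainderConst, h] at k
        linarith
      · have := pointwise_opposite_sign_one_right hp ht hz'
        rw [remainderConst, h] at k
        linarith

/-- The pointwise remainder inequality, for two weights `w < W`. -/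
lemma pointwise_weights {p W w : ℝ} (hp : p ∈ Ioo (1 : ℝ) 2) (hw : 0 < w) (hW : w < W) {C a b : ℝ}
    (hC : C ≤ p - 1) (hab : 0 ≤ a * b ∨ C ≤ remainderConst p) :
    (W - w) ^ (p - 1) * (W * |a| ^ p) +
        C * ((frenchPow a (p / 2) - frenchPow b (p / 2)) ^ 2 * (w * W ^ (p - 1))) ≤
      |W * a - w * b| ^ p + (W - w) ^ (p - 1) * (w * |b| ^ p) := by
  have hW0 : 0 < W := hw.trans hW
  have ht : w / W ∈ Ioo (0 : ℝ) 1 := ⟨by positivity, (div_lt_one hW0).2 hW⟩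
  have h := pointwise_ratio hp ht hC hab
  have h1 := mul_le_mul_of_nonneg_left h (Real.rpow_nonneg hW0.le p)
  have e1 : W ^ p = W * W ^ (p - 1) := by
    rw [← Real.rpow_one_add' hW0.le (by linarith [hp.1])]; congr 1; ring
  have e2 : W ^ (p - 1) * (1 - w / W) ^ (p - 1) = (W - w) ^ (p - 1) := by
    rw [← Real.mul_rpow hW0.le (by linarith [ht.2])]; congr 1; field_simp
  have e3 : W ^ p * |a - w / W * b| ^ p = |W * a - w * b| ^ p := by
    rw [← Real.mul_rpow hW0.le (abs_nonneg _)]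
    congr 1
    rw [← abs_of_pos hW0, ← abs_mul, abs_of_pos hW0]; congr 1; field_simp
  rw [mul_add, mul_add, e3, e1] at h1
  rw [← e2]
  refine le_trans (le_of_eq ?_) (h1.trans (le_of_eq ?_)) <;> field_simp

open scoped ENNReal

/-! ### Radial integrals against |e-z|^(-q): scaling, rotation, inversion -/

section Radial

variable {E : Type*} [NormedAddCommGroup E] [InnerProductSpace ℝ E] [FiniteDimensional ℝ E]
  [MeasurableSpace E] [BorelSpace E]

/-- The integral of a radial function against the Riesz-type kernel with pole `e`. -/
noncomputable def kernelInt (e : E) (q : ℝ) (f : ℝ → ℝ≥0∞) : ℝ≥0∞ :=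
  ∫⁻ z, f ‖z‖ * ENNReal.ofReal (‖e - z‖ ^ (-q))

lemma lintegral_comp_smul_pos {g : E → ℝ≥0∞} (hg : Measurable g) {c : ℝ} (hc : 0 < c) :
    ∫⁻ z, g z = ENNReal.ofReal (c ^ Module.finrank ℝ E) * ∫⁻ z, g (c • z) := by
  have h := Measure.map_addHaar_smul (volume : Measure E) hc.ne'
  rw [← lintegral_map (f := g) (g := fun z => c • z) hg (measurable_const_smul c), h,
    lintegral_smul_measure, smul_eq_mul, ← mul_assoc, ← ENNReal.ofReal_mul (by positivity),
    abs_of_pos (by positivity), mul_inv_cancel₀ (by positivity), ENNReal.ofReal_one, one_mul]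

omit [FiniteDimensional ℝ E] [MeasurableSpace E] [BorelSpace E] in
lemma exists_isometry_apply_eq {e e' : E} (h : ‖e‖ = ‖e'‖) : ∃ L : E ≃ₗᵢ[ℝ] E, L e = e' :=
  ⟨_, Submodule.reflection_sub h⟩

lemma lintegral_comp_isometry (g : E → ℝ≥0∞) (L : E ≃ₗᵢ[ℝ] E) :
    ∫⁻ z, g (L z) = ∫⁻ z, g z :=
  L.measurePreserving.lintegral_comp_emb L.toHomeomorph.measurableEmbedding g

@[fun_prop]
lemma measurable_rpow_norm_sub (q : ℝ) : Measurable fun z : E × E => ‖z.1 - z.2‖ ^ (-q) := by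
  fun_prop

/-- Substitute y = |x| Lz with an isometry L carrying e to x/|x|. This separation is what turns
every double integral below into a single integral times a constant. -/
lemma lintegral_ratio_kernel {f : ℝ → ℝ≥0∞} (hf : Measurable f) {e x : E} (he : ‖e‖ = 1)
    (hx : x ≠ 0) (q : ℝ) :
    ∫⁻ y, f (‖y‖ / ‖x‖) * ENNReal.ofReal (‖x - y‖ ^ (-q)) =
      ENNReal.ofReal (‖x‖ ^ ((Module.finrank ℝ E : ℝ) - q)) * kernelInt e q f := by
  have hx0 : 0 < ‖x‖ := norm_pos_iff.2 hx
  obtain ⟨L, hL⟩ := exists_isometry_apply_eq (e := e) (e' := ‖x‖⁻¹ • x)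
    (by rw [he, norm_smul, norm_inv, norm_norm, inv_mul_cancel₀ hx0.ne'])
  have hL' : x = ‖x‖ • L e := by rw [hL, smul_smul, mul_inv_cancel₀ hx0.ne', one_smul]
  rw [lintegral_comp_smul_pos (by fun_prop) hx0, ← lintegral_comp_isometry _ L,
    Real.rpow_sub hx0, Real.rpow_natCast, div_eq_mul_inv, ← Real.rpow_neg hx0.le,
    ENNReal.ofReal_mul (by positivity), mul_assoc]
  congr 1
  rw [kernelInt, ← lintegral_const_mul _ (by fun_prop)]
  congr with z
  have h1 : ‖‖x‖ • L z‖ = ‖x‖ * ‖z‖ := by simp [norm_smul]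
  have h2 : ‖x - ‖x‖ • L z‖ = ‖x‖ * ‖e - z‖ := by
    nth_rewrite 1 [hL']
    rw [← smul_sub, ← map_sub, norm_smul, norm_norm, L.norm_map]
  rw [h1, h2, mul_div_cancel_left₀ _ hx0.ne', Real.mul_rpow hx0.le (norm_nonneg _),
    ENNReal.ofReal_mul (by positivity)]
  ring

lemma kernelInt_congr [Nontrivial E] {e : E} {q : ℝ} {f g : ℝ → ℝ≥0∞}
    (h : ∀ r, 0 < r → r ≠ 1 → f r = g r) : kernelInt e q f = kernelInt e q g := by
  apply lintegral_congr_ae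
  have h1 : ∀ᵐ z : E, z ∉ Metric.sphere (0 : E) 1 :=
    measure_eq_zero_iff_ae_notMem.1 (Measure.addHaar_sphere _ _ _)
  have h2 : ∀ᵐ z : E, z ∉ ({0} : Set E) := measure_eq_zero_iff_ae_notMem.1 (measure_singleton _)
  filter_upwards [h1, h2] with z hz hz'
  simp only [mem_sphere_iff_norm, sub_zero, mem_singleton_iff] at hz hz'
  rw [h _ (norm_pos_iff.2 hz') hz]

lemma kernelInt_add {e : E} {q : ℝ} {f : ℝ → ℝ≥0∞} (hf : Measurable f) (g : ℝ → ℝ≥0∞) :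
    kernelInt e q (fun r => f r + g r) = kernelInt e q f + kernelInt e q g := by
  simp only [kernelInt, add_mul]
  rw [lintegral_add_left (by fun_prop)]

/-- Inversion `r ↦ r⁻¹` in radial integrals against the kernel. -/
lemma kernelInt_inv [Nontrivial E] {f : ℝ → ℝ≥0∞} (hf : Measurable f) {e : E} (he : ‖e‖ = 1)
    (q : ℝ) :
    kernelInt e q f =
      kernelInt e q fun r => f r⁻¹ * ENNReal.ofReal (r ^ (q - 2 * Module.finrank ℝ E)) := by
  set d : ℝ := ((Module.finrank ℝ E : ℕ) : ℝ) with hd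
  -- Instead of the Jacobian of z ↦ z/|z|^2, the double integral of φ(|x|) f(|y|/|x|) |x-y|^(-q) is
  -- computed in both orders. The choice of φ makes M the volume of the annulus 1 < |y| < 2,
  -- positive and finite, so it can be cancelled.
  set φ : ℝ → ℝ≥0∞ := (Ioo 1 2).indicator fun r => ENNReal.ofReal (r ^ (q - d)) with hφ
  have hφm : Measurable φ := Measurable.indicator (by fun_prop) measurableSet_Ioo
  set M : ℝ≥0∞ := ∫⁻ y : E, ENNReal.ofReal (‖y‖ ^ (d - q)) * φ ‖y‖ with hM
  have hM' : M = volume {y : E | ‖y‖ ∈ Ioo (1 : ℝ) 2} := by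
    have hs : MeasurableSet {y : E | ‖y‖ ∈ Ioo (1 : ℝ) 2} :=
      measurableSet_Ioo.preimage measurable_norm
    rw [hM, ← lintegral_indicator_one hs]
    congr with y
    by_cases hy : ‖y‖ ∈ Ioo (1 : ℝ) 2
    · have h0 : 0 < ‖y‖ := by linarith [hy.1]
      rw [indicator_of_mem (show y ∈ {y : E | ‖y‖ ∈ Ioo (1 : ℝ) 2} from hy), hφ,
        indicator_of_mem hy, ← ENNReal.ofReal_mul (by positivity), ← Real.rpow_add h0]
      simp
    · rw [indicator_of_notMem (show y ∉ {y : E | ‖y‖ ∈ Ioo (1 : ℝ) 2} from hy), hφ,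
        indicator_of_notMem hy, mul_zero]
  have hM0 : M ≠ 0 := by
    rw [hM']
    apply ne_of_gt
    apply IsOpen.measure_pos
    · exact isOpen_Ioo.preimage continuous_norm
    · exact ⟨(3 / 2 : ℝ) • e, by simp [norm_smul, he]; norm_num⟩
  have hMtop : M ≠ ∞ := by
    rw [hM']
    apply ne_of_lt
    refine (measure_mono ?_).trans_lt (measure_closedBall_lt_top (x := (0 : E)) (r := 2))
    intro y hy
    simpa using hy.2.le
  have hT1 : ∫⁻ x : E, ∫⁻ y : E, φ ‖x‖ * (f (‖y‖ / ‖x‖) * ENNReal.ofReal (‖x - y‖ ^ (-q))) =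
      M * kernelInt e q f := by
    rw [hM, ← lintegral_mul_const _ (by fun_prop)]
    congr with x
    rw [lintegral_const_mul _ (by fun_prop)]
    rcases eq_or_ne x 0 with rfl | hx
    · have : φ ‖(0 : E)‖ = 0 := by simp [hφ]
      rw [this]; simp
    · rw [lintegral_ratio_kernel hf he hx]; ring
  have hae : ∀ᵐ y : E, y ≠ 0 :=
    measure_eq_zero_iff_ae_notMem.1 (measure_singleton (0 : E))
  have hT2 : ∫⁻ x : E, ∫⁻ y : E, φ ‖x‖ * (f (‖y‖ / ‖x‖) * ENNReal.ofReal (‖x - y‖ ^ (-q))) =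
      M * kernelInt e q fun r => f r⁻¹ * ENNReal.ofReal (r ^ (q - 2 * d)) := by
    rw [lintegral_lintegral_swap (by fun_prop)]
    have h1 : ∀ᵐ y : E, ∫⁻ x : E, φ ‖x‖ * (f (‖y‖ / ‖x‖) * ENNReal.ofReal (‖x - y‖ ^ (-q))) =
        ∫⁻ z : E, ENNReal.ofReal (‖y‖ ^ (d - q)) * (φ (‖z‖ * ‖y‖) * f ‖z‖⁻¹ *
          ENNReal.ofReal (‖e - z‖ ^ (-q))) := by
      filter_upwards [hae] with y hy
      have hy0 : ‖y‖ ≠ 0 := norm_ne_zero_iff.2 hy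
      rw [lintegral_const_mul _ (by fun_prop)]
      have := lintegral_ratio_kernel (f := fun r => φ (r * ‖y‖) * f r⁻¹) (by fun_prop) he hy q
      rw [kernelInt] at this
      rw [← this]
      congr with x
      rw [div_mul_cancel₀ _ hy0, inv_div, norm_sub_rev]; ring
    rw [lintegral_congr_ae h1, lintegral_lintegral_swap (by fun_prop), kernelInt,
      ← lintegral_const_mul _ (by fun_prop)]
    apply lintegral_congr_ae
    filter_upwards [hae] with z hz
    have hz0 : 0 < ‖z‖ := norm_pos_iff.2 hz
    have h2 : ∫⁻ y : E, ENNReal.ofReal (‖y‖ ^ (d - q)) * (φ (‖z‖ * ‖y‖) * f ‖z‖⁻¹ *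
          ENNReal.ofReal (‖e - z‖ ^ (-q))) = (∫⁻ y : E, ENNReal.ofReal (‖y‖ ^ (d - q)) *
          φ (‖z‖ * ‖y‖)) * (f ‖z‖⁻¹ * ENNReal.ofReal (‖e - z‖ ^ (-q))) := by
      rw [← lintegral_mul_const _ (by fun_prop)]
      congr with y; ring
    have h3 : (∫⁻ y : E, ENNReal.ofReal (‖y‖ ^ (d - q)) * φ (‖z‖ * ‖y‖)) =
        -- The dilation y ↦ y/|z| contributes |z|^(-d) from the volume and |z|^(q-d) from the
        -- weight.
        M * ENNReal.ofReal (‖z‖ ^ (q - 2 * d)) := by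
      rw [lintegral_comp_smul_pos (by fun_prop) (inv_pos.2 hz0),
        ← lintegral_const_mul _ (by fun_prop), hM, ← lintegral_mul_const _ (by fun_prop)]
      congr with y
      have e1 : ‖‖z‖⁻¹ • y‖ = ‖z‖⁻¹ * ‖y‖ := by simp [norm_smul]
      have e2 : ‖z‖⁻¹ ^ Module.finrank ℝ E = ‖z‖ ^ (-d) := by
        rw [inv_pow, Real.rpow_neg hz0.le, hd, Real.rpow_natCast]
      rw [e1, mul_inv_cancel_left₀ hz0.ne', Real.mul_rpow (by positivity) (by positivity), e2,
        Real.inv_rpow hz0.le, ← Real.rpow_neg hz0.le, ENNReal.ofReal_mul (by positivity),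
        show q - 2 * d = -d + -(d - q) by ring, Real.rpow_add hz0,
        ENNReal.ofReal_mul (by positivity)]
      ring
    rw [h2, h3]; ring
  have := hT1.symm.trans hT2
  exact (ENNReal.mul_right_inj hM0 hMtop).1 this

end Radial

/-! ### Polar coordinates for functions of the norm and of one coordinate -/

section Polar

lemma lintegral_fun_norm {F : Type*} [NormedAddCommGroup F] [NormedSpace ℝ F]
    [FiniteDimensional ℝ F] [Nontrivial F] [MeasurableSpace F] [BorelSpace F] (μ : Measure F)
    [μ.IsAddHaarMeasure] {f : ℝ → ℝ≥0∞} (hf : Measurable f) :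
    ∫⁻ x, f ‖x‖ ∂μ = μ.toSphere univ *
      ∫⁻ r in Ioi (0 : ℝ), ENNReal.ofReal (r ^ (Module.finrank ℝ F - 1)) * f r := by
  have h0 : MeasurableSet ({0}ᶜ : Set F) := (measurableSet_singleton _).compl
  calc ∫⁻ x, f ‖x‖ ∂μ = ∫⁻ x : ({(0)}ᶜ : Set F), f ‖x.1‖ ∂(μ.comap (↑)) := by
        rw [lintegral_subtype_comap h0 fun x ↦ f (‖x‖), restrict_compl_singleton]
    _ = ∫⁻ x, f x.2 ∂μ.toSphere.prod (.volumeIoiPow (Module.finrank ℝ F - 1)) := by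
        have := μ.measurePreserving_homeomorphUnitSphereProd.lintegral_comp_emb
          (Homeomorph.measurableEmbedding _) (fun z => f z.2)
        simpa using this
    _ = μ.toSphere univ * ∫⁻ x : Ioi (0 : ℝ), f x ∂.volumeIoiPow (Module.finrank ℝ F - 1) := by
        have hm : Measurable fun x : Ioi (0 : ℝ) => f x := hf.comp measurable_subtype_coe
        have h1 : Measurable fun z : Metric.sphere (0 : F) 1 × Ioi (0 : ℝ) => f z.2 :=
          hm.comp measurable_snd
        rw [lintegral_prod _ h1.aemeasurable]
        simp only [lintegral_const]
        rw [mul_comm]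
    _ = _ := by
        congr 1
        have hm : Measurable fun x : Ioi (0 : ℝ) => f x := hf.comp measurable_subtype_coe
        rw [Measure.volumeIoiPow, lintegral_withDensity_eq_lintegral_mul _ (by fun_prop) hm]
        exact lintegral_subtype_comap measurableSet_Ioi
          fun r => ENNReal.ofReal (r ^ (Module.finrank ℝ F - 1)) * f r

lemma lintegral_euclidean_succ {n : ℕ} {F : ℝ → ℝ → ℝ≥0∞} (hF : Measurable (Function.uncurry F)) :
    ∫⁻ z : EuclideanSpace ℝ (Fin (n + 1)), F ‖z‖ (z 0) =
      ∫⁻ t : ℝ, ∫⁻ w : EuclideanSpace ℝ (Fin n), F (√(t ^ 2 + ‖w‖ ^ 2)) t := by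
  have e1 := (PiLp.volume_preserving_ofLp (Fin (n + 1))).lintegral_comp_emb
    (MeasurableEquiv.toLp 2 (Fin (n + 1) → ℝ)).symm.measurableEmbedding
    (fun z => F (√(∑ i, z i ^ 2)) (z 0))
  have e2 := (volume_preserving_piFinSuccAbove (fun _ : Fin (n + 1) => ℝ) 0).lintegral_comp_emb
    (MeasurableEquiv.measurableEmbedding _)
    (fun z => F (√(z.1 ^ 2 + ∑ i, z.2 i ^ 2)) z.1)
  have e3 : ∀ t : ℝ, ∫⁻ w : EuclideanSpace ℝ (Fin n), F (√(t ^ 2 + ‖w‖ ^ 2)) t =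
      ∫⁻ w : Fin n → ℝ, F (√(t ^ 2 + ∑ i, w i ^ 2)) t := by
    intro t
    rw [← (PiLp.volume_preserving_ofLp (Fin n)).lintegral_comp_emb
      (MeasurableEquiv.toLp 2 (Fin n → ℝ)).symm.measurableEmbedding
      (fun w => F (√(t ^ 2 + ∑ i, w i ^ 2)) t)]
    simp [EuclideanSpace.norm_sq_eq]
  simp_rw [e3]
  have hm : Measurable fun z : ℝ × (Fin n → ℝ) => F (√(z.1 ^ 2 + ∑ i, z.2 i ^ 2)) z.1 :=
    hF.comp (f := fun z : ℝ × (Fin n → ℝ) => (√(z.1 ^ 2 + ∑ i, z.2 i ^ 2), z.1)) (by fun_prop)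
  rw [Measure.volume_eq_prod, lintegral_prod _ hm.aemeasurable] at e2
  rw [← e2]
  simp only [EuclideanSpace.norm_eq, Real.norm_eq_abs, sq_abs]
  rw [e1]
  congr with z
  simp [MeasurableEquiv.piFinSuccAbove, Fin.sum_univ_succ, Fin.tail]

lemma lintegral_half_plane {G : ℝ × ℝ → ℝ≥0∞} (hG : Measurable G) :
    ∫⁻ t : ℝ, ∫⁻ ρ in Ioi (0 : ℝ), G (t, ρ) =
      ∫⁻ r in Ioi (0 : ℝ), ∫⁻ θ in Ioo 0 Real.pi,
        ENNReal.ofReal r * G (r * Real.cos θ, r * Real.sin θ) := by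
  have h1 : ∫⁻ t : ℝ, ∫⁻ ρ in Ioi (0 : ℝ), G (t, ρ) =
      ∫⁻ z : ℝ × ℝ, (univ ×ˢ Ioi (0 : ℝ)).indicator G z := by
    rw [lintegral_indicator (MeasurableSet.univ.prod measurableSet_Ioi), Measure.volume_eq_prod,
      ← Measure.prod_restrict, lintegral_prod _ hG.aemeasurable, Measure.restrict_univ]
  rw [h1, ← lintegral_comp_polarCoord_symm]
  have hsin : Ioo 0 Real.pi = {θ | 0 < Real.sin θ} ∩ Ioo (-Real.pi) Real.pi := by
    ext θ
    constructor
    · intro h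
      exact ⟨Real.sin_pos_of_mem_Ioo h, by linarith [h.1, Real.pi_pos], h.2⟩
    · rintro ⟨h1, h2, h3⟩
      refine ⟨?_, h3⟩
      by_contra h
      exact absurd (Real.sin_nonpos_of_nonpos_of_neg_pi_le (not_lt.1 h) h2.le) (not_le.2 h1)
  have hmG : Measurable fun z : ℝ × ℝ => ENNReal.ofReal z.1 *
      G (z.1 * Real.cos z.2, z.1 * Real.sin z.2) := by fun_prop
  have hset : MeasurableSet {z : ℝ × ℝ | 0 < z.1 * Real.sin z.2} :=
    measurableSet_lt (by fun_prop) (by fun_prop)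
  have h2 : ∀ z : ℝ × ℝ, ENNReal.ofReal z.1 • (univ ×ˢ Ioi (0 : ℝ)).indicator G (polarCoord.symm z)
      = {z : ℝ × ℝ | 0 < z.1 * Real.sin z.2}.indicator (fun z => ENNReal.ofReal z.1 *
      G (z.1 * Real.cos z.2, z.1 * Real.sin z.2)) z := by
    intro z
    by_cases hz : 0 < z.1 * Real.sin z.2
    · rw [indicator_of_mem (by simpa using hz), indicator_of_mem (by simpa using hz)]
      simp
    · rw [indicator_of_notMem (by simpa using hz), indicator_of_notMem (by simpa using hz)]
      simp
  simp_rw [h2]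
  rw [setLIntegral_indicator hset]
  have h3 : {z : ℝ × ℝ | 0 < z.1 * Real.sin z.2} ∩ polarCoord.target =
      Ioi (0 : ℝ) ×ˢ Ioo 0 Real.pi := by
    ext z
    rw [hsin]
    simp only [polarCoord, mem_inter_iff, mem_ofPred_eq, mem_prod, mem_Ioi]
    constructor
    · rintro ⟨h1, h2, h3⟩
      exact ⟨h2, (mul_pos_iff_of_pos_left h2).1 h1, h3⟩
    · rintro ⟨h1, h2, h3⟩
      exact ⟨mul_pos h1 h2, h1, h3⟩
  rw [h3, Measure.volume_eq_prod, ← Measure.prod_restrict, lintegral_prod _ hmG.aemeasurable]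

lemma cos_image_Ioo : Real.cos '' Ioo 0 Real.pi = Ioo (-1) 1 := by
  ext t
  constructor
  · rintro ⟨θ, hθ, rfl⟩
    have h1 := Real.strictAntiOn_cos (left_mem_Icc.2 Real.pi_pos.le) ⟨hθ.1.le, hθ.2.le⟩ hθ.1
    have h2 := Real.strictAntiOn_cos ⟨hθ.1.le, hθ.2.le⟩ (right_mem_Icc.2 Real.pi_pos.le) hθ.2
    simp at h1 h2
    exact ⟨h2, h1⟩
  · intro ht
    exact ⟨Real.arccos t, ⟨Real.arccos_pos.2 ht.2, Real.arccos_lt_pi.2 ht.1⟩,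
      Real.cos_arccos ht.1.le ht.2.le⟩

lemma injOn_cos_Ioo : InjOn Real.cos (Ioo 0 Real.pi) :=
  Real.injOn_cos.mono Ioo_subset_Icc_self

lemma sin_mul_rpow {n : ℕ} (hn : 1 ≤ n) {θ : ℝ} (hθ : θ ∈ Ioo 0 Real.pi) :
    Real.sin θ * (1 - Real.cos θ ^ 2) ^ (((n : ℝ) - 2) / 2) = Real.sin θ ^ (n - 1) := by
  have h := Real.sin_pos_of_mem_Ioo hθ
  rw [show 1 - Real.cos θ ^ 2 = Real.sin θ ^ 2 by rw [Real.sin_sq], ← Real.rpow_natCast _ 2,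
    ← Real.rpow_mul h.le]
  nth_rewrite 1 [← Real.rpow_one (Real.sin θ)]
  rw [← Real.rpow_add h, ← Real.rpow_natCast]
  congr 1; push_cast [hn]; ring

lemma lintegral_sin_pow {n : ℕ} (hn : 1 ≤ n) (g : ℝ → ℝ≥0∞) :
    ∫⁻ θ in Ioo 0 Real.pi, ENNReal.ofReal (Real.sin θ ^ (n - 1)) * g (Real.cos θ) =
      ∫⁻ t in Ioo (-1 : ℝ) 1, ENNReal.ofReal ((1 - t ^ 2) ^ (((n : ℝ) - 2) / 2)) * g t := by
  rw [← cos_image_Ioo, lintegral_image_eq_lintegral_abs_deriv_mul measurableSet_Ioo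
    (fun x _ => (Real.hasDerivAt_cos x).hasDerivWithinAt) injOn_cos_Ioo]
  apply setLIntegral_congr_fun measurableSet_Ioo
  intro θ hθ
  simp only
  rw [← mul_assoc, ← ENNReal.ofReal_mul (abs_nonneg _), abs_neg,
    abs_of_pos (Real.sin_pos_of_mem_Ioo hθ), sin_mul_rpow hn hθ]

/-- Integration over `ℝ^{n+1}` of a function of the norm and of the first coordinate. -/
lemma lintegral_norm_coord {n : ℕ} (hn : 1 ≤ n) {F : ℝ → ℝ → ℝ≥0∞}
    (hF : Measurable (Function.uncurry F)) :
    ∫⁻ z : EuclideanSpace ℝ (Fin (n + 1)), F ‖z‖ (z 0) =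
      (volume : Measure (EuclideanSpace ℝ (Fin n))).toSphere univ *
        ∫⁻ r in Ioi (0 : ℝ), ENNReal.ofReal (r ^ n) *
          ∫⁻ t in Ioo (-1 : ℝ) 1, ENNReal.ofReal ((1 - t ^ 2) ^ (((n : ℝ) - 2) / 2)) *
            F r (r * t) := by
  have : Nonempty (Fin n) := ⟨⟨0, hn⟩⟩
  have hFm : ∀ {α : Type} [MeasurableSpace α] {a b : α → ℝ}, Measurable a → Measurable b →
      Measurable fun x => F (a x) (b x) := fun ha hb => hF.comp (ha.prodMk hb)
  rw [lintegral_euclidean_succ hF]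
  have h1 : ∀ t : ℝ, ∫⁻ w : EuclideanSpace ℝ (Fin n), F (√(t ^ 2 + ‖w‖ ^ 2)) t =
      (volume : Measure (EuclideanSpace ℝ (Fin n))).toSphere univ *
      ∫⁻ ρ in Ioi (0 : ℝ), ENNReal.ofReal (ρ ^ (n - 1)) * F (√(t ^ 2 + ρ ^ 2)) t := by
    intro t
    rw [lintegral_fun_norm volume (f := fun r => F (√(t ^ 2 + r ^ 2)) t)
      (hFm (by fun_prop) (by fun_prop))]
    simp
  simp_rw [h1]
  have hm : Measurable fun z : ℝ × ℝ => ENNReal.ofReal (z.2 ^ (n - 1)) *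
      F (√(z.1 ^ 2 + z.2 ^ 2)) z.1 :=
    Measurable.mul (by fun_prop) (hFm (by fun_prop) (by fun_prop))
  have hm' : Measurable fun t : ℝ => ∫⁻ ρ in Ioi (0 : ℝ), ENNReal.ofReal (ρ ^ (n - 1)) *
      F (√(t ^ 2 + ρ ^ 2)) t := hm.lintegral_prod_right'
  rw [lintegral_const_mul _ hm', lintegral_half_plane hm]
  congr 1
  apply setLIntegral_congr_fun measurableSet_Ioi
  intro r hr
  simp only
  have hr0 : 0 < r := hr
  rw [← lintegral_sin_pow hn fun t => F r (r * t), ← lintegral_const_mul]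
  · apply setLIntegral_congr_fun measurableSet_Ioo
    intro θ hθ
    have hs := Real.sin_pos_of_mem_Ioo hθ
    simp only
    rw [show (r * Real.cos θ) ^ 2 + (r * Real.sin θ) ^ 2 = r ^ 2 by
      rw [mul_pow, mul_pow, ← mul_add, Real.cos_sq_add_sin_sq, mul_one], Real.sqrt_sq hr0.le,
      mul_pow, ENNReal.ofReal_mul (by positivity), ← mul_assoc, ← mul_assoc, ← mul_assoc]
    congr 2
    rw [← ENNReal.ofReal_mul hr0.le, ← pow_succ', Nat.sub_add_cancel hn]
  · exact Measurable.mul (by fun_prop) (hFm (by fun_prop) (by fun_prop))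

end Polar

/-! ### Identification of the angular integral with Φ -/

section PhiKernel

lemma kernelInt_eq_of_norm_eq {E : Type*} [NormedAddCommGroup E] [InnerProductSpace ℝ E]
    [FiniteDimensional ℝ E] [MeasurableSpace E] [BorelSpace E] {e e' : E} (h : ‖e‖ = ‖e'‖)
    (q : ℝ) (f : ℝ → ℝ≥0∞) : kernelInt e q f = kernelInt e' q f := by
  obtain ⟨L, hL⟩ := exists_isometry_apply_eq h
  rw [kernelInt, kernelInt]
  conv_rhs => rw [← lintegral_comp_isometry _ L]
  congr with z
  rw [L.norm_map, ← hL, ← map_sub, L.norm_map]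

lemma one_sub_two_mul_add_sq_pos {r t : ℝ} (hr : r ∈ Ioo (0 : ℝ) 1) (ht : t ≤ 1) :
    0 < 1 - 2 * t * r + r ^ 2 := by
  have := hr.1
  have := hr.2
  nlinarith [sq_nonneg (1 - r), sq_pos_of_pos (sub_pos.2 hr.2)]

/-- For n = 1 the density (1-t^2)^(-1/2) is singular at the endpoints; t = cos θ makes the integrand
continuous on [0, π]. -/
lemma integrableOn_Phi {n : ℕ} (hn : 1 ≤ n) {r : ℝ} (hr : r ∈ Ioo (0 : ℝ) 1) (k : ℝ) :
    IntegrableOn (fun t : ℝ => (1 - t ^ 2) ^ (((n : ℝ) - 2) / 2) / (1 - 2 * t * r + r ^ 2) ^ k)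
      (Ioo (-1) 1) := by
  rw [← cos_image_Ioo, integrableOn_image_iff_integrableOn_abs_deriv_smul measurableSet_Ioo
    (fun x _ => (Real.hasDerivAt_cos x).hasDerivWithinAt) injOn_cos_Ioo]
  have hc : ContinuousOn (fun θ : ℝ => Real.sin θ ^ (n - 1) /
      (1 - 2 * Real.cos θ * r + r ^ 2) ^ k) (Icc 0 Real.pi) := by
    have hpos : ∀ θ : ℝ, 0 < 1 - 2 * Real.cos θ * r + r ^ 2 := fun θ =>
      one_sub_two_mul_add_sq_pos hr (Real.cos_le_one θ)
    apply ContinuousOn.div (by fun_prop)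
    · exact ContinuousOn.rpow_const (by fun_prop) fun θ _ => Or.inl (hpos θ).ne'
    · exact fun θ _ => (Real.rpow_pos_of_pos (hpos θ) _).ne'
  refine ((hc.integrableOn_Icc).mono_set Ioo_subset_Icc_self).congr_fun (fun θ hθ => ?_)
    measurableSet_Ioo
  simp only [smul_eq_mul]
  rw [abs_neg, abs_of_pos (Real.sin_pos_of_mem_Ioo hθ), ← mul_div_assoc, sin_mul_rpow hn hθ]

lemma norm_single_sub_sq {n : ℕ} (z : EuclideanSpace ℝ (Fin (n + 1))) :
    ‖EuclideanSpace.single (0 : Fin (n + 1)) (1 : ℝ) - z‖ = √(1 - 2 * z 0 + ‖z‖ ^ 2) := by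
  rw [← Real.sqrt_sq (norm_nonneg (_ - _)), norm_sub_sq_real]
  simp [EuclideanSpace.inner_single_left]

lemma toSphere_univ_eq_ofReal (n : ℕ) :
    (volume : Measure (EuclideanSpace ℝ (Fin n))).toSphere univ =
      ENNReal.ofReal (unitSphereArea n) := by
  rw [unitSphereArea, ofReal_measureReal]

lemma Phi_nonneg {d : ℕ} {s p r : ℝ} (hr : r ∈ Ioo (0 : ℝ) 1) : 0 ≤ Phi d s p r := by
  unfold Phi
  split_ifs with h
  · apply mul_nonneg measureReal_nonneg
    apply setIntegral_nonneg measurableSet_Ioo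
    intro t ht
    apply div_nonneg <;> apply Real.rpow_nonneg
    · nlinarith [ht.1, ht.2]
    · exact (one_sub_two_mul_add_sq_pos hr ht.2.le).le
  · have := hr.1
    have := hr.2
    apply add_nonneg <;> apply Real.rpow_nonneg <;> linarith

lemma kernelInt_indicator_Iio_of_two_le {n : ℕ} (hn : 1 ≤ n) {s p : ℝ} {f : ℝ → ℝ≥0∞}
    (hf : Measurable f) :
    kernelInt (EuclideanSpace.single (0 : Fin (n + 1)) (1 : ℝ)) (((n + 1 : ℕ) : ℝ) + s * p)
      ((Iio 1).indicator f) =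
      ∫⁻ r in Ioo (0 : ℝ) 1, f r * ENNReal.ofReal (r ^ n * Phi (n + 1) s p r) := by
  set q := ((n + 1 : ℕ) : ℝ) + s * p with hq
  have hfi : Measurable ((Iio 1).indicator f) := hf.indicator measurableSet_Iio
  have h := lintegral_norm_coord hn (F := fun r c => (Iio 1).indicator f r *
    ENNReal.ofReal (√(1 - 2 * c + r ^ 2) ^ (-q))) (by unfold Function.uncurry; fun_prop)
  simp only [← norm_single_sub_sq] at h
  rw [kernelInt, h, toSphere_univ_eq_ofReal, ← lintegral_const_mul'
    _ _ ENNReal.ofReal_ne_top, ← lintegral_indicator measurableSet_Ioi,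
    ← lintegral_indicator measurableSet_Ioo]
  congr with r
  by_cases hr : r ∈ Ioo (0 : ℝ) 1
  · rw [indicator_of_mem hr, indicator_of_mem (show r ∈ Ioi (0 : ℝ) from hr.1),
      indicator_of_mem (show r ∈ Iio (1 : ℝ) from hr.2)]
    have hint : ENNReal.ofReal (∫ t in Ioo (-1 : ℝ) 1, (1 - t ^ 2) ^ (((n : ℝ) - 2) / 2) /
        (1 - 2 * t * r + r ^ 2) ^ (q / 2)) = ∫⁻ t in Ioo (-1 : ℝ) 1,
        ENNReal.ofReal ((1 - t ^ 2) ^ (((n : ℝ) - 2) / 2)) *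
          ENNReal.ofReal (√(1 - 2 * (r * t) + r ^ 2) ^ (-q)) := by
      rw [ofReal_integral_eq_lintegral_ofReal (integrableOn_Phi hn hr _)]
      · apply setLIntegral_congr_fun measurableSet_Ioo
        intro t ht
        have hpos := one_sub_two_mul_add_sq_pos hr ht.2.le
        have h1 : 0 ≤ 1 - t ^ 2 := by nlinarith [ht.1, ht.2]
        simp only
        rw [← ENNReal.ofReal_mul (by positivity), div_eq_mul_inv, ← Real.rpow_neg hpos.le,
          Real.sqrt_eq_rpow, ← Real.rpow_mul (by nlinarith)]
        congr 3 <;> ring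
      · refine (ae_restrict_iff' measurableSet_Ioo).2 (.of_forall fun t ht => ?_)
        apply div_nonneg <;> apply Real.rpow_nonneg
        · nlinarith [ht.1, ht.2]
        · exact (one_sub_two_mul_add_sq_pos hr ht.2.le).le
    have hmm : ∀ t : ℝ, ENNReal.ofReal ((1 - t ^ 2) ^ (((n : ℝ) - 2) / 2)) *
        (f r * ENNReal.ofReal (√(1 - 2 * (r * t) + r ^ 2) ^ (-q))) =
        f r * (ENNReal.ofReal ((1 - t ^ 2) ^ (((n : ℝ) - 2) / 2)) *
          ENNReal.ofReal (√(1 - 2 * (r * t) + r ^ 2) ^ (-q))) := fun t => by ring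
    simp_rw [hmm]
    rw [lintegral_const_mul _ (by fun_prop), ← hint]
    have hP : Phi (n + 1) s p r = unitSphereArea n * ∫ t in Ioo (-1 : ℝ) 1,
        (1 - t ^ 2) ^ (((n : ℝ) - 2) / 2) / (1 - 2 * t * r + r ^ 2) ^ (q / 2) := by
      rw [Phi, if_pos (by omega), hq, Nat.add_sub_cancel]
      push_cast
      rw [show (n : ℝ) + 1 - 3 = n - 2 by ring]
    rw [hP, ENNReal.ofReal_mul (pow_nonneg hr.1.le _),
      ENNReal.ofReal_mul (show 0 ≤ unitSphereArea n from measureReal_nonneg)]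
    ring
  · rw [indicator_of_notMem hr]
    by_cases h0 : r ∈ Ioi (0 : ℝ)
    · rw [indicator_of_mem h0, indicator_of_notMem (fun h1 : r ∈ Iio 1 => hr ⟨h0, h1⟩)]
      simp
    · rw [indicator_of_notMem h0]

/-- On the line the sphere of radius r is {r, -r}, and its two points produce the two terms of
`Phi`. -/
lemma kernelInt_indicator_Iio_one {s p : ℝ} {f : ℝ → ℝ≥0∞} (hf : Measurable f) :
    kernelInt (EuclideanSpace.single (0 : Fin 1) (1 : ℝ)) (((1 : ℕ) : ℝ) + s * p)
      ((Iio 1).indicator f) =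
      ∫⁻ r in Ioo (0 : ℝ) 1, f r * ENNReal.ofReal (Phi 1 s p r) := by
  have hfi : Measurable ((Iio 1).indicator f) := hf.indicator measurableSet_Iio
  set G : ℝ → ℝ≥0∞ := fun x => (Iio 1).indicator f |x| *
    ENNReal.ofReal (|1 - x| ^ (-(((1 : ℕ) : ℝ) + s * p))) with hG
  have hGm : Measurable G := by fun_prop
  have h1 : kernelInt (EuclideanSpace.single (0 : Fin 1) (1 : ℝ)) (((1 : ℕ) : ℝ) + s * p)
      ((Iio 1).indicator f) = ∫⁻ x, G x := by
    have e1 := (PiLp.volume_preserving_ofLp (Fin 1)).lintegral_comp_emb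
      (MeasurableEquiv.toLp 2 (Fin 1 → ℝ)).symm.measurableEmbedding (fun z => G (z 0))
    have e2 := (volume_preserving_funUnique (Fin 1) ℝ).lintegral_comp_emb
      (MeasurableEquiv.measurableEmbedding _) G
    simp only [MeasurableEquiv.funUnique_apply, Fin.default_eq_zero] at e2
    refine Eq.trans ?_ (e1.trans e2)
    rw [kernelInt]
    congr with z
    simp [hG, EuclideanSpace.norm_eq, Real.sqrt_sq_eq_abs]
  have h2 : ∫⁻ x, G x = ∫⁻ x in Ioi 0, (G x + G (-x)) := by
    rw [lintegral_add_left hGm, ← lintegral_add_compl G (measurableSet_Ioi (a := (0 : ℝ)))]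
    congr 1
    rw [compl_Ioi, ← setLIntegral_congr Iio_ae_eq_Iic]
    have := (Measure.measurePreserving_neg (volume : Measure ℝ)).setLIntegral_comp_emb
      (MeasurableEquiv.neg ℝ).measurableEmbedding (fun x => G (-x)) (Iio 0)
    simpa using this
  rw [h1, h2, ← lintegral_indicator measurableSet_Ioi, ← lintegral_indicator measurableSet_Ioo]
  congr with r
  by_cases hr : r ∈ Ioo (0 : ℝ) 1
  · have := hr.1
    have := hr.2
    rw [indicator_of_mem hr, indicator_of_mem (show r ∈ Ioi (0 : ℝ) from hr.1), hG]
    simp only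
    rw [abs_neg, abs_of_pos hr.1, indicator_of_mem (show r ∈ Iio (1 : ℝ) from hr.2), ← mul_add,
      sub_neg_eq_add, abs_of_pos (sub_pos.2 hr.2), abs_of_pos (by linarith : 0 < 1 + r),
      ← ENNReal.ofReal_add (Real.rpow_nonneg (by linarith) _) (Real.rpow_nonneg (by linarith) _),
      Phi, if_neg (by norm_num)]
    congr 4 <;> push_cast <;> ring
  · rw [indicator_of_notMem hr]
    by_cases h0 : r ∈ Ioi (0 : ℝ)
    · have h1 : |r| ∉ Iio (1 : ℝ) := by rw [abs_of_pos h0]; exact fun h1 => hr ⟨h0, h1⟩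
      rw [indicator_of_mem h0, hG]
      simp only [abs_neg, indicator_of_notMem h1, zero_mul, add_zero]
    · rw [indicator_of_notMem h0]

/-- Radial integrals against the kernel, inside the unit ball, in terms of `Phi`. -/
lemma kernelInt_indicator_Iio {d : ℕ} (hd : 1 ≤ d) {s p : ℝ} {f : ℝ → ℝ≥0∞} (hf : Measurable f)
    {e : EuclideanSpace ℝ (Fin d)} (he : ‖e‖ = 1) :
    kernelInt e ((d : ℝ) + s * p) ((Iio 1).indicator f) =
      ∫⁻ r in Ioo (0 : ℝ) 1, f r * ENNReal.ofReal (r ^ ((d : ℝ) - 1) * Phi d s p r) := by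
  obtain ⟨n, rfl⟩ : ∃ n, d = n + 1 := ⟨d - 1, by omega⟩
  rw [kernelInt_eq_of_norm_eq (e' := EuclideanSpace.single (0 : Fin (n + 1)) (1 : ℝ)) (by simp [he])]
  rcases n.eq_zero_or_pos with rfl | hn
  · rw [kernelInt_indicator_Iio_one hf]
    simp
  · rw [kernelInt_indicator_Iio_of_two_le hn hf]
    push_cast
    simp

end PhiKernel

/-! ### Finiteness of radial kernel integrals -/

section Finiteness

lemma rpow_le_add_of_mem_Icc {x a b : ℝ} (ha : 0 < a) (hx : x ∈ Icc a b) (k : ℝ) :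
    x ^ k ≤ a ^ k + b ^ k := by
  have hx0 : 0 < x := ha.trans_le hx.1
  have hb : 0 < b := hx0.trans_le hx.2
  rcases le_total 0 k with h | h
  · have := Real.rpow_le_rpow hx0.le hx.2 h
    have := Real.rpow_nonneg ha.le k
    linarith
  · have := Real.rpow_le_rpow_of_nonpos ha hx.1 h
    have := Real.rpow_nonneg hb.le k
    linarith

variable {E : Type*} [NormedAddCommGroup E] [InnerProductSpace ℝ E] [FiniteDimensional ℝ E]
  [MeasurableSpace E] [BorelSpace E] [Nontrivial E]

lemma lintegral_ball_rpow_lt_top {b : ℝ} (hb : b < Module.finrank ℝ E) (R : ℝ) :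
    ∫⁻ z in Metric.ball (0 : E) R, ENNReal.ofReal (‖z‖ ^ (-b)) < ∞ := by
  have h : IntegrableOn (fun z : E => ‖z‖ ^ (-b)) (Metric.ball (0 : E) R) :=
    integrableOn_ball_of_norm_le_rpow (C := 1) (α := b) Module.finrank_pos hb
      (.of_forall fun x => by
        rw [one_mul, Real.norm_of_nonneg (Real.rpow_nonneg (norm_nonneg _) _)])
      (show Measurable fun z : E => ‖z‖ ^ (-b) by fun_prop).aestronglyMeasurable
  exact h.lintegral_lt_top

lemma lintegral_compl_rpow_lt_top {c : ℝ} (hc : (Module.finrank ℝ E : ℝ) < c) :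
    ∫⁻ z in {z : E | 1 ≤ ‖z‖}, ENNReal.ofReal (‖z‖ ^ (-c)) < ∞ := by
  have hs : MeasurableSet {z : E | 1 ≤ ‖z‖} := measurableSet_le measurable_const measurable_norm
  have h1 := lintegral_fun_norm (volume : Measure E)
    (f := (Ici 1).indicator fun r => ENNReal.ofReal (r ^ (-c)))
    (Measurable.indicator (by fun_prop) measurableSet_Ici)
  have h2 : ∀ x : E, (Ici (1 : ℝ)).indicator (fun r => ENNReal.ofReal (r ^ (-c))) ‖x‖ =
      {z : E | 1 ≤ ‖z‖}.indicator (fun z => ENNReal.ofReal (‖z‖ ^ (-c))) x := by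
    intro x
    by_cases hx : 1 ≤ ‖x‖
    · rw [indicator_of_mem (show ‖x‖ ∈ Ici (1 : ℝ) from hx), indicator_of_mem
        (show x ∈ {z : E | 1 ≤ ‖z‖} from hx)]
    · rw [indicator_of_notMem (show ‖x‖ ∉ Ici (1 : ℝ) from hx), indicator_of_notMem
        (show x ∉ {z : E | 1 ≤ ‖z‖} from hx)]
  simp_rw [h2] at h1
  rw [lintegral_indicator hs] at h1
  rw [h1]
  refine ENNReal.mul_lt_top (measure_lt_top _ _) ?_
  have h3 : IntegrableOn (fun r : ℝ => r ^ ((Module.finrank ℝ E : ℝ) - 1 - c)) (Ioi (1 / 2)) :=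
    integrableOn_Ioi_rpow_of_lt (by linarith) (by norm_num)
  refine lt_of_le_of_lt ?_ h3.lintegral_lt_top
  rw [← lintegral_indicator measurableSet_Ioi, ← lintegral_indicator measurableSet_Ioi]
  refine lintegral_mono fun r => ?_
  by_cases hr : 1 ≤ r
  · have hr0 : 0 < r := by linarith
    rw [indicator_of_mem (show r ∈ Ioi (0 : ℝ) from hr0),
      indicator_of_mem (show r ∈ Ioi (1 / 2 : ℝ) from by simp only [mem_Ioi]; linarith),
      indicator_of_mem (show r ∈ Ici (1 : ℝ) from hr), ← ENNReal.ofReal_mul (by positivity),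
      ← Real.rpow_natCast, Nat.cast_sub Module.finrank_pos, ← Real.rpow_add hr0]
    apply le_of_eq
    congr 2
    push_cast; ring
  · have : (Ioi (0 : ℝ)).indicator (fun a => ENNReal.ofReal (a ^ (Module.finrank ℝ E - 1)) *
        (Ici 1).indicator (fun r => ENNReal.ofReal (r ^ (-c))) a) r = 0 := by
      rw [indicator_apply_eq_zero]
      intro _
      rw [indicator_of_notMem (show r ∉ Ici (1 : ℝ) from hr), mul_zero]
    rw [this]
    exact zero_le

/-- There are three places to check: the origin, where b < d; the pole e, where the kernel exponent
d+σ-p is below d; and infinity, where the total exponent d+σ+b exceeds d. -/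
lemma kernelInt_lt_top {e : E} (he : ‖e‖ = 1) {σ p b : ℝ} (hp : 0 ≤ p) (hσp : σ < p)
    (hb : -σ < b) (hb' : b < Module.finrank ℝ E) :
    kernelInt e ((Module.finrank ℝ E : ℝ) + σ - p)
      (fun r => ENNReal.ofReal ((max 1 r) ^ (-p) * r ^ (-b))) < ∞ := by
  set d : ℝ := ((Module.finrank ℝ E : ℕ) : ℝ) with hd
  set q := d + σ - p with hq
  set K₁ : ℝ := (1 / 2 : ℝ) ^ (-q) + (3 / 2 : ℝ) ^ (-q)
  set K₂ : ℝ := (1 / 2 : ℝ) ^ (-b) + (2 : ℝ) ^ (-b)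
  set K₃ : ℝ := (1 / 2 : ℝ) ^ (-q) + (2 : ℝ) ^ (-q)
  have hK₁ : 0 ≤ K₁ := by positivity
  have hK₂ : 0 ≤ K₂ := by positivity
  have hK₃ : 0 ≤ K₃ := by positivity
  have hs : MeasurableSet {z : E | 1 ≤ ‖z‖} := measurableSet_le measurable_const measurable_norm
  set F₁ : E → ℝ≥0∞ := (Metric.ball (0 : E) 1).indicator fun z => ENNReal.ofReal (‖z‖ ^ (-b))
  set F₂ : E → ℝ≥0∞ := (Metric.ball (0 : E) 4).indicator fun z => ENNReal.ofReal (‖z‖ ^ (-q))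
  set F₃ : E → ℝ≥0∞ := {z : E | 1 ≤ ‖z‖}.indicator fun z => ENNReal.ofReal (‖z‖ ^ (-(d + σ + b)))
  have hF₁ : Measurable F₁ := Measurable.indicator (by fun_prop) measurableSet_ball
  have hF₂ : Measurable F₂ := Measurable.indicator (by fun_prop) measurableSet_ball
  have hF₃ : Measurable F₃ := Measurable.indicator (by fun_prop) hs
  have I₁ : ∫⁻ z, F₁ z < ∞ := by
    rw [lintegral_indicator measurableSet_ball]; exact lintegral_ball_rpow_lt_top hb' _
  have I₂ : ∫⁻ z, F₂ (e - z) < ∞ := by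
    rw [lintegral_sub_left_eq_self, lintegral_indicator measurableSet_ball]
    exact lintegral_ball_rpow_lt_top (by rw [← hd]; linarith) _
  have I₃ : ∫⁻ z, F₃ z < ∞ := by
    rw [lintegral_indicator hs]; exact lintegral_compl_rpow_lt_top (by rw [← hd]; linarith)
  have hle : kernelInt e q (fun r => ENNReal.ofReal ((max 1 r) ^ (-p) * r ^ (-b))) ≤
      ∫⁻ z, (ENNReal.ofReal K₁ * F₁ z + ENNReal.ofReal K₂ * F₂ (e - z)) +
        ENNReal.ofReal K₃ * F₃ z := by
    refine lintegral_mono fun z => ?_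
    have hm1 : max 1 ‖z‖ ^ (-p) ≤ 1 :=
      Real.rpow_le_one_of_one_le_of_nonpos (le_max_left _ _) (by linarith)
    have hm0 : 0 ≤ max 1 ‖z‖ ^ (-p) := Real.rpow_nonneg (zero_le_one.trans (le_max_left _ _)) _
    have hz0 : 0 ≤ ‖z‖ ^ (-b) := Real.rpow_nonneg (norm_nonneg _) _
    have he0 : 0 ≤ ‖e - z‖ ^ (-q) := Real.rpow_nonneg (norm_nonneg _) _
    have t1 : ‖e - z‖ ≤ 1 + ‖z‖ := by simpa [he] using norm_sub_le e z
    have t2 : 1 - ‖z‖ ≤ ‖e - z‖ := by simpa [he] using norm_sub_norm_le e z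
    have t3 : ‖z‖ - 1 ≤ ‖e - z‖ := by
      rw [norm_sub_rev]; simpa [he] using norm_sub_norm_le z e
    rw [← ENNReal.ofReal_mul (by positivity)]
    rcases lt_or_ge ‖z‖ (1 / 2) with h1 | h1
    · refine le_trans ?_ (le_add_right (le_add_right le_rfl))
      have hz : z ∈ Metric.ball (0 : E) 1 := by simp; linarith
      simp only [F₁]
      rw [indicator_of_mem hz, ← ENNReal.ofReal_mul hK₁]
      apply ENNReal.ofReal_le_ofReal
      have := rpow_le_add_of_mem_Icc (x := ‖e - z‖) (a := 1 / 2) (b := 3 / 2) (by norm_num)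
        ⟨by linarith, by linarith⟩ (-q)
      rw [mul_comm K₁]
      refine mul_le_mul ?_ this he0 hz0
      nlinarith
    rcases lt_or_ge ‖z‖ 2 with h2 | h2
    · refine le_trans ?_ (le_add_right (le_add_left le_rfl))
      have hz : e - z ∈ Metric.ball (0 : E) 4 := by rw [mem_ball_zero_iff]; linarith
      simp only [F₂]
      rw [indicator_of_mem hz, ← ENNReal.ofReal_mul hK₂]
      apply ENNReal.ofReal_le_ofReal
      have := rpow_le_add_of_mem_Icc (x := ‖z‖) (a := 1 / 2) (b := 2) (by norm_num)
        ⟨by linarith, by linarith⟩ (-b)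
      refine mul_le_mul ?_ le_rfl he0 hK₂
      refine le_trans ?_ this
      nlinarith
    · refine le_trans ?_ (le_add_left le_rfl)
      have hz : z ∈ {z : E | 1 ≤ ‖z‖} := show 1 ≤ ‖z‖ by linarith
      have hzp : 0 < ‖z‖ := by linarith
      simp only [F₃]
      rw [indicator_of_mem hz, ← ENNReal.ofReal_mul hK₃, max_eq_right (by linarith)]
      apply ENNReal.ofReal_le_ofReal
      have := rpow_le_add_of_mem_Icc (x := ‖e - z‖ / ‖z‖) (a := 1 / 2) (b := 2) (by norm_num)
        ⟨by rw [le_div_iff₀ hzp]; linarith, by rw [div_le_iff₀ hzp]; linarith⟩ (-q)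
      rw [Real.div_rpow (norm_nonneg _) hzp.le, div_le_iff₀ (Real.rpow_pos_of_pos hzp _)] at this
      rw [← Real.rpow_add hzp]
      refine (mul_le_mul_of_nonneg_left this (Real.rpow_nonneg hzp.le _)).trans (le_of_eq ?_)
      rw [mul_left_comm, ← Real.rpow_add hzp]
      congr 2
      rw [hq]; ring
  refine hle.trans_lt ?_
  rw [lintegral_add_right _ (by fun_prop), lintegral_add_left (by fun_prop),
    lintegral_const_mul _ hF₁, lintegral_const_mul _ hF₃, lintegral_const_mul _ (by fun_prop)]
  have hof := fun K => ENNReal.ofReal_lt_top (r := K)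
  exact ENNReal.add_lt_top.2 ⟨ENNReal.add_lt_top.2 ⟨ENNReal.mul_lt_top (hof _) I₁,
    ENNReal.mul_lt_top (hof _) I₂⟩, ENNReal.mul_lt_top (hof _) I₃⟩

/-- Comparison of kernels with exponents `q` and `q - p`. -/
lemma kernelInt_le_of_dominated {e : E} (he : ‖e‖ = 1) {q p : ℝ} {f g : ℝ → ℝ≥0∞}
    (hp : 0 ≤ p) (h : ∀ r, 0 < r → r ≠ 1 → f r ≤ ENNReal.ofReal (|1 - r| ^ p) * g r) :
    kernelInt e q f ≤ kernelInt e (q - p) g := by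
  apply lintegral_mono_ae
  have h1 : ∀ᵐ z : E, z ∉ Metric.sphere (0 : E) 1 :=
    measure_eq_zero_iff_ae_notMem.1 (Measure.addHaar_sphere _ _ _)
  have h2 : ∀ᵐ z : E, z ∉ ({0} : Set E) := measure_eq_zero_iff_ae_notMem.1 (measure_singleton _)
  filter_upwards [h1, h2] with z hz hz'
  simp only [mem_sphere_iff_norm, sub_zero, mem_singleton_iff] at hz hz'
  have hez : 0 < ‖e - z‖ := by
    rw [norm_pos_iff, sub_ne_zero]; rintro rfl; exact hz he
  have t : |1 - ‖z‖| ≤ ‖e - z‖ := by simpa [he] using abs_norm_sub_norm_le e z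
  calc f ‖z‖ * ENNReal.ofReal (‖e - z‖ ^ (-q))
      ≤ ENNReal.ofReal (‖e - z‖ ^ p) * g ‖z‖ * ENNReal.ofReal (‖e - z‖ ^ (-q)) := by
        gcongr
        refine (h _ (norm_pos_iff.2 hz') hz).trans ?_
        gcongr
    _ = g ‖z‖ * ENNReal.ofReal (‖e - z‖ ^ (-(q - p))) := by
        rw [show -(q - p) = p + -q by ring, Real.rpow_add hez, ENNReal.ofReal_mul (by positivity)]
        ring

end Finiteness

/-! ### Convergence and folding of the integral that defines 𝒞 -/

section Constant

lemma abs_one_sub_div_max_of_far {r : ℝ} (hr : 0 < r) (h : r ≤ 1 / 2 ∨ 2 ≤ r) :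
    1 ≤ 2 * (|1 - r| / max 1 r) := by
  rcases h with h | h
  · rw [max_eq_left (by linarith), abs_of_pos (by linarith)]; linarith
  · rw [max_eq_right (by linarith), abs_of_neg (by linarith), ← mul_div_assoc,
      le_div_iff₀ hr]; linarith

lemma abs_one_sub_le_of_near {r : ℝ} (h : r ≤ 2) :
    |1 - r| ≤ 2 * (|1 - r| / max 1 r) := by
  have hm : 0 < max 1 r := lt_max_of_lt_left one_pos
  have : max 1 r ≤ 2 := max_le (by norm_num) h
  rw [← mul_div_assoc, le_div_iff₀ hm]
  nlinarith [abs_nonneg (1 - r)]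

/-- On [1/2, 2] this is the mean value inequality; elsewhere |1-r|/max(1,r) is at least 1/2 and the
triangle inequality suffices. -/
lemma exists_abs_one_sub_rpow_le (g : ℝ) : ∃ K : ℝ, 0 ≤ K ∧ ∀ r : ℝ, 0 < r →
    |1 - r ^ (-g)| ≤ K * ((1 + r ^ (-g)) * (|1 - r| / max 1 r)) := by
  set M : ℝ := |g| * ((1 / 2 : ℝ) ^ (-g - 1) + 2 ^ (-g - 1)) with hM
  have hM0 : 0 ≤ M := by positivity
  refine ⟨2 + 2 * M, by positivity, fun r hr => ?_⟩
  have hg : 0 < r ^ (-g) := Real.rpow_pos_of_pos hr _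
  have hm : 0 ≤ |1 - r| / max 1 r := div_nonneg (abs_nonneg _) (le_max_of_le_left zero_le_one)
  have habs : |1 - r ^ (-g)| ≤ 1 + r ^ (-g) := by
    rw [abs_le]; constructor <;> linarith
  by_cases h : r ≤ 1 / 2 ∨ 2 ≤ r
  · have := abs_one_sub_div_max_of_far hr h
    nlinarith [mul_nonneg hM0 (mul_nonneg (by linarith : 0 ≤ 1 + r ^ (-g)) hm)]
  · push Not at h
    have hder : ∀ x ∈ Icc (1 / 2 : ℝ) 2, HasDerivWithinAt (fun x : ℝ => x ^ (-g))
        (-g * x ^ (-g - 1)) (Icc (1 / 2) 2) x := fun x hx =>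
      (Real.hasDerivAt_rpow_const (Or.inl (by linarith [hx.1] : x ≠ 0))).hasDerivWithinAt
    have hbd : ∀ x ∈ Icc (1 / 2 : ℝ) 2, ‖-g * x ^ (-g - 1)‖ ≤ M := by
      intro x hx
      have hx0 : 0 < x := by linarith [hx.1]
      rw [norm_mul, norm_neg, Real.norm_eq_abs, Real.norm_of_nonneg (by positivity)]
      exact mul_le_mul_of_nonneg_left (rpow_le_add_of_mem_Icc (by norm_num) hx _) (abs_nonneg _)
    have := (convex_Icc (1 / 2 : ℝ) 2).norm_image_sub_le_of_norm_hasDerivWithin_le hder hbd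
      (show r ∈ Icc (1 / 2 : ℝ) 2 from ⟨h.1.le, h.2.le⟩)
      (show (1 : ℝ) ∈ Icc (1 / 2 : ℝ) 2 by norm_num)
    simp only [Real.one_rpow, Real.norm_eq_abs] at this
    have h2 := abs_one_sub_le_of_near h.2.le
    have h3 := mul_le_mul_of_nonneg_left h2 hM0
    have h4 := mul_nonneg hM0 (mul_nonneg hg.le hm)
    have h5 := mul_nonneg (by linarith : 0 ≤ 1 + r ^ (-g)) hm
    linarith

lemma add_rpow_le_two_rpow {p x y : ℝ} (hp : 0 ≤ p) (hx : 0 ≤ x) (hy : 0 ≤ y) :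
    (x + y) ^ p ≤ 2 ^ p * (x ^ p + y ^ p) := by
  have h1 : (x + y) ^ p ≤ (2 * max x y) ^ p := by
    apply Real.rpow_le_rpow (by positivity) _ hp
    linarith [le_max_left x y, le_max_right x y]
  rw [Real.mul_rpow (by norm_num) (le_max_of_le_left hx)] at h1
  refine h1.trans (mul_le_mul_of_nonneg_left ?_ (by positivity))
  have := Real.rpow_nonneg hx p
  have := Real.rpow_nonneg hy p
  rcases max_choice x y with h | h <;> rw [h] <;> linarith

variable {E : Type*} [NormedAddCommGroup E] [InnerProductSpace ℝ E] [FiniteDimensional ℝ E]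
  [MeasurableSpace E] [BorelSpace E] [Nontrivial E]

/-- The profile vanishes like |1-r|^p at r = 1, and |1-|z|| ≤ |e-z| converts this into a gain of p
in the kernel exponent. What is left is a sum of two integrals with powers b and b+gp. -/
lemma kernelInt_one_sub_rpow_lt_top {e : E} (he : ‖e‖ = 1) {σ p b g : ℝ} (hp : 0 < p)
    (hσp : σ < p) (hb : -σ < b) (hb' : b < Module.finrank ℝ E) (hg : -σ < b + g * p)
    (hg' : b + g * p < Module.finrank ℝ E) :
    kernelInt e ((Module.finrank ℝ E : ℝ) + σ)
      (fun r => ENNReal.ofReal (|1 - r ^ (-g)| ^ p * r ^ (-b))) < ∞ := by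
  obtain ⟨K, hK, hKr⟩ := exists_abs_one_sub_rpow_le g
  have hdom := kernelInt_le_of_dominated he (q := (Module.finrank ℝ E : ℝ) + σ) (p := p)
    (f := fun r => ENNReal.ofReal (|1 - r ^ (-g)| ^ p * r ^ (-b)))
    (g := fun r => ENNReal.ofReal (K ^ p * 2 ^ p) *
      (ENNReal.ofReal ((max 1 r) ^ (-p) * r ^ (-b)) +
        ENNReal.ofReal ((max 1 r) ^ (-p) * r ^ (-(b + g * p))))) hp.le (by
      intro r hr _
      have hm : 0 < max 1 r := lt_max_of_lt_left one_pos
      rw [← ENNReal.ofReal_add (by positivity) (by positivity),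
        ← ENNReal.ofReal_mul (by positivity), ← ENNReal.ofReal_mul (by positivity)]
      apply ENNReal.ofReal_le_ofReal
      have h1 := Real.rpow_le_rpow (abs_nonneg _) (hKr r hr) hp.le
      have hg0 : 0 < r ^ (-g) := Real.rpow_pos_of_pos hr _
      rw [Real.mul_rpow hK (by positivity), Real.mul_rpow (by positivity) (by positivity),
        Real.div_rpow (abs_nonneg _) hm.le, div_eq_mul_inv, ← Real.rpow_neg hm.le] at h1
      have h2 := add_rpow_le_two_rpow hp.le zero_le_one hg0.le
      rw [Real.one_rpow, ← Real.rpow_mul hr.le] at h2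
      calc |1 - r ^ (-g)| ^ p * r ^ (-b)
          ≤ K ^ p * ((1 + r ^ (-g)) ^ p * (|1 - r| ^ p * max 1 r ^ (-p))) * r ^ (-b) := by
            gcongr
        _ ≤ K ^ p * (2 ^ p * (1 + r ^ (-g * p)) * (|1 - r| ^ p * max 1 r ^ (-p))) * r ^ (-b) := by
            gcongr
        _ = _ := by
            rw [show -(b + g * p) = -g * p + -b by ring, Real.rpow_add hr]; ring)
  refine hdom.trans_lt ?_
  have hmul : kernelInt e ((Module.finrank ℝ E : ℝ) + σ - p) (fun r =>
      ENNReal.ofReal (K ^ p * 2 ^ p) * (ENNReal.ofReal ((max 1 r) ^ (-p) * r ^ (-b)) +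
        ENNReal.ofReal ((max 1 r) ^ (-p) * r ^ (-(b + g * p))))) =
      ENNReal.ofReal (K ^ p * 2 ^ p) * kernelInt e ((Module.finrank ℝ E : ℝ) + σ - p) (fun r =>
        ENNReal.ofReal ((max 1 r) ^ (-p) * r ^ (-b)) +
        ENNReal.ofReal ((max 1 r) ^ (-p) * r ^ (-(b + g * p)))) := by
    rw [kernelInt, kernelInt, ← lintegral_const_mul' _ _ ENNReal.ofReal_ne_top]
    congr with z
    ring
  rw [hmul, kernelInt_add (by fun_prop)]
  exact ENNReal.mul_lt_top ENNReal.ofReal_lt_top (ENNReal.add_lt_top.2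
    ⟨kernelInt_lt_top he hp.le hσp hb hb', kernelInt_lt_top he hp.le hσp hg hg'⟩)

lemma kernelInt_pos {e : E} (he : ‖e‖ = 1) {q : ℝ} {f : ℝ → ℝ≥0∞} (hf : Measurable f)
    (h : ∀ r, 0 < r → r ≠ 1 → f r ≠ 0) : kernelInt e q f ≠ 0 := by
  intro h0
  rw [kernelInt, lintegral_eq_zero_iff (by fun_prop)] at h0
  have h1 : ∀ᵐ z : E, z ∉ Metric.sphere (0 : E) 1 :=
    measure_eq_zero_iff_ae_notMem.1 (Measure.addHaar_sphere _ _ _)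
  have h2 : ∀ᵐ z : E, z ∉ ({0} : Set E) := measure_eq_zero_iff_ae_notMem.1 (measure_singleton _)
  have h3 : ∀ᵐ z : E, False := by
    filter_upwards [h0, h1, h2] with z hz0 hz hz'
    simp only [mem_sphere_iff_norm, sub_zero, mem_singleton_iff] at hz hz'
    have hez : 0 < ‖e - z‖ := by
      rw [norm_pos_iff, sub_ne_zero]; rintro rfl; exact hz he
    simp only [Pi.zero_apply, mul_eq_zero, ENNReal.ofReal_eq_zero] at hz0
    rcases hz0 with h4 | h4
    · exact h _ (norm_pos_iff.2 hz') hz h4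
    · exact absurd (Real.rpow_pos_of_pos hez (-q)) (not_lt.2 h4)
  rw [Filter.eventually_false_iff_eq_bot, ae_eq_bot] at h3
  exact NeZero.ne (volume : Measure E) h3

/-- Folding a radial integral onto the unit ball. -/
lemma kernelInt_fold {e : E} (he : ‖e‖ = 1) {σ : ℝ} {f : ℝ → ℝ≥0∞} (hf : Measurable f) :
    kernelInt e ((Module.finrank ℝ E : ℝ) + σ) f =
      kernelInt e ((Module.finrank ℝ E : ℝ) + σ) ((Iio 1).indicator fun r =>
        f r + f r⁻¹ * ENNReal.ofReal (r ^ (σ - Module.finrank ℝ E))) := by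
  set d : ℝ := ((Module.finrank ℝ E : ℕ) : ℝ) with hd
  have h1 : kernelInt e (d + σ) f =
      kernelInt e (d + σ) (fun r => (Iio 1).indicator f r + (Ioi 1).indicator f r) := by
    apply kernelInt_congr
    intro r hr hr1
    rcases lt_or_gt_of_ne hr1 with h | h
    · simp [h, h.le]
    · simp [h, h.le]
  rw [h1, kernelInt_add (hf.indicator measurableSet_Iio),
    kernelInt_inv (hf.indicator measurableSet_Ioi) he, ← hd,
    ← kernelInt_add (hf.indicator measurableSet_Iio)]
  apply kernelInt_congr
  intro r hr hr1
  rcases lt_or_gt_of_ne hr1 with h | h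
  · have : 1 < r⁻¹ := (one_lt_inv₀ hr).2 h
    rw [indicator_of_mem (show r ∈ Iio (1 : ℝ) from h),
      indicator_of_mem (show r ∈ Iio (1 : ℝ) from h),
      indicator_of_mem (show r⁻¹ ∈ Ioi (1 : ℝ) from this)]
    congr 4; ring
  · have : r⁻¹ < 1 := inv_lt_one_of_one_lt₀ h
    rw [indicator_of_notMem (show r ∉ Iio (1 : ℝ) from not_lt.2 h.le),
      indicator_of_notMem (show r ∉ Iio (1 : ℝ) from not_lt.2 h.le),
      indicator_of_notMem (show r⁻¹ ∉ Ioi (1 : ℝ) from not_lt.2 this.le)]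
    simp

end Constant

/-! ### The Hardy constant as an integral over ℝ^d -/

section HardyConst

variable {d : ℕ} {s p α β : ℝ}

/-- The choice of g gives -gp-β = α+sp-d. Hence inversion exchanges the roles of α and β, which
accounts for the sum r^α + r^β in 𝒞. -/
lemma hardy_profile_inv {r g : ℝ} (hr : 0 < r)
    (hg : g * p = (d : ℝ) - α - β - s * p) :
    |1 - r ^ (-g)| ^ p * r ^ (-β) = |1 - r ^ g| ^ p * (r ^ α * r ^ (s * p - d)) := by
  have h1 : 1 - r ^ (-g) = -(1 - r ^ g) * r ^ (-g) := by
    have : r ^ g * r ^ (-g) = 1 := by rw [← Real.rpow_add hr]; simp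
    linear_combination -this
  rw [h1, abs_mul, abs_neg, abs_of_pos (Real.rpow_pos_of_pos hr _),
    Real.mul_rpow (abs_nonneg _) (by positivity), ← Real.rpow_mul hr.le, mul_assoc,
    ← Real.rpow_add hr, ← Real.rpow_add hr]
  congr 2
  linarith

/-- The weighted Hardy constant as an integral over the unit ball of `ℝ^d`. -/
lemma kernelInt_fold_profile {e : EuclideanSpace ℝ (Fin d)} [Nontrivial (EuclideanSpace ℝ (Fin d))]
    (he : ‖e‖ = 1) {g : ℝ} (hg : g * p = (d : ℝ) - α - β - s * p) :
    kernelInt e ((d : ℝ) + s * p) (fun r => ENNReal.ofReal (|1 - r ^ (-g)| ^ p * r ^ (-β))) =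
      kernelInt e ((d : ℝ) + s * p) ((Iio 1).indicator fun r =>
        ENNReal.ofReal (|1 - r ^ g| ^ p * ((r ^ α + r ^ β) * r ^ (s * p - d)))) := by
  have hfold := kernelInt_fold he (σ := s * p)
    (f := fun r => ENNReal.ofReal (|1 - r ^ (-g)| ^ p * r ^ (-β))) (by fun_prop)
  rw [finrank_euclideanSpace_fin] at hfold
  rw [hfold]
  apply kernelInt_congr
  intro r hr _
  by_cases h : r ∈ Iio (1 : ℝ)
  · have hi : r⁻¹ ^ (-g) = r ^ g := by rw [Real.inv_rpow hr.le, Real.rpow_neg hr.le, inv_inv]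
    have hi' : r⁻¹ ^ (-β) = r ^ β := by rw [Real.inv_rpow hr.le, Real.rpow_neg hr.le, inv_inv]
    rw [indicator_of_mem h, indicator_of_mem h, hardy_profile_inv hr hg, hi, hi',
      ← ENNReal.ofReal_mul (by positivity), ← ENNReal.ofReal_add (by positivity) (by positivity)]
    congr 1; ring
  · rw [indicator_of_notMem h, indicator_of_notMem h]

lemma measurable_Phi (d : ℕ) (s p : ℝ) : Measurable (Phi d s p) := by
  unfold Phi
  split_ifs with h
  · refine Measurable.const_mul ?_ _
    have : Measurable fun z : ℝ × ℝ => (1 - z.2 ^ 2) ^ (((d : ℝ) - 3) / 2) /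
      (1 - 2 * z.2 * z.1 + z.1 ^ 2) ^ (((d : ℝ) + s * p) / 2) := by fun_prop
    exact (this.stronglyMeasurable.integral_prod_right (ν := volume.restrict (Ioo (-1) 1))).measurable
  · fun_prop

variable (hd : 1 ≤ d) (hs : s ∈ Ioo (0 : ℝ) 1) (hp : p ∈ Ioo (1 : ℝ) 2)
  (hα : α ∈ Ioo (-(s * p)) (d : ℝ)) (hβ : β ∈ Ioo (-(s * p)) (d : ℝ))
include hd hs hp hα hβ

lemma kernelInt_hardy_lt_top {e : EuclideanSpace ℝ (Fin d)} (he : ‖e‖ = 1) {g : ℝ}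
    (hg : g * p = (d : ℝ) - α - β - s * p) :
    kernelInt e ((d : ℝ) + s * p) (fun r => ENNReal.ofReal (|1 - r ^ (-g)| ^ p * r ^ (-β))) < ∞ := by
  have : Nonempty (Fin d) := ⟨⟨0, hd⟩⟩
  -- The second exponent is β+gp = d-α-sp, which lies in (-sp, d) precisely when α does.
  have h := kernelInt_one_sub_rpow_lt_top he (σ := s * p) (p := p) (b := β) (g := g)
    (by linarith [hp.1]) (by nlinarith [hs.1, hs.2, hp.1]) hβ.1
    (by rw [finrank_euclideanSpace_fin]; exact hβ.2)
    (by rw [hg]; linarith [hα.2]) (by rw [hg, finrank_euclideanSpace_fin]; linarith [hα.1])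
  rwa [finrank_euclideanSpace_fin] at h

/-- The weighted Hardy constant as an integral over `ℝ^d`. -/
lemma ofReal_hardyConst {e : EuclideanSpace ℝ (Fin d)} (he : ‖e‖ = 1) {g : ℝ}
    (hg : g * p = (d : ℝ) - α - β - s * p) :
    ENNReal.ofReal (hardyConst d s p α β) =
      kernelInt e ((d : ℝ) + s * p) (fun r => ENNReal.ofReal (|1 - r ^ (-g)| ^ p * r ^ (-β))) := by
  have : Nonempty (Fin d) := ⟨⟨0, hd⟩⟩
  have hp0 : 0 < p := by linarith [hp.1]
  have hfin := kernelInt_hardy_lt_top hd hs hp hα hβ he hg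
  have hg' : ((d : ℝ) - α - β - s * p) / p = g := by rw [← hg]; field_simp
  rw [kernelInt_fold_profile he hg, kernelInt_indicator_Iio hd (by fun_prop) he] at hfin ⊢
  have heq : ∫⁻ r in Ioo (0 : ℝ) 1, ENNReal.ofReal (|1 - r ^ g| ^ p *
      ((r ^ α + r ^ β) * r ^ (s * p - d))) * ENNReal.ofReal (r ^ ((d : ℝ) - 1) * Phi d s p r) =
      ∫⁻ r in Ioo (0 : ℝ) 1, ENNReal.ofReal (r ^ (s * p - 1) * (r ^ α + r ^ β) *
        |1 - r ^ (((d : ℝ) - α - β - s * p) / p)| ^ p * Phi d s p r) := by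
    apply setLIntegral_congr_fun measurableSet_Ioo
    intro r hr
    have hr0 : 0 < r := hr.1
    simp only
    rw [← ENNReal.ofReal_mul (by positivity), hg',
      show s * p - 1 = (s * p - d) + (d - 1) by ring, Real.rpow_add hr0]
    congr 1; ring
  rw [heq] at hfin ⊢
  have hnn : 0 ≤ᵐ[volume.restrict (Ioo (0 : ℝ) 1)] fun r => r ^ (s * p - 1) * (r ^ α + r ^ β) *
        |1 - r ^ (((d : ℝ) - α - β - s * p) / p)| ^ p * Phi d s p r :=
    (ae_restrict_iff' measurableSet_Ioo).2 (.of_forall fun r hr => by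
      have hr0 : 0 < r := hr.1
      have := Phi_nonneg (d := d) (s := s) (p := p) hr
      simp only [Pi.zero_apply]
      positivity)
  have hm : Measurable fun r => r ^ (s * p - 1) * (r ^ α + r ^ β) *
        |1 - r ^ (((d : ℝ) - α - β - s * p) / p)| ^ p * Phi d s p r := by
    have := measurable_Phi d s p
    fun_prop
  have hint : Integrable (fun r => r ^ (s * p - 1) * (r ^ α + r ^ β) *
        |1 - r ^ (((d : ℝ) - α - β - s * p) / p)| ^ p * Phi d s p r)
        (volume.restrict (Ioo (0 : ℝ) 1)) :=
    ⟨hm.aestronglyMeasurable, (hasFiniteIntegral_iff_ofReal hnn).2 hfin⟩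
  rw [hardyConst, ofReal_integral_eq_lintegral_ofReal hint hnn]

/-- Since sp+α+β ≠ d means g ≠ 0, the profile |1-r^(-g)| vanishes only on the null set r = 1. -/
lemma hardyConst_pos (hne : s * p + α + β ≠ d) : 0 < hardyConst d s p α β := by
  have : Nonempty (Fin d) := ⟨⟨0, hd⟩⟩
  have hp0 : 0 < p := by linarith [hp.1]
  set g := ((d : ℝ) - α - β - s * p) / p with hgdef
  have hg : g * p = (d : ℝ) - α - β - s * p := by rw [hgdef]; field_simp
  have hg0 : g ≠ 0 := by
    intro h
    rw [h, zero_mul] at hg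
    exact hne (by linarith)
  have he : ‖EuclideanSpace.single (⟨0, hd⟩ : Fin d) (1 : ℝ)‖ = 1 := by simp
  have h := kernelInt_pos he (q := (d : ℝ) + s * p)
    (f := fun r => ENNReal.ofReal (|1 - r ^ (-g)| ^ p * r ^ (-β))) (by fun_prop) (by
      intro r hr hr1
      rw [ne_eq, ENNReal.ofReal_eq_zero, not_le]
      have : 1 - r ^ (-g) ≠ 0 := by
        intro h
        have h2 : r ^ (-g) = 1 := by linarith
        have h3 := congrArg Real.log h2
        rw [Real.log_rpow hr, Real.log_one, mul_eq_zero, neg_eq_zero] at h3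
        exact h3.elim hg0 (Real.log_ne_zero_of_pos_of_ne_one hr hr1)
      have := abs_pos.2 this
      positivity)
  rw [← ofReal_hardyConst hd hs hp hα hβ he hg, ne_eq, ENNReal.ofReal_eq_zero, not_le] at h
  exact h

end HardyConst

/-! ### Truncation near |x| = |y| and symmetrization -/

section Core

/-- The indicator function of `(-∞, η)`. -/
noncomputable def cutoff (η : ℝ) : ℝ → ℝ≥0∞ := (Iio η).indicator 1

@[fun_prop]
lemma measurable_cutoff (η : ℝ) : Measurable (cutoff η) :=
  measurable_one.indicator measurableSet_Iio

lemma cutoff_of_lt {η r : ℝ} (h : r < η) : cutoff η r = 1 :=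
  indicator_of_mem (show r ∈ Iio η from h) _

lemma cutoff_of_le {η r : ℝ} (h : η ≤ r) : cutoff η r = 0 :=
  indicator_of_notMem (show r ∉ Iio η from not_lt.2 h) _

lemma cutoff_mono {η η' : ℝ} (h : η ≤ η') (r : ℝ) : cutoff η r ≤ cutoff η' r := by
  rcases lt_or_ge r η with h1 | h1
  · rw [cutoff_of_lt h1, cutoff_of_lt (h1.trans_le h)]
  · rw [cutoff_of_le h1]; exact zero_le

/-- Monotone convergence along thresholds increasing to 1; the shift by 2 keeps them in (0,1)
already at n = 0. -/
lemma tendsto_lintegral_cutoff {X : Type*} [MeasurableSpace X] (μ : Measure X) {t : X → ℝ}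
    (ht : Measurable t) {f : X → ℝ≥0∞} (hf : Measurable f) :
    Filter.Tendsto (fun n : ℕ => ∫⁻ x, cutoff (1 - 1 / ((n : ℝ) + 2)) (t x) * f x ∂μ) Filter.atTop
      (nhds (∫⁻ x, cutoff 1 (t x) * f x ∂μ)) := by
  have hmono : Monotone fun n : ℕ => 1 - 1 / ((n : ℝ) + 2) := by
    intro m n hmn
    have : (m : ℝ) ≤ n := by exact_mod_cast hmn
    simp only
    gcongr
  refine lintegral_tendsto_of_tendsto_of_monotone (fun n => by fun_prop)
    (.of_forall fun x m n hmn => ?_) (.of_forall fun x => ?_)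
  · exact mul_le_mul_left (cutoff_mono (hmono hmn) _) _
  · rcases lt_or_ge (t x) 1 with h | h
    · rw [cutoff_of_lt h]
      obtain ⟨N, hN⟩ := exists_nat_gt (1 / (1 - t x))
      apply tendsto_const_nhds.congr'
      filter_upwards [Filter.eventually_ge_atTop N] with n hn
      rw [cutoff_of_lt]
      have h1 : (N : ℝ) ≤ n := by exact_mod_cast hn
      have h2 : 1 / ((n : ℝ) + 2) < 1 - t x := by
        rw [div_lt_comm₀ (by positivity) (by linarith)]; linarith
      linarith
    · rw [cutoff_of_le h]
      apply tendsto_const_nhds.congr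
      intro n
      rw [cutoff_of_le]
      have : 0 < 1 / ((n : ℝ) + 2) := by positivity
      linarith

variable {E : Type*} [NormedAddCommGroup E] [InnerProductSpace ℝ E] [FiniteDimensional ℝ E]
  [MeasurableSpace E] [BorelSpace E] [Nontrivial E]

lemma ae_prod_ne_zero : ∀ᵐ z : E × E, z.1 ≠ 0 ∧ z.2 ≠ 0 := by
  have h1 : ∀ᵐ x : E, x ≠ 0 := measure_eq_zero_iff_ae_notMem.1 (measure_singleton (0 : E))
  have h2 : ∀ᵐ z : E × E, z.1 ≠ 0 := Measure.quasiMeasurePreserving_fst.ae h1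
  have h3 : ∀ᵐ z : E × E, z.2 ≠ 0 := Measure.quasiMeasurePreserving_snd.ae h1
  exact h2.and h3

lemma ae_prod_norm_ne : ∀ᵐ z : E × E, ‖z.2‖ ≠ ‖z.1‖ := by
  have hs : MeasurableSet {z : E × E | ‖z.2‖ ≠ ‖z.1‖} :=
    (measurableSet_eq_fun (by fun_prop) (by fun_prop)).compl
  rw [Measure.volume_eq_prod, Measure.ae_prod_iff_ae_ae hs]
  refine .of_forall fun x => ?_
  have := measure_eq_zero_iff_ae_notMem.1 (Measure.addHaar_sphere (volume : Measure E) 0 ‖x‖)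
  filter_upwards [this] with y hy
  simpa using hy

/-- Separation of variables with the first point fixed. -/
lemma lintegral_prod_ratio {G : E → ℝ≥0∞} (hG : Measurable G) {f : ℝ → ℝ≥0∞} (hf : Measurable f)
    {e : E} (he : ‖e‖ = 1) (q : ℝ) :
    ∫⁻ z : E × E, G z.1 * (f (‖z.2‖ / ‖z.1‖) * ENNReal.ofReal (‖z.1 - z.2‖ ^ (-q))) =
      (∫⁻ x, G x * ENNReal.ofReal (‖x‖ ^ ((Module.finrank ℝ E : ℝ) - q))) * kernelInt e q f := by
  have h1 : ∀ᵐ x : E, x ≠ 0 := measure_eq_zero_iff_ae_notMem.1 (measure_singleton (0 : E))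
  rw [Measure.volume_eq_prod, lintegral_prod _ (by fun_prop), ← lintegral_mul_const _ (by fun_prop)]
  apply lintegral_congr_ae
  filter_upwards [h1] with x hx
  rw [lintegral_const_mul _ (by fun_prop), lintegral_ratio_kernel hf he hx, mul_assoc]

/-- The singular weight `‖x - y‖^{-q} ‖x‖^{-a} ‖y‖^{-b}`. -/
noncomputable def weight (q a b : ℝ) (z : E × E) : ℝ :=
  ‖z.1 - z.2‖ ^ (-q) * ‖z.1‖ ^ (-a) * ‖z.2‖ ^ (-b)

omit [InnerProductSpace ℝ E] [FiniteDimensional ℝ E] [MeasurableSpace E] [BorelSpace E]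
  [Nontrivial E] in
lemma weight_nonneg (q a b : ℝ) (z : E × E) : 0 ≤ weight q a b z := by
  unfold weight; positivity

omit [InnerProductSpace ℝ E] [FiniteDimensional ℝ E] [MeasurableSpace E] [BorelSpace E]
  [Nontrivial E] in
lemma weight_swap (q a b : ℝ) (z : E × E) : weight q a b z.swap = weight q b a z := by
  simp only [weight, Prod.fst_swap, Prod.snd_swap]
  rw [norm_sub_rev]; ring

omit [Nontrivial E] in
@[fun_prop]
lemma measurable_weight (q a b : ℝ) : Measurable (weight q a b : E × E → ℝ) := by
  unfold weight; fun_prop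

/-- Symmetrization of a double integral, folded onto `‖y‖ < ‖x‖`. -/
lemma lintegral_symmetrize {S : E × E → ℝ≥0∞} (hS : Measurable S) (hsymm : ∀ z, S z.swap = S z)
    (q a b : ℝ) :
    ∫⁻ z, S z * ENNReal.ofReal (weight q a b z) =
      ∫⁻ z, cutoff 1 (‖z.2‖ / ‖z.1‖) *
        (S z * ENNReal.ofReal (weight q a b z + weight q b a z)) := by
  have h1 : ∫⁻ z : E × E, cutoff 1 (‖z.1‖ / ‖z.2‖) * (S z * ENNReal.ofReal (weight q a b z)) =
      ∫⁻ z : E × E, cutoff 1 (‖z.2‖ / ‖z.1‖) * (S z * ENNReal.ofReal (weight q b a z)) := by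
    rw [Measure.volume_eq_prod, ← lintegral_prod_swap]
    congr with z
    rw [hsymm, weight_swap, Prod.fst_swap, Prod.snd_swap]
  simp_rw [ENNReal.ofReal_add (weight_nonneg q a b _) (weight_nonneg q b a _), mul_add]
  rw [lintegral_add_left (by fun_prop), ← h1, ← lintegral_add_left (by fun_prop)]
  apply lintegral_congr_ae
  filter_upwards [ae_prod_ne_zero, ae_prod_norm_ne] with z hz hne
  have hz1 : 0 < ‖z.1‖ := norm_pos_iff.2 hz.1
  have hz2 : 0 < ‖z.2‖ := norm_pos_iff.2 hz.2
  rcases lt_or_gt_of_ne hne with h | h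
  · rw [cutoff_of_lt ((div_lt_one hz1).2 h), cutoff_of_le ((one_le_div hz2).2 h.le)]
    simp
  · rw [cutoff_of_le ((one_le_div hz1).2 h.le), cutoff_of_lt ((div_lt_one hz2).2 h)]
    simp

end Core

/-! ### The ground state terms and their truncated constants -/

section CoreInequality

variable {d : ℕ} {s p α β g : ℝ}

lemma groundState_eq (hg : g * p = (d : ℝ) - α - β - s * p) (hp : 0 < p)
    (x : EuclideanSpace ℝ (Fin d)) : groundState s p α β x = ‖x‖ ^ (-g) := by
  rw [groundState, ← hg, mul_div_cancel_right₀ _ hp.ne']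

lemma transform_eq (hg : g * p = (d : ℝ) - α - β - s * p) (hp : 0 < p)
    (u : EuclideanSpace ℝ (Fin d) → ℝ) (x : EuclideanSpace ℝ (Fin d)) :
    transform s p α β u x = u x * ‖x‖ ^ g := by
  rw [transform, ← hg, mul_div_cancel_right₀ _ hp.ne']

/-- The powers of X coming from the ground state have exponents -g(p-1), -g and gp, which cancel;
everything but |U|^p X^(-α-β) depends on Y/X and k alone. -/
lemma radial_profile_identity {X Y U k : ℝ} (hX : 0 < X) (hY : 0 < Y) :
    |X ^ (-g) - Y ^ (-g)| ^ (p - 1) * (X ^ (-g) * |U * X ^ g| ^ p) *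
        (k * X ^ (-α) * Y ^ (-β) + k * X ^ (-β) * Y ^ (-α)) =
      |U| ^ p * X ^ (-α - β) * (|1 - (Y / X) ^ (-g)| ^ (p - 1) *
        ((Y / X) ^ (-α) + (Y / X) ^ (-β)) * k) := by
  obtain ⟨r, hr, rfl⟩ : ∃ r, 0 < r ∧ Y = r * X := ⟨Y / X, by positivity, by field_simp⟩
  rw [mul_div_cancel_right₀ _ hX.ne']
  simp only [Real.mul_rpow hr.le hX.le]
  have h1 : X ^ (-g) - r ^ (-g) * X ^ (-g) = (1 - r ^ (-g)) * X ^ (-g) := by ring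
  have hXg : 0 < X ^ (-g) := Real.rpow_pos_of_pos hX _
  have hXg' : 0 < X ^ g := Real.rpow_pos_of_pos hX _
  rw [h1, abs_mul, abs_of_pos hXg, Real.mul_rpow (abs_nonneg _) hXg.le, abs_mul, abs_of_pos hXg',
    Real.mul_rpow (abs_nonneg _) hXg'.le, ← Real.rpow_mul hX.le, ← Real.rpow_mul hX.le]
  have h2 : X ^ (-g * (p - 1)) * X ^ (-g) * X ^ (g * p) = 1 := by
    rw [← Real.rpow_add hX, ← Real.rpow_add hX,
      show -g * (p - 1) + -g + g * p = 0 by ring, Real.rpow_zero]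
  have h3 : X ^ (-α - β) = X ^ (-α) * X ^ (-β) := by rw [← Real.rpow_add hX]; rfl
  rw [h3]
  linear_combination (|1 - r ^ (-g)| ^ (p - 1) * |U| ^ p * k * X ^ (-α) * X ^ (-β) *
    (r ^ (-α) + r ^ (-β))) * h2

/-- The densities of the two ground state constants differ by the factor r^g. Their difference thus
carries 1-r^g, the missing power in the density |1-r^g|^p of the Hardy constant. -/
lemma profile_identity {r : ℝ} (hr : 0 < r) (hg : g * p = (d : ℝ) - α - β - s * p) :
    |1 - r ^ (-g)| ^ (p - 1) * (r ^ (-α) + r ^ (-β)) =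
      r ^ g * (|1 - r ^ g| ^ (p - 1) * ((r ^ α + r ^ β) * r ^ (s * p - d))) := by
  have h1 : 1 - r ^ (-g) = -(1 - r ^ g) * r ^ (-g) := by
    have : r ^ g * r ^ (-g) = 1 := by rw [← Real.rpow_add hr]; simp
    linear_combination -this
  rw [h1, abs_mul, abs_neg, abs_of_pos (Real.rpow_pos_of_pos hr _),
    Real.mul_rpow (abs_nonneg _) (by positivity), ← Real.rpow_mul hr.le]
  have h2 : r ^ (-g * (p - 1)) * r ^ (-α) = r ^ g * r ^ β * r ^ (s * p - d) := by
    rw [← Real.rpow_add hr, ← Real.rpow_add hr, ← Real.rpow_add hr]; congr 1; linarith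
  have h3 : r ^ (-g * (p - 1)) * r ^ (-β) = r ^ g * r ^ α * r ^ (s * p - d) := by
    rw [← Real.rpow_add hr, ← Real.rpow_add hr, ← Real.rpow_add hr]; congr 1; linarith
  linear_combination |1 - r ^ g| ^ (p - 1) * (h2 + h3)

lemma ofReal_hardyIntegrand {F : Type*} [NormedAddCommGroup F] (u : EuclideanSpace ℝ (Fin d) → F)
    {x : EuclideanSpace ℝ (Fin d)} (hx : x ≠ 0) :
    ENNReal.ofReal (hardyIntegrand s p α β u x) =
      ENNReal.ofReal (‖u x‖ ^ p * ‖x‖ ^ (-α - β)) *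
        ENNReal.ofReal (‖x‖ ^ ((d : ℝ) - (d + s * p))) := by
  have hx0 : 0 < ‖x‖ := norm_pos_iff.2 hx
  rw [← ENNReal.ofReal_mul (by positivity), hardyIntegrand, mul_assoc, ← Real.rpow_add hx0,
    div_eq_mul_inv, ← Real.rpow_neg hx0.le]
  congr 3; ring

lemma lintegral_hardyIntegrand [Nontrivial (EuclideanSpace ℝ (Fin d))] {F : Type*}
    [NormedAddCommGroup F] (u : EuclideanSpace ℝ (Fin d) → F) :
    ∫⁻ x, ENNReal.ofReal (hardyIntegrand s p α β u x) =
      ∫⁻ x, ENNReal.ofReal (‖u x‖ ^ p * ‖x‖ ^ (-α - β)) *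
        ENNReal.ofReal (‖x‖ ^ ((d : ℝ) - (d + s * p))) := by
  apply lintegral_congr_ae
  filter_upwards [measure_eq_zero_iff_ae_notMem.1
    (measure_singleton (0 : EuclideanSpace ℝ (Fin d)))] with x hx
  exact ofReal_hardyIntegrand u hx

/-- The double integrals of the ground state substitution factor through the Hardy integral. -/
lemma lintegral_groundState_term [Nontrivial (EuclideanSpace ℝ (Fin d))]
    {u : EuclideanSpace ℝ (Fin d) → ℝ} (hu : Measurable u) {χ : ℝ → ℝ≥0∞} (hχ : Measurable χ)
    {e : EuclideanSpace ℝ (Fin d)} (he : ‖e‖ = 1) :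
    ∫⁻ z : EuclideanSpace ℝ (Fin d) × EuclideanSpace ℝ (Fin d), χ (‖z.2‖ / ‖z.1‖) *
      (ENNReal.ofReal (|‖z.1‖ ^ (-g) - ‖z.2‖ ^ (-g)| ^ (p - 1) *
        (‖z.1‖ ^ (-g) * |u z.1 * ‖z.1‖ ^ g| ^ p)) *
        ENNReal.ofReal (weight ((d : ℝ) + s * p) α β z + weight ((d : ℝ) + s * p) β α z)) =
    (∫⁻ x, ENNReal.ofReal (hardyIntegrand s p α β u x)) * kernelInt e ((d : ℝ) + s * p)
      fun r => χ r * ENNReal.ofReal (|1 - r ^ (-g)| ^ (p - 1) * (r ^ (-α) + r ^ (-β))) := by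
  have h := lintegral_prod_ratio (G := fun x : EuclideanSpace ℝ (Fin d) =>
      ENNReal.ofReal (‖u x‖ ^ p * ‖x‖ ^ (-α - β))) (by fun_prop)
    (f := fun r => χ r * ENNReal.ofReal (|1 - r ^ (-g)| ^ (p - 1) * (r ^ (-α) + r ^ (-β))))
    (by fun_prop) he ((d : ℝ) + s * p)
  rw [finrank_euclideanSpace_fin] at h
  rw [lintegral_hardyIntegrand, ← h]
  apply lintegral_congr_ae
  filter_upwards [ae_prod_ne_zero] with z hz
  have hz1 : 0 < ‖z.1‖ := norm_pos_iff.2 hz.1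
  have hz2 : 0 < ‖z.2‖ := norm_pos_iff.2 hz.2
  rw [← ENNReal.ofReal_mul (by positivity), mul_assoc (χ _), ← ENNReal.ofReal_mul (by positivity),
    mul_left_comm _ (χ _), ← ENNReal.ofReal_mul (by positivity), weight, weight,
    radial_profile_identity hz1 hz2, Real.norm_eq_abs]

/-- Exchanging x and y gives the previous term with χ(1/r); `kernelInt_inv` then returns to χ(r). -/
lemma lintegral_groundState_term_snd [Nontrivial (EuclideanSpace ℝ (Fin d))]
    {u : EuclideanSpace ℝ (Fin d) → ℝ} (hu : Measurable u) {χ : ℝ → ℝ≥0∞} (hχ : Measurable χ)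
    {e : EuclideanSpace ℝ (Fin d)} (he : ‖e‖ = 1) :
    ∫⁻ z : EuclideanSpace ℝ (Fin d) × EuclideanSpace ℝ (Fin d), χ (‖z.2‖ / ‖z.1‖) *
      (ENNReal.ofReal (|‖z.1‖ ^ (-g) - ‖z.2‖ ^ (-g)| ^ (p - 1) *
        (‖z.2‖ ^ (-g) * |u z.2 * ‖z.2‖ ^ g| ^ p)) *
        ENNReal.ofReal (weight ((d : ℝ) + s * p) α β z + weight ((d : ℝ) + s * p) β α z)) =
    (∫⁻ x, ENNReal.ofReal (hardyIntegrand s p α β u x)) * kernelInt e ((d : ℝ) + s * p)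
      fun r => χ r * ENNReal.ofReal
        (|1 - r ^ g| ^ (p - 1) * ((r ^ α + r ^ β) * r ^ (s * p - d))) := by
  have h := lintegral_groundState_term (s := s) (p := p) (α := α) (β := β) (g := g) hu
    (χ := fun r => χ r⁻¹) (by fun_prop) he
  rw [kernelInt_inv (by fun_prop) he, finrank_euclideanSpace_fin] at h
  have h2 : kernelInt e ((d : ℝ) + s * p) (fun r => χ r * ENNReal.ofReal
        (|1 - r ^ g| ^ (p - 1) * ((r ^ α + r ^ β) * r ^ (s * p - d)))) =
      kernelInt e ((d : ℝ) + s * p) fun r => χ r⁻¹⁻¹ * ENNReal.ofReal (|1 - r⁻¹ ^ (-g)| ^ (p - 1) *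
        (r⁻¹ ^ (-α) + r⁻¹ ^ (-β))) * ENNReal.ofReal (r ^ ((d : ℝ) + s * p - 2 * d)) := by
    apply kernelInt_congr
    intro r hr _
    have hi : ∀ k : ℝ, r⁻¹ ^ (-k) = r ^ k := fun k => by
      rw [Real.inv_rpow hr.le, Real.rpow_neg hr.le, inv_inv]
    rw [inv_inv, hi, hi, hi, mul_assoc, ← ENNReal.ofReal_mul (by positivity), mul_assoc]
    congr 5; ring
  rw [h2, ← h, Measure.volume_eq_prod, ← lintegral_prod_swap]
  congr with z
  rw [Prod.fst_swap, Prod.snd_swap, inv_div, weight_swap, weight_swap, abs_sub_comm, add_comm]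

lemma kernelInt_const_mul {E : Type*} [NormedAddCommGroup E] [InnerProductSpace ℝ E]
    [FiniteDimensional ℝ E] [MeasurableSpace E] [BorelSpace E] (e : E) (q : ℝ) {c : ℝ≥0∞}
    (hc : c ≠ ∞) (f : ℝ → ℝ≥0∞) :
    kernelInt e q (fun r => c * f r) = c * kernelInt e q f := by
  rw [kernelInt, kernelInt, ← lintegral_const_mul' _ _ hc]
  congr with z
  ring

lemma kernelInt_mono {E : Type*} [NormedAddCommGroup E] [InnerProductSpace ℝ E]
    [FiniteDimensional ℝ E] [MeasurableSpace E] [BorelSpace E] [Nontrivial E] {e : E} {q : ℝ}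
    {f f' : ℝ → ℝ≥0∞} (h : ∀ r, 0 < r → r ≠ 1 → f r ≤ f' r) :
    kernelInt e q f ≤ kernelInt e q f' := by
  have h1 : kernelInt e q f' = kernelInt e q fun r => max (f r) (f' r) :=
    kernelInt_congr fun r hr hr1 => (max_eq_right (h r hr hr1)).symm
  rw [h1]
  apply lintegral_mono fun z => ?_
  gcongr
  exact le_max_left _ _

/-- The algebraic relation between the three truncated constants, with the finiteness needed for
cancellation. -/
lemma truncated_constants [Nontrivial (EuclideanSpace ℝ (Fin d))] (hp : 1 < p) (hg0 : g ≠ 0)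
    (hg : g * p = (d : ℝ) - α - β - s * p) {e : EuclideanSpace ℝ (Fin d)} {η : ℝ}
    (hη : η ∈ Ioo (0 : ℝ) 1) {c₁ c₂ c : ℝ≥0∞}
    (hc₁ : c₁ = kernelInt e ((d : ℝ) + s * p) fun r => cutoff η r *
      ENNReal.ofReal (|1 - r ^ (-g)| ^ (p - 1) * (r ^ (-α) + r ^ (-β))))
    (hc₂ : c₂ = kernelInt e ((d : ℝ) + s * p) fun r => cutoff η r *
      ENNReal.ofReal (|1 - r ^ g| ^ (p - 1) * ((r ^ α + r ^ β) * r ^ (s * p - d))))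
    (hc : c = kernelInt e ((d : ℝ) + s * p) fun r => cutoff η r *
      ENNReal.ofReal (|1 - r ^ g| ^ p * ((r ^ α + r ^ β) * r ^ (s * p - d)))) (hfin : c < ∞) :
    (0 < g ∧ c₂ = c₁ + c ∧ c₁ < ∞) ∨ (g < 0 ∧ c₁ = c₂ + c ∧ c₂ < ∞) := by
  have hpow : ∀ r : ℝ, |1 - r ^ g| ^ p = |1 - r ^ g| * |1 - r ^ g| ^ (p - 1) := fun r => by
    rw [← Real.rpow_one_add' (abs_nonneg _) (by linarith)]; congr 1; ring
  have hηg : |1 - η ^ g| ≠ 0 := by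
    intro h
    have h2 : η ^ g = 1 := by linarith [abs_eq_zero.1 h]
    have h3 := congrArg Real.log h2
    rw [Real.log_rpow hη.1, Real.log_one, mul_eq_zero] at h3
    exact h3.elim hg0 (Real.log_ne_zero_of_pos_of_ne_one hη.1 hη.2.ne)
  have hη0 : 0 < |1 - η ^ g| := lt_of_le_of_ne (abs_nonneg _) hηg.symm
  -- For r < η the factor |1-r^g| is at least |1-η^g| > 0, so c₂ is at most c/|1-η^g|. This bound is
  -- lost as η → 1, which is why the cancellation is done before the limit.
  have hfin₂ : c₂ < ∞ := by
    have h : c₂ ≤ ENNReal.ofReal (|1 - η ^ g|⁻¹) * c := by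
      rw [hc₂, hc, ← kernelInt_const_mul _ _ ENNReal.ofReal_ne_top]
      apply kernelInt_mono
      intro r hr _
      rcases lt_or_ge r η with h | h
      · rw [cutoff_of_lt h, one_mul, one_mul, ← ENNReal.ofReal_mul (by positivity)]
        apply ENNReal.ofReal_le_ofReal
        rw [hpow]
        have h1 : |1 - η ^ g| ≤ |1 - r ^ g| := by
          rcases lt_or_gt_of_ne hg0 with hg' | hg'
          · have h2 := Real.rpow_lt_rpow_of_neg hr h hg'
            have h3 := Real.one_lt_rpow_of_pos_of_lt_one_of_neg hη.1 hη.2 hg'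
            rw [abs_of_neg (by linarith), abs_of_neg (by linarith)]
            linarith
          · have h2 := Real.rpow_lt_rpow hr.le h hg'
            have h3 := Real.rpow_lt_one hη.1.le hη.2 hg'
            rw [abs_of_pos (by linarith), abs_of_pos (by linarith)]
            linarith
        have h4 : 0 ≤ |1 - r ^ g| ^ (p - 1) * ((r ^ α + r ^ β) * r ^ (s * p - d)) := by positivity
        rw [inv_mul_eq_div, le_div_iff₀ hη0]
        nlinarith [mul_le_mul_of_nonneg_left h1 h4]
      · rw [cutoff_of_le h]; simp
    exact h.trans_lt (ENNReal.mul_lt_top ENNReal.ofReal_lt_top hfin)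
  rcases lt_or_gt_of_ne hg0 with hg' | hg'
  · refine Or.inr ⟨hg', ?_, hfin₂⟩
    rw [hc₁, hc₂, hc, ← kernelInt_add (by fun_prop)]
    apply kernelInt_congr
    intro r hr _
    rcases lt_or_ge r η with h | h
    · have h3 := Real.one_lt_rpow_of_pos_of_lt_one_of_neg hr (h.trans hη.2) hg'
      rw [cutoff_of_lt h, one_mul, one_mul, one_mul, ← ENNReal.ofReal_add (by positivity)
        (by positivity), hpow, profile_identity hr hg]
      congr 1
      nth_rewrite 3 [abs_of_neg (by linarith)]
      ring
    · rw [cutoff_of_le h]; simp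
  · have heq : c₂ = c₁ + c := by
      rw [hc₁, hc₂, hc, ← kernelInt_add (by fun_prop)]
      apply kernelInt_congr
      intro r hr _
      rcases lt_or_ge r η with h | h
      · have h3 := Real.rpow_lt_one hr.le (h.trans hη.2) hg'
        rw [cutoff_of_lt h, one_mul, one_mul, one_mul, ← ENNReal.ofReal_add (by positivity)
          (by positivity), hpow, profile_identity hr hg]
        congr 1
        nth_rewrite 3 [abs_of_pos (by linarith)]
        ring
      · rw [cutoff_of_le h]; simp
    exact Or.inl ⟨hg', heq, lt_of_le_of_lt (heq ▸ le_self_add) hfin₂⟩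

end CoreInequality

/-! ### Integration of the pointwise inequality and passage to the limit -/

section Main

variable {d : ℕ} {s p α β g : ℝ}

@[fun_prop]
lemma measurable_frenchPow (k : ℝ) : Measurable fun a => frenchPow a k := by
  have : Measurable Real.sign := by
    unfold Real.sign
    exact Measurable.ite measurableSet_Iio measurable_const
      (Measurable.ite measurableSet_Ioi measurable_const measurable_const)
  unfold frenchPow
  fun_prop

/-- The squared increment of the half power, times the pair weight. -/
noncomputable def remainderCore (s p α β : ℝ) (v : EuclideanSpace ℝ (Fin d) → ℝ)
    (z : EuclideanSpace ℝ (Fin d) × EuclideanSpace ℝ (Fin d)) : ℝ :=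
  (frenchPow (v z.1) (p / 2) - frenchPow (v z.2) (p / 2)) ^ 2 * pairWeight s p α β z.1 z.2

lemma measurable_groundState : Measurable (groundState (d := d) s p α β) := by
  unfold groundState; fun_prop

lemma measurable_transform {u : EuclideanSpace ℝ (Fin d) → ℝ} (hu : Measurable u) :
    Measurable (transform s p α β u) := by
  unfold transform; fun_prop

lemma measurable_remainderCore {v : EuclideanSpace ℝ (Fin d) → ℝ} (hv : Measurable v) :
    Measurable (remainderCore s p α β v) := by
  have := measurable_groundState (d := d) (s := s) (p := p) (α := α) (β := β)
  unfold remainderCore pairWeight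
  fun_prop

lemma pairWeight_nonneg (x y : EuclideanSpace ℝ (Fin d)) : 0 ≤ pairWeight s p α β x y := by
  have h : ∀ x : EuclideanSpace ℝ (Fin d), 0 ≤ groundState s p α β x := fun x => by
    unfold groundState; positivity
  exact mul_nonneg (le_min (h _) (h _)) (Real.rpow_nonneg (le_max_of_le_left (h _)) _)

lemma remainderCore_nonneg (v : EuclideanSpace ℝ (Fin d) → ℝ)
    (z : EuclideanSpace ℝ (Fin d) × EuclideanSpace ℝ (Fin d)) : 0 ≤ remainderCore s p α β v z :=
  mul_nonneg (sq_nonneg _) (pairWeight_nonneg _ _)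

lemma remainderCore_swap (v : EuclideanSpace ℝ (Fin d) → ℝ)
    (z : EuclideanSpace ℝ (Fin d) × EuclideanSpace ℝ (Fin d)) :
    remainderCore s p α β v z.swap = remainderCore s p α β v z := by
  simp only [remainderCore, pairWeight, Prod.fst_swap, Prod.snd_swap]
  rw [min_comm, max_comm]; ring

lemma remainderIntegrand_eq (v : EuclideanSpace ℝ (Fin d) → ℝ)
    (z : EuclideanSpace ℝ (Fin d) × EuclideanSpace ℝ (Fin d)) :
    remainderIntegrand s p α β v z.1 z.2 =
      remainderCore s p α β v z * weight ((d : ℝ) + s * p) α β z := by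
  rw [remainderIntegrand, remainderCore, weight, Real.rpow_neg (norm_nonneg (z.1 - z.2))]
  ring

lemma gagliardoIntegrand_eq {F : Type*} [NormedAddCommGroup F] (u : EuclideanSpace ℝ (Fin d) → F)
    (z : EuclideanSpace ℝ (Fin d) × EuclideanSpace ℝ (Fin d)) :
    gagliardoIntegrand s p α β u z.1 z.2 =
      ‖u z.1 - u z.2‖ ^ p * weight ((d : ℝ) + s * p) α β z := by
  rw [gagliardoIntegrand, weight, Real.rpow_neg (norm_nonneg (z.1 - z.2))]
  ring

/-- The ground state inequality at a pair of points whose ground states are ordered. -/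
lemma groundState_pointwise (hp : p ∈ Ioo (1 : ℝ) 2) (hg : g * p = (d : ℝ) - α - β - s * p)
    {C : ℝ} (hC : C ≤ p - 1) {u : EuclideanSpace ℝ (Fin d) → ℝ}
    (hab : ∀ x y, 0 ≤ u x * u y ∨ C ≤ remainderConst p)
    {x y : EuclideanSpace ℝ (Fin d)} (hx : x ≠ 0) (hy : y ≠ 0) (hxy : ‖x‖ ^ (-g) < ‖y‖ ^ (-g)) :
    |‖x‖ ^ (-g) - ‖y‖ ^ (-g)| ^ (p - 1) * (‖y‖ ^ (-g) * |u y * ‖y‖ ^ g| ^ p) +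
        C * remainderCore s p α β (transform s p α β u) (x, y) ≤
      ‖u x - u y‖ ^ p +
        |‖x‖ ^ (-g) - ‖y‖ ^ (-g)| ^ (p - 1) * (‖x‖ ^ (-g) * |u x * ‖x‖ ^ g| ^ p) := by
  have hp0 : 0 < p := by linarith [hp.1]
  have hx0 : 0 < ‖x‖ := norm_pos_iff.2 hx
  have hy0 : 0 < ‖y‖ := norm_pos_iff.2 hy
  have hx1 : ‖x‖ ^ g * ‖x‖ ^ (-g) = 1 := by rw [← Real.rpow_add hx0]; simp
  have hy1 : ‖y‖ ^ g * ‖y‖ ^ (-g) = 1 := by rw [← Real.rpow_add hy0]; simp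
  have h := pointwise_weights hp (Real.rpow_pos_of_pos hx0 (-g)) hxy (a := u y * ‖y‖ ^ g)
    (b := u x * ‖x‖ ^ g) hC (by
      refine (hab y x).imp_left fun h => ?_
      have : 0 < ‖y‖ ^ g * ‖x‖ ^ g := by positivity
      nlinarith)
  have e1 : ‖y‖ ^ (-g) * (u y * ‖y‖ ^ g) = u y := by linear_combination u y * hy1
  have e2 : ‖x‖ ^ (-g) * (u x * ‖x‖ ^ g) = u x := by linear_combination u x * hx1
  rw [e1, e2] at h
  rw [abs_sub_comm, abs_of_pos (sub_pos.2 hxy), Real.norm_eq_abs, abs_sub_comm]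
  simp only [remainderCore, pairWeight, groundState_eq hg hp0, transform_eq hg hp0]
  rw [min_eq_left hxy.le, max_eq_right hxy.le]
  refine le_trans (le_of_eq ?_) h
  ring

/-- All terms are kept positive and placed on the side where they add, because subtraction of lower
integrals is unavailable before finiteness is known. -/
lemma lintegral_cutoff_mono {E : Type*} [NormedAddCommGroup E] [InnerProductSpace ℝ E]
    [FiniteDimensional ℝ E] [MeasurableSpace E] [BorelSpace E] [Nontrivial E] {η C : ℝ}
    (hη : η ∈ Ioo (0 : ℝ) 1) (hC0 : 0 ≤ C) {B R S T : E × E → ℝ} {k : E × E → ℝ≥0∞}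
    (hB : Measurable B) (hR : Measurable R) (hS : Measurable S)
    (hk : Measurable k) (hB0 : ∀ z, 0 ≤ B z) (hR0 : ∀ z, 0 ≤ R z) (hS0 : ∀ z, 0 ≤ S z)
    (hT0 : ∀ z, 0 ≤ T z)
    (hle : ∀ z : E × E, z.1 ≠ 0 → z.2 ≠ 0 → ‖z.2‖ < ‖z.1‖ → B z + C * R z ≤ S z + T z) :
    (∫⁻ z, cutoff η (‖z.2‖ / ‖z.1‖) * (ENNReal.ofReal (B z) * k z)) +
        ENNReal.ofReal C * ∫⁻ z, cutoff η (‖z.2‖ / ‖z.1‖) * (ENNReal.ofReal (R z) * k z) ≤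
      (∫⁻ z, cutoff η (‖z.2‖ / ‖z.1‖) * (ENNReal.ofReal (S z) * k z)) +
        ∫⁻ z, cutoff η (‖z.2‖ / ‖z.1‖) * (ENNReal.ofReal (T z) * k z) := by
  rw [← lintegral_const_mul _ (by fun_prop), ← lintegral_add_left (by fun_prop),
    ← lintegral_add_left (by fun_prop)]
  apply lintegral_mono_ae
  filter_upwards [ae_prod_ne_zero] with z hz
  rcases lt_or_ge (‖z.2‖ / ‖z.1‖) η with h | h
  · rw [cutoff_of_lt h, one_mul, one_mul, one_mul, one_mul, ← mul_assoc, ← add_mul, ← add_mul,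
      ← ENNReal.ofReal_mul hC0, ← ENNReal.ofReal_add (hB0 z) (mul_nonneg hC0 (hR0 z)),
      ← ENNReal.ofReal_add (hS0 z) (hT0 z)]
    exact mul_le_mul_left (ENNReal.ofReal_le_ofReal
      (hle z hz.1 hz.2 ((div_lt_one (norm_pos_iff.2 hz.1)).1 (h.trans hη.2)))) _
  · rw [cutoff_of_le h]; simp

lemma measurable_groundTerm {E : Type*} [NormedAddCommGroup E] [MeasurableSpace E]
    [OpensMeasurableSpace E] {u : E → ℝ} (hu : Measurable u) (g p : ℝ) :
    Measurable fun z : E × E =>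
      |‖z.1‖ ^ (-g) - ‖z.2‖ ^ (-g)| ^ (p - 1) * (‖z.1‖ ^ (-g) * |u z.1 * ‖z.1‖ ^ g| ^ p) := by
  have h1 : Measurable fun z : E × E => ‖z.1‖ ^ (-g) := by fun_prop
  have h2 : Measurable fun z : E × E => ‖z.2‖ ^ (-g) := by fun_prop
  have h3 : Measurable fun z : E × E => u z.1 * ‖z.1‖ ^ g := by fun_prop
  exact ((h1.sub h2).norm.pow_const _).mul (h1.mul (h3.norm.pow_const _))

lemma measurable_groundTerm_snd {E : Type*} [NormedAddCommGroup E] [MeasurableSpace E]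
    [OpensMeasurableSpace E] {u : E → ℝ} (hu : Measurable u) (g p : ℝ) :
    Measurable fun z : E × E =>
      |‖z.1‖ ^ (-g) - ‖z.2‖ ^ (-g)| ^ (p - 1) * (‖z.2‖ ^ (-g) * |u z.2 * ‖z.2‖ ^ g| ^ p) := by
  have h1 : Measurable fun z : E × E => ‖z.1‖ ^ (-g) := by fun_prop
  have h2 : Measurable fun z : E × E => ‖z.2‖ ^ (-g) := by fun_prop
  have h3 : Measurable fun z : E × E => u z.2 * ‖z.2‖ ^ g := by fun_prop
  exact ((h1.sub h2).norm.pow_const _).mul (h2.mul (h3.norm.pow_const _))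

/-- The ground state inequality, away from the diagonal `‖x‖ = ‖y‖`. -/
lemma truncated_hardy [Nontrivial (EuclideanSpace ℝ (Fin d))] (hp : p ∈ Ioo (1 : ℝ) 2)
    (hg0 : g ≠ 0) (hg : g * p = (d : ℝ) - α - β - s * p)
    {C : ℝ} (hC0 : 0 ≤ C) (hC : C ≤ p - 1) {u : EuclideanSpace ℝ (Fin d) → ℝ} (hu : Measurable u)
    (hab : ∀ x y, 0 ≤ u x * u y ∨ C ≤ remainderConst p)
    (hH : ∫⁻ x, ENNReal.ofReal (hardyIntegrand s p α β u x) < ∞)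
    {e : EuclideanSpace ℝ (Fin d)} (he : ‖e‖ = 1) {η : ℝ} (hη : η ∈ Ioo (0 : ℝ) 1)
    (hfin : (kernelInt e ((d : ℝ) + s * p) fun r => cutoff η r *
      ENNReal.ofReal (|1 - r ^ g| ^ p * ((r ^ α + r ^ β) * r ^ (s * p - d)))) < ∞) :
    (∫⁻ x, ENNReal.ofReal (hardyIntegrand s p α β u x)) *
      (kernelInt e ((d : ℝ) + s * p) fun r => cutoff η r *
        ENNReal.ofReal (|1 - r ^ g| ^ p * ((r ^ α + r ^ β) * r ^ (s * p - d)))) +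
      ENNReal.ofReal C * ∫⁻ z, cutoff η (‖z.2‖ / ‖z.1‖) *
        (ENNReal.ofReal (remainderCore s p α β (transform s p α β u) z) *
          ENNReal.ofReal (weight ((d : ℝ) + s * p) α β z + weight ((d : ℝ) + s * p) β α z)) ≤
    ∫⁻ z, cutoff η (‖z.2‖ / ‖z.1‖) * (ENNReal.ofReal (‖u z.1 - u z.2‖ ^ p) *
      ENNReal.ofReal (weight ((d : ℝ) + s * p) α β z + weight ((d : ℝ) + s * p) β α z)) := by
  have hT₁ := lintegral_groundState_term (s := s) (p := p) (α := α) (β := β) (g := g) hu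
    (measurable_cutoff η) he
  have hT₂ := lintegral_groundState_term_snd (s := s) (p := p) (α := α) (β := β) (g := g) hu
    (measurable_cutoff η) he
  set H := ∫⁻ x, ENNReal.ofReal (hardyIntegrand s p α β u x)
  have hRm := measurable_remainderCore (s := s) (p := p) (α := α) (β := β)
    (measurable_transform (s := s) (p := p) (α := α) (β := β) hu)
  set R := remainderCore s p α β (transform s p α β u)
  set k : EuclideanSpace ℝ (Fin d) × EuclideanSpace ℝ (Fin d) → ℝ≥0∞ := fun z =>
    ENNReal.ofReal (weight ((d : ℝ) + s * p) α β z + weight ((d : ℝ) + s * p) β α z)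
  have hk : Measurable k := by fun_prop
  set A₁ : EuclideanSpace ℝ (Fin d) × EuclideanSpace ℝ (Fin d) → ℝ := fun z =>
    |‖z.1‖ ^ (-g) - ‖z.2‖ ^ (-g)| ^ (p - 1) * (‖z.1‖ ^ (-g) * |u z.1 * ‖z.1‖ ^ g| ^ p)
  set A₂ : EuclideanSpace ℝ (Fin d) × EuclideanSpace ℝ (Fin d) → ℝ := fun z =>
    |‖z.1‖ ^ (-g) - ‖z.2‖ ^ (-g)| ^ (p - 1) * (‖z.2‖ ^ (-g) * |u z.2 * ‖z.2‖ ^ g| ^ p)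
  have hA₁ : Measurable A₁ := measurable_groundTerm hu g p
  have hA₂ : Measurable A₂ := measurable_groundTerm_snd hu g p
  have hA₁0 : ∀ z, 0 ≤ A₁ z := fun z => mul_nonneg (Real.rpow_nonneg (abs_nonneg _) _)
    (mul_nonneg (Real.rpow_nonneg (norm_nonneg _) _) (Real.rpow_nonneg (abs_nonneg _) _))
  have hA₂0 : ∀ z, 0 ≤ A₂ z := fun z => mul_nonneg (Real.rpow_nonneg (abs_nonneg _) _)
    (mul_nonneg (Real.rpow_nonneg (norm_nonneg _) _) (Real.rpow_nonneg (abs_nonneg _) _))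
  have hR0 : ∀ z, 0 ≤ R z := remainderCore_nonneg _
  have key : ∀ B B' : EuclideanSpace ℝ (Fin d) × EuclideanSpace ℝ (Fin d) → ℝ, Measurable B →
      (∀ z, 0 ≤ B z) → (∀ z, 0 ≤ B' z) →
      (∀ z : EuclideanSpace ℝ (Fin d) × EuclideanSpace ℝ (Fin d), z.1 ≠ 0 → z.2 ≠ 0 →
        ‖z.2‖ < ‖z.1‖ → B z + C * R z ≤ ‖u z.1 - u z.2‖ ^ p + B' z) →
      (∫⁻ z, cutoff η (‖z.2‖ / ‖z.1‖) * (ENNReal.ofReal (B z) * k z)) +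
        ENNReal.ofReal C * ∫⁻ z, cutoff η (‖z.2‖ / ‖z.1‖) * (ENNReal.ofReal (R z) * k z) ≤
      (∫⁻ z, cutoff η (‖z.2‖ / ‖z.1‖) * (ENNReal.ofReal (‖u z.1 - u z.2‖ ^ p) * k z)) +
        ∫⁻ z, cutoff η (‖z.2‖ / ‖z.1‖) * (ENNReal.ofReal (B' z) * k z) :=
    fun B B' hB hB0 hB'0 hle => lintegral_cutoff_mono hη hC0 hB hRm (by fun_prop) hk hB0
      hR0 (fun z => by positivity) hB'0 hle
  have hcancel : ∀ {c c' cc e' R' : ℝ≥0∞}, c' = c + cc → c < ∞ → H * c' + R' ≤ e' + H * c →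
      H * cc + R' ≤ e' := by
    intro c c' cc e' R' h1 h2 h3
    have h4 : H * c ≠ ∞ := (ENNReal.mul_lt_top hH h2).ne
    rw [h1, mul_add, add_assoc, add_comm e'] at h3
    exact (ENNReal.add_le_add_iff_left h4).1 h3
  -- If g > 0, the inner point z.2 carries the larger ground state; if g < 0, the outer point z.1
  -- does. The term of that point stands on the smaller side of the inequality and has the larger
  -- constant.
  rcases truncated_constants hp.1 hg0 hg hη rfl rfl rfl hfin with ⟨hg', h1, h2⟩ | ⟨hg', h1, h2⟩
  · have := key A₂ A₁ hA₂ hA₂0 hA₁0 fun z hz1 hz2 hlt =>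
      groundState_pointwise hp hg hC hab hz1 hz2
        (Real.rpow_lt_rpow_of_neg (norm_pos_iff.2 hz2) hlt (by linarith))
    rw [hT₁, hT₂] at this
    exact hcancel h1 h2 this
  · have := key A₁ A₂ hA₁ hA₁0 hA₂0 fun z hz1 hz2 hlt => by
      have h := groundState_pointwise hp hg hC hab hz2 hz1
        (Real.rpow_lt_rpow (norm_nonneg _) hlt (by linarith))
      have hs : remainderCore s p α β (transform s p α β u) (z.2, z.1) = R z :=
        remainderCore_swap _ z
      rw [hs, abs_sub_comm, norm_sub_rev] at h
      exact h
    rw [hT₁, hT₂] at this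
    exact hcancel h1 h2 this

/-- The sharp weighted Hardy inequality with remainder, in terms of lower integrals. -/
theorem hardy_lintegral (hd : 1 ≤ d) (hs : s ∈ Ioo (0 : ℝ) 1) (hp : p ∈ Ioo (1 : ℝ) 2)
    (hα : α ∈ Ioo (-(s * p)) (d : ℝ)) (hβ : β ∈ Ioo (-(s * p)) (d : ℝ))
    (hne : s * p + α + β ≠ d) {C : ℝ} (hC0 : 0 ≤ C) (hC : C ≤ p - 1)
    {u : EuclideanSpace ℝ (Fin d) → ℝ} (hu : Measurable u)
    (hab : ∀ x y, 0 ≤ u x * u y ∨ C ≤ remainderConst p)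
    (hH : ∫⁻ x, ENNReal.ofReal (hardyIntegrand s p α β u x) < ∞) :
    (∫⁻ x, ENNReal.ofReal (hardyIntegrand s p α β u x)) * ENNReal.ofReal (hardyConst d s p α β) +
      ENNReal.ofReal C * ∫⁻ z : EuclideanSpace ℝ (Fin d) × EuclideanSpace ℝ (Fin d),
        ENNReal.ofReal (remainderIntegrand s p α β (transform s p α β u) z.1 z.2) ≤
    ∫⁻ z : EuclideanSpace ℝ (Fin d) × EuclideanSpace ℝ (Fin d),
      ENNReal.ofReal (gagliardoIntegrand s p α β u z.1 z.2) := by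
  have : Nonempty (Fin d) := ⟨⟨0, hd⟩⟩
  have hp0 : 0 < p := by linarith [hp.1]
  set g := ((d : ℝ) - α - β - s * p) / p with hgdef
  have hg : g * p = (d : ℝ) - α - β - s * p := by rw [hgdef]; field_simp
  have hg0 : g ≠ 0 := by
    intro h
    rw [h, zero_mul] at hg
    exact hne (by linarith)
  have he : ‖EuclideanSpace.single (⟨0, hd⟩ : Fin d) (1 : ℝ)‖ = 1 := by simp
  set e := EuclideanSpace.single (⟨0, hd⟩ : Fin d) (1 : ℝ)
  have hRm := measurable_remainderCore (s := s) (p := p) (α := α) (β := β)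
    (measurable_transform (s := s) (p := p) (α := α) (β := β) hu)
  have hcut : ∀ f : ℝ → ℝ≥0∞, (Iio (1 : ℝ)).indicator f = fun r => cutoff 1 r * f r := by
    intro f
    ext r
    rcases lt_or_ge r 1 with h | h
    · rw [cutoff_of_lt h, one_mul, indicator_of_mem (show r ∈ Iio (1 : ℝ) from h)]
    · rw [cutoff_of_le h, zero_mul, indicator_of_notMem (show r ∉ Iio (1 : ℝ) from not_lt.2 h)]
  have hconst := ofReal_hardyConst hd hs hp hα hβ he hg
  rw [kernelInt_fold_profile he hg, hcut] at hconst
  simp_rw [remainderIntegrand_eq, gagliardoIntegrand_eq,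
    ENNReal.ofReal_mul (remainderCore_nonneg _ _),
    fun z : EuclideanSpace ℝ (Fin d) × EuclideanSpace ℝ (Fin d) =>
      ENNReal.ofReal_mul (q := weight ((d : ℝ) + s * p) α β z)
        (Real.rpow_nonneg (norm_nonneg (u z.1 - u z.2)) p)]
  rw [lintegral_symmetrize (by fun_prop) (fun z => by rw [remainderCore_swap]),
    lintegral_symmetrize (by fun_prop) (fun z => by
      rw [Prod.fst_swap, Prod.snd_swap, norm_sub_rev]), hconst]
  have hk : ∀ (η : ℝ) (f : ℝ → ℝ≥0∞), kernelInt e ((d : ℝ) + s * p) (fun r => cutoff η r * f r) =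
      ∫⁻ z, cutoff η ‖z‖ * (f ‖z‖ * ENNReal.ofReal (‖e - z‖ ^ (-((d : ℝ) + s * p)))) := by
    intro η f
    simp only [kernelInt, mul_assoc]
  have hlim1 := tendsto_lintegral_cutoff (volume : Measure (EuclideanSpace ℝ (Fin d)))
    (t := fun z => ‖z‖) (by fun_prop) (f := fun z => ENNReal.ofReal (|1 - ‖z‖ ^ g| ^ p *
      ((‖z‖ ^ α + ‖z‖ ^ β) * ‖z‖ ^ (s * p - d))) *
        ENNReal.ofReal (‖e - z‖ ^ (-((d : ℝ) + s * p)))) (by fun_prop)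
  have hlim2 := tendsto_lintegral_cutoff
    (volume : Measure (EuclideanSpace ℝ (Fin d) × EuclideanSpace ℝ (Fin d)))
    (t := fun z => ‖z.2‖ / ‖z.1‖) (by fun_prop)
    (f := fun z => ENNReal.ofReal (remainderCore s p α β (transform s p α β u) z) *
      ENNReal.ofReal (weight ((d : ℝ) + s * p) α β z + weight ((d : ℝ) + s * p) β α z))
      (by fun_prop)
  have hlim := (ENNReal.Tendsto.const_mul hlim1 (Or.inr hH.ne)).add
    (ENNReal.Tendsto.const_mul hlim2 (Or.inr (ENNReal.ofReal_ne_top (r := C))))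
  rw [hk]
  -- Only the left side is passed to the limit; the truncated energy is already bounded by the full
  -- one.
  refine le_of_tendsto' hlim fun n => ?_
  have hn : 1 / ((n : ℝ) + 2) < 1 := by
    rw [div_lt_one (by positivity)]; linarith [(Nat.cast_nonneg n : (0 : ℝ) ≤ n)]
  have hn0 : 0 < 1 / ((n : ℝ) + 2) := by positivity
  have hη : 1 - 1 / ((n : ℝ) + 2) ∈ Ioo (0 : ℝ) 1 := ⟨by linarith, by linarith⟩
  rw [← hk _ (fun r => ENNReal.ofReal (|1 - r ^ g| ^ p * ((r ^ α + r ^ β) * r ^ (s * p - d))))]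
  refine (truncated_hardy hp hg0 hg hC0 hC hu hab hH he hη ?_).trans ?_
  · refine lt_of_le_of_lt (kernelInt_mono fun r _ _ => ?_)
      (hconst ▸ ENNReal.ofReal_lt_top (r := hardyConst d s p α β))
    exact mul_le_mul_left (cutoff_mono hη.2.le r) _
  · refine lintegral_mono fun z => ?_
    exact mul_le_mul_left (cutoff_mono hη.2.le _) _

end Main

/-! ### Finiteness of the energy and of the Hardy integral -/

section Finiteness

/-- A bounded Lipschitz function supported in a ball is Lipschitz for the scale-invariant
quantity `‖x - y‖ / max ‖x‖ ‖y‖`. -/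
lemma exists_norm_sub_le_ratio {E F : Type*} [NormedAddCommGroup E] [NormedAddCommGroup F]
    {u : E → F} {L M R : ℝ} (hL : ∀ x y, ‖u x - u y‖ ≤ L * ‖x - y‖) (hL0 : 0 ≤ L)
    (hM : ∀ x, ‖u x‖ ≤ M) (hR : ∀ x, R < ‖x‖ → u x = 0) (hR0 : 0 < R) :
    ∃ K, 0 ≤ K ∧ ∀ x y, x ≠ 0 → ‖u x - u y‖ ≤ K * (‖x - y‖ / max ‖x‖ ‖y‖) := by
  have hM0 : 0 ≤ M := (norm_nonneg _).trans (hM 0)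
  refine ⟨2 * R * L + 2 * M, by positivity, fun x y hx => ?_⟩
  have hm : 0 < max ‖x‖ ‖y‖ := lt_max_of_lt_left (norm_pos_iff.2 hx)
  have hq : 0 ≤ ‖x - y‖ / max ‖x‖ ‖y‖ := by positivity
  -- The point of larger norm lies outside the support. Either the other does too, or its norm is at
  -- most R and the distance is at least half the larger norm.
  have far : ∀ a b : E, max ‖a‖ ‖b‖ > 2 * R → ‖a‖ ≤ ‖b‖ →
      ‖u a - u b‖ ≤ 2 * M * (‖a - b‖ / max ‖a‖ ‖b‖) := by
    intro a b h1 h2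
    rw [max_eq_right h2] at h1 ⊢
    rw [hR b (by linarith), sub_zero]
    rcases lt_or_ge R ‖a‖ with h | h
    · rw [hR a h, norm_zero]; positivity
    · have hb : 0 < ‖b‖ := by linarith
      have h3 : ‖b‖ - ‖a‖ ≤ ‖a - b‖ := by rw [norm_sub_rev]; exact norm_sub_norm_le _ _
      have h4 : 1 / 2 ≤ ‖a - b‖ / ‖b‖ := by rw [div_le_div_iff₀ (by norm_num) hb]; linarith
      nlinarith [hM a]
  rcases le_or_gt (max ‖x‖ ‖y‖) (2 * R) with h | h
  · have h1 : ‖x - y‖ = ‖x - y‖ / max ‖x‖ ‖y‖ * max ‖x‖ ‖y‖ := by field_simp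
    have h2 : ‖x - y‖ ≤ ‖x - y‖ / max ‖x‖ ‖y‖ * (2 * R) := by
      nth_rewrite 1 [h1]; gcongr
    have := hL x y
    nlinarith [mul_le_mul_of_nonneg_left h2 hL0, mul_nonneg hM0 hq]
  · have h3 : ‖u x - u y‖ ≤ 2 * M * (‖x - y‖ / max ‖x‖ ‖y‖) := by
      rcases le_total ‖x‖ ‖y‖ with h' | h'
      · exact far x y h h'
      · have := far y x (by rwa [max_comm]) h'
        rwa [norm_sub_rev, norm_sub_rev y, max_comm] at this
    nlinarith [mul_nonneg (mul_nonneg hR0.le hL0) hq]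

variable {d : ℕ} {s p α β : ℝ}

/-- With r = |y|/|x| the integrand separates into powers of |x| and max(1,r)^(-p) r^(-β). The powers
of |x| collect to the Hardy weight on S, and `kernelInt_lt_top` handles r. -/
lemma lintegral_indicator_weight_lt_top [Nontrivial (EuclideanSpace ℝ (Fin d))]
    (hs : s ∈ Ioo (0 : ℝ) 1) (hp : p ∈ Ioo (1 : ℝ) 2)
    (hβ : β ∈ Ioo (-(s * p)) (d : ℝ)) {S : Set (EuclideanSpace ℝ (Fin d))} (hS : MeasurableSet S)
    (hfin : ∫⁻ x in S, ENNReal.ofReal (‖x‖ ^ (-(s * p + α + β))) < ∞)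
    {e : EuclideanSpace ℝ (Fin d)} (he : ‖e‖ = 1) :
    ∫⁻ z : EuclideanSpace ℝ (Fin d) × EuclideanSpace ℝ (Fin d), S.indicator 1 z.1 *
      ENNReal.ofReal (max ‖z.1‖ ‖z.2‖ ^ (-p) * weight ((d : ℝ) + s * p - p) α β z) < ∞ := by
  have hp0 : 0 < p := by linarith [hp.1]
  have hk := kernelInt_lt_top (σ := s * p) (b := β) he hp0.le (by nlinarith [hs.2])
    hβ.1 (by rw [finrank_euclideanSpace_fin]; exact hβ.2)
  rw [finrank_euclideanSpace_fin] at hk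
  have h1 := lintegral_prod_ratio (E := EuclideanSpace ℝ (Fin d))
    (G := fun x => S.indicator 1 x * ENNReal.ofReal (‖x‖ ^ (-α - β - p)))
    ((measurable_one.indicator hS).mul (by fun_prop))
    (f := fun r => ENNReal.ofReal ((max 1 r) ^ (-p) * r ^ (-β))) (by fun_prop) he
    ((d : ℝ) + s * p - p)
  refine lt_of_eq_of_lt ?_ (h1.trans_lt (ENNReal.mul_lt_top ?_ hk))
  · apply lintegral_congr_ae
    filter_upwards [ae_prod_ne_zero] with z hz
    have hz1 : 0 < ‖z.1‖ := norm_pos_iff.2 hz.1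
    have hz2 : 0 < ‖z.2‖ := norm_pos_iff.2 hz.2
    rw [mul_assoc, ← ENNReal.ofReal_mul (by positivity), ← ENNReal.ofReal_mul (by positivity)]
    congr 2
    have e1 : max 1 (‖z.2‖ / ‖z.1‖) = max ‖z.1‖ ‖z.2‖ / ‖z.1‖ := by
      rw [← max_div_div_right hz1.le, div_self hz1.ne']
    rw [e1, Real.div_rpow (le_max_of_le_left hz1.le) hz1.le, Real.div_rpow hz2.le hz1.le, weight,
      show -α - β - p = -α + -β + -p by ring, Real.rpow_add hz1, Real.rpow_add hz1]
    have h3 := (Real.rpow_pos_of_pos hz1 (-β)).ne'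
    have h4 := (Real.rpow_pos_of_pos hz1 (-p)).ne'
    field_simp
  · refine lt_of_eq_of_lt ?_ hfin
    rw [← lintegral_indicator hS]
    apply lintegral_congr_ae
    have h1 : ∀ᵐ x : EuclideanSpace ℝ (Fin d), x ≠ 0 :=
      measure_eq_zero_iff_ae_notMem.1 (measure_singleton _)
    filter_upwards [h1] with x hx
    by_cases hxS : x ∈ S
    · rw [indicator_of_mem hxS, indicator_of_mem hxS, Pi.one_apply, one_mul,
        ← ENNReal.ofReal_mul (by positivity), ← Real.rpow_add (norm_pos_iff.2 hx),
        finrank_euclideanSpace_fin]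
      congr 2; ring
    · simp [hxS]

/-- The scale-invariant Lipschitz bound trades p powers of |x-y| for max(|x|,|y|)^(-p). The
integrand vanishes unless x or y is in S, and the case y ∈ S is the case x ∈ S with α and β
exchanged. -/
lemma lintegral_gagliardo_lt_top {F : Type*} [NormedAddCommGroup F]
    [Nontrivial (EuclideanSpace ℝ (Fin d))] (hs : s ∈ Ioo (0 : ℝ) 1) (hp : p ∈ Ioo (1 : ℝ) 2)
    (hα : α ∈ Ioo (-(s * p)) (d : ℝ)) (hβ : β ∈ Ioo (-(s * p)) (d : ℝ))
    {u : EuclideanSpace ℝ (Fin d) → F} {S : Set (EuclideanSpace ℝ (Fin d))}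
    (hS : MeasurableSet S) (huS : ∀ x, x ∉ S → u x = 0) {K : ℝ} (hK : 0 ≤ K)
    (hu : ∀ x y, x ≠ 0 → ‖u x - u y‖ ≤ K * (‖x - y‖ / max ‖x‖ ‖y‖))
    (hfin : ∫⁻ x in S, ENNReal.ofReal (‖x‖ ^ (-(s * p + α + β))) < ∞)
    {e : EuclideanSpace ℝ (Fin d)} (he : ‖e‖ = 1) :
    ∫⁻ z : EuclideanSpace ℝ (Fin d) × EuclideanSpace ℝ (Fin d),
      ENNReal.ofReal (gagliardoIntegrand s p α β u z.1 z.2) < ∞ := by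
  have hp0 : 0 < p := by linarith [hp.1]
  have h1 := lintegral_indicator_weight_lt_top hs hp hβ hS hfin he
  have h2 := lintegral_indicator_weight_lt_top (α := β) (β := α) hs hp hα hS
    (by simpa only [add_right_comm] using hfin) he
  rw [Measure.volume_eq_prod, ← lintegral_prod_swap, ← Measure.volume_eq_prod] at h2
  have hSm : Measurable (S.indicator (1 : EuclideanSpace ℝ (Fin d) → ℝ≥0∞)) :=
    measurable_one.indicator hS
  have h3 := ENNReal.mul_lt_top (ENNReal.ofReal_lt_top (r := K ^ p))
    (ENNReal.add_lt_top.2 ⟨h1, h2⟩)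
  rw [← lintegral_add_left (by fun_prop), ← lintegral_const_mul _ (by fun_prop)] at h3
  refine lt_of_le_of_lt (lintegral_mono_ae ?_) h3
  filter_upwards [ae_prod_ne_zero] with z hz
  have hm : 0 < max ‖z.1‖ ‖z.2‖ := lt_max_of_lt_left (norm_pos_iff.2 hz.1)
  rw [gagliardoIntegrand_eq, weight_swap, Prod.fst_swap, Prod.snd_swap, max_comm ‖z.2‖, ← add_mul]
  by_cases hzS : z.1 ∉ S ∧ z.2 ∉ S
  · rw [huS _ hzS.1, huS _ hzS.2, sub_zero, norm_zero, Real.zero_rpow hp0.ne', zero_mul,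
      ENNReal.ofReal_zero]
    exact zero_le
  have h5 : (1 : ℝ≥0∞) ≤ S.indicator 1 z.1 + S.indicator 1 z.2 := by
    rcases not_and_or.1 hzS with h | h
    · rw [indicator_of_mem (not_not.1 h)]; exact le_self_add
    · rw [indicator_of_mem (not_not.1 h) (f := 1)]; exact le_add_self
  refine le_trans ?_ (mul_le_mul_right (mul_le_mul_left h5 _) _)
  rw [one_mul, ← ENNReal.ofReal_mul (by positivity)]
  apply ENNReal.ofReal_le_ofReal
  rcases eq_or_ne z.1 z.2 with h | h
  · rw [h, sub_self, norm_zero, Real.zero_rpow hp0.ne', zero_mul]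
    have := weight_nonneg ((d : ℝ) + s * p - p) α β z
    positivity
  have hxy : 0 < ‖z.1 - z.2‖ := norm_pos_iff.2 (sub_ne_zero.2 h)
  have h6 := Real.rpow_le_rpow (norm_nonneg _) (hu z.1 z.2 hz.1) hp0.le
  refine (mul_le_mul_of_nonneg_right h6 (weight_nonneg _ _ _ _)).trans (le_of_eq ?_)
  rw [Real.mul_rpow hK (by positivity), Real.div_rpow hxy.le hm.le, weight, weight,
    show -((d : ℝ) + s * p - p) = -((d : ℝ) + s * p) + p by ring, Real.rpow_add hxy,
    Real.rpow_neg hm.le]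
  field_simp

lemma lintegral_hardy_lt_top {F : Type*} [NormedAddCommGroup F] (hp : 0 < p)
    {u : EuclideanSpace ℝ (Fin d) → F} {S : Set (EuclideanSpace ℝ (Fin d))}
    (hS : MeasurableSet S) (huS : ∀ x, x ∉ S → u x = 0) {M : ℝ} (hM : ∀ x, ‖u x‖ ≤ M)
    (hfin : ∫⁻ x in S, ENNReal.ofReal (‖x‖ ^ (-(s * p + α + β))) < ∞) :
    ∫⁻ x, ENNReal.ofReal (hardyIntegrand s p α β u x) < ∞ := by
  have hM0 : 0 ≤ M := (norm_nonneg _).trans (hM 0)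
  have h3 := ENNReal.mul_lt_top (ENNReal.ofReal_lt_top (r := M ^ p)) hfin
  rw [← lintegral_indicator hS, ← lintegral_const_mul _ (Measurable.indicator (by fun_prop) hS)]
    at h3
  refine lt_of_le_of_lt (lintegral_mono fun x => ?_) h3
  by_cases hx : x ∈ S
  · rw [indicator_of_mem hx, ← ENNReal.ofReal_mul (by positivity), hardyIntegrand,
      Real.rpow_neg (norm_nonneg _), div_eq_mul_inv]
    gcongr
    exact hM x
  · rw [hardyIntegrand, huS x hx, norm_zero, Real.zero_rpow hp.ne']
    simp

/-- On a compact subset of `Ω` the Hardy weight is integrable. -/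
lemma setLIntegral_hardyWeight_lt_top [Nontrivial (EuclideanSpace ℝ (Fin d))] {b : ℝ}
    {Ω S : Set (EuclideanSpace ℝ (Fin d))}
    (hΩ : (b < d ∧ Ω = univ) ∨ ((d : ℝ) < b ∧ Ω = {0}ᶜ)) (hS : IsCompact S) (hSΩ : S ⊆ Ω) :
    ∫⁻ x in S, ENNReal.ofReal (‖x‖ ^ (-b)) < ∞ := by
  rcases hΩ with ⟨hb, -⟩ | ⟨-, rfl⟩
  · obtain ⟨R, hR⟩ := hS.isBounded.subset_ball 0
    exact (lintegral_mono_set hR).trans_lt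
      (lintegral_ball_rpow_lt_top (by rwa [finrank_euclideanSpace_fin]) R)
  · have hc : ContinuousOn (fun x : EuclideanSpace ℝ (Fin d) => ‖x‖ ^ (-b)) S := fun x hx =>
      (continuous_norm.continuousAt.rpow_const
        (Or.inl (norm_ne_zero_iff.2 (hSΩ hx)))).continuousWithinAt
    exact (hc.integrableOn_compact hS).lintegral_lt_top

end Finiteness

/-! ### From lower integrals to real integrals -/

section Consequences

lemma integrable_of_lintegral_ofReal {X : Type*} [MeasurableSpace X] {μ : Measure X} {f : X → ℝ}
    (hf : Measurable f) (h0 : ∀ x, 0 ≤ f x) (h : ∫⁻ x, ENNReal.ofReal (f x) ∂μ < ∞) :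
    Integrable f μ :=
  ⟨hf.aestronglyMeasurable, (hasFiniteIntegral_iff_ofReal (.of_forall h0)).2 h⟩

variable {d : ℕ} {s p α β : ℝ}

lemma gagliardoIntegrand_nonneg {F : Type*} [NormedAddCommGroup F]
    (u : EuclideanSpace ℝ (Fin d) → F) (x y : EuclideanSpace ℝ (Fin d)) :
    0 ≤ gagliardoIntegrand s p α β u x y := by
  unfold gagliardoIntegrand; positivity

lemma hardyIntegrand_nonneg {F : Type*} [NormedAddCommGroup F]
    (u : EuclideanSpace ℝ (Fin d) → F) (x : EuclideanSpace ℝ (Fin d)) :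
    0 ≤ hardyIntegrand s p α β u x := by
  unfold hardyIntegrand; positivity

lemma remainderIntegrand_nonneg (v : EuclideanSpace ℝ (Fin d) → ℝ)
    (z : EuclideanSpace ℝ (Fin d) × EuclideanSpace ℝ (Fin d)) :
    0 ≤ remainderIntegrand s p α β v z.1 z.2 := by
  rw [remainderIntegrand_eq]
  exact mul_nonneg (remainderCore_nonneg _ _) (weight_nonneg _ _ _ _)

lemma measurable_gagliardoIntegrand {F : Type*} [NormedAddCommGroup F]
    {u : EuclideanSpace ℝ (Fin d) → F} (hu : Continuous u) :
    Measurable fun z : EuclideanSpace ℝ (Fin d) × EuclideanSpace ℝ (Fin d) =>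
      gagliardoIntegrand s p α β u z.1 z.2 := by
  have h : Measurable fun z : EuclideanSpace ℝ (Fin d) × EuclideanSpace ℝ (Fin d) =>
      ‖u z.1 - u z.2‖ := (by fun_prop : Continuous _).measurable
  unfold gagliardoIntegrand
  fun_prop

lemma measurable_hardyIntegrand {F : Type*} [NormedAddCommGroup F]
    {u : EuclideanSpace ℝ (Fin d) → F} (hu : Continuous u) :
    Measurable (hardyIntegrand s p α β u) := by
  have h : Measurable fun x => ‖u x‖ := hu.norm.measurable
  unfold hardyIntegrand
  fun_prop

lemma measurable_remainderIntegrand {v : EuclideanSpace ℝ (Fin d) → ℝ} (hv : Measurable v) :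
    Measurable fun z : EuclideanSpace ℝ (Fin d) × EuclideanSpace ℝ (Fin d) =>
      remainderIntegrand s p α β v z.1 z.2 := by
  simp_rw [remainderIntegrand_eq]
  exact (measurable_remainderCore hv).mul (measurable_weight _ _ _)

lemma lintegral_lt_top_of_isCc1 {F : Type*} [NormedAddCommGroup F] [NormedSpace ℝ F]
    (hd : 1 ≤ d) (hs : s ∈ Ioo (0 : ℝ) 1) (hp : p ∈ Ioo (1 : ℝ) 2)
    (hα : α ∈ Ioo (-(s * p)) (d : ℝ)) (hβ : β ∈ Ioo (-(s * p)) (d : ℝ))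
    {Ω : Set (EuclideanSpace ℝ (Fin d))}
    (hΩ : (s * p + α + β < d ∧ Ω = univ) ∨ ((d : ℝ) < s * p + α + β ∧ Ω = {0}ᶜ))
    {u : EuclideanSpace ℝ (Fin d) → F} (hu : IsCc1 Ω u) :
    (∫⁻ z : EuclideanSpace ℝ (Fin d) × EuclideanSpace ℝ (Fin d),
      ENNReal.ofReal (gagliardoIntegrand s p α β u z.1 z.2) < ∞) ∧
    ∫⁻ x, ENNReal.ofReal (hardyIntegrand s p α β u x) < ∞ := by
  have : Nonempty (Fin d) := ⟨⟨0, hd⟩⟩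
  have he : ‖EuclideanSpace.single (⟨0, hd⟩ : Fin d) (1 : ℝ)‖ = 1 := by simp
  obtain ⟨hu1, hu2, hu3⟩ := hu
  obtain ⟨L, hL⟩ := hu1.lipschitzWith_of_hasCompactSupport hu2 one_ne_zero
  obtain ⟨M, hM⟩ := hu2.exists_bound_of_continuous hu1.continuous
  obtain ⟨R, hR0, hR⟩ := hu2.isCompact.isBounded.exists_pos_norm_le
  have huS : ∀ x, x ∉ tsupport u → u x = 0 := fun x hx => image_eq_zero_of_notMem_tsupport hx
  have hSm : MeasurableSet (tsupport u) := (isClosed_tsupport u).measurableSet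
  have hfin := setLIntegral_hardyWeight_lt_top hΩ hu2.isCompact hu3
  obtain ⟨K, hK0, hK⟩ := exists_norm_sub_le_ratio (fun x y => by
    simpa [dist_eq_norm] using hL.dist_le_mul x y) L.2 hM
    (fun x hx => huS x fun h => absurd (hR x h) (not_le.2 hx)) hR0
  exact ⟨lintegral_gagliardo_lt_top hs hp hα hβ hSm huS hK0 hK hfin he,
    lintegral_hardy_lt_top (by linarith [hp.1]) hSm huS hM hfin⟩

lemma integral_integral_eq_toReal {f : EuclideanSpace ℝ (Fin d) → EuclideanSpace ℝ (Fin d) → ℝ}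
    (hf : Measurable fun z : EuclideanSpace ℝ (Fin d) × EuclideanSpace ℝ (Fin d) => f z.1 z.2)
    (h0 : ∀ x y, 0 ≤ f x y)
    (h : ∫⁻ z : EuclideanSpace ℝ (Fin d) × EuclideanSpace ℝ (Fin d),
      ENNReal.ofReal (f z.1 z.2) < ∞) :
    ∫ x, ∫ y, f x y = (∫⁻ z : EuclideanSpace ℝ (Fin d) × EuclideanSpace ℝ (Fin d),
      ENNReal.ofReal (f z.1 z.2)).toReal := by
  have hi : Integrable (fun z : EuclideanSpace ℝ (Fin d) × EuclideanSpace ℝ (Fin d) => f z.1 z.2)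
    (volume.prod volume) := integrable_of_lintegral_ofReal hf (fun z => h0 z.1 z.2) h
  have h1 := integral_eq_lintegral_of_nonneg_ae
    (f := fun z : EuclideanSpace ℝ (Fin d) × EuclideanSpace ℝ (Fin d) => f z.1 z.2)
    (μ := volume.prod volume) (.of_forall fun z => h0 z.1 z.2) hf.aestronglyMeasurable
  rw [Measure.volume_eq_prod, ← h1, integral_prod _ hi]

lemma lintegral_gagliardo_norm_le {F : Type*} [NormedAddCommGroup F] (hp : 0 ≤ p)
    (u : EuclideanSpace ℝ (Fin d) → F) :
    ∫⁻ z : EuclideanSpace ℝ (Fin d) × EuclideanSpace ℝ (Fin d),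
      ENNReal.ofReal (gagliardoIntegrand s p α β (fun x => ‖u x‖) z.1 z.2) ≤
    ∫⁻ z : EuclideanSpace ℝ (Fin d) × EuclideanSpace ℝ (Fin d),
      ENNReal.ofReal (gagliardoIntegrand s p α β u z.1 z.2) := by
  refine lintegral_mono fun z => ENNReal.ofReal_le_ofReal ?_
  rw [gagliardoIntegrand_eq, gagliardoIntegrand_eq]
  exact mul_le_mul_of_nonneg_right (Real.rpow_le_rpow (norm_nonneg _)
    (abs_norm_sub_norm_le _ _) hp) (weight_nonneg _ _ _ _)

/-- Passing from lower integrals to the Hardy difference; `u` is compared with the real function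
`u₀`, which has the same Hardy integral and a smaller double integral. -/
lemma hardyDifference_ge {F : Type*} [NormedAddCommGroup F] (hd : 1 ≤ d)
    (hs : s ∈ Ioo (0 : ℝ) 1) (hp : p ∈ Ioo (1 : ℝ) 2)
    (hα : α ∈ Ioo (-(s * p)) (d : ℝ)) (hβ : β ∈ Ioo (-(s * p)) (d : ℝ))
    (hne : s * p + α + β ≠ d) {C : ℝ} (hC0 : 0 < C) (hC : C ≤ p - 1)
    {u : EuclideanSpace ℝ (Fin d) → F} {u₀ : EuclideanSpace ℝ (Fin d) → ℝ}
    (hu : Continuous u) (hu₀ : Continuous u₀)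
    (hab : ∀ x y, 0 ≤ u₀ x * u₀ y ∨ C ≤ remainderConst p)
    (hG : ∫⁻ z : EuclideanSpace ℝ (Fin d) × EuclideanSpace ℝ (Fin d),
      ENNReal.ofReal (gagliardoIntegrand s p α β u z.1 z.2) < ∞)
    (hGle : ∫⁻ z : EuclideanSpace ℝ (Fin d) × EuclideanSpace ℝ (Fin d),
      ENNReal.ofReal (gagliardoIntegrand s p α β u₀ z.1 z.2) ≤
        ∫⁻ z : EuclideanSpace ℝ (Fin d) × EuclideanSpace ℝ (Fin d),
          ENNReal.ofReal (gagliardoIntegrand s p α β u z.1 z.2))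
    (hH : ∫⁻ x, ENNReal.ofReal (hardyIntegrand s p α β u x) < ∞)
    (huu : ∀ x, ‖u₀ x‖ = ‖u x‖) :
    IntegralsConverge s p α β u (transform s p α β u₀) ∧
      hardyDifference s p α β (hardyConst d s p α β) u ≥
        C * remainderTerm s p α β (transform s p α β u₀) := by
  have hHeq : hardyIntegrand s p α β u₀ = hardyIntegrand s p α β u := by
    ext x; rw [hardyIntegrand, hardyIntegrand, huu]
  have key := (hardy_lintegral hd hs hp hα hβ hne hC0.le hC hu₀.measurable hab
    (by rwa [hHeq])).trans hGle
  rw [hHeq] at key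
  have hRm := measurable_remainderIntegrand (s := s) (p := p) (α := α) (β := β)
    (measurable_transform (s := s) (p := p) (α := α) (β := β) hu₀.measurable)
  have hGm := measurable_gagliardoIntegrand (s := s) (p := p) (α := α) (β := β) hu
  have hHm := measurable_hardyIntegrand (s := s) (p := p) (α := α) (β := β) hu
  have hR : ∫⁻ z : EuclideanSpace ℝ (Fin d) × EuclideanSpace ℝ (Fin d),
      -- Convergence of the remainder is read off from the inequality itself, since C > 0 and the
      -- energy is finite.
      ENNReal.ofReal (remainderIntegrand s p α β (transform s p α β u₀) z.1 z.2) < ∞ := by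
    have h := (le_add_self.trans key).trans_lt hG
    exact ENNReal.lt_top_of_mul_ne_top_right h.ne (ENNReal.ofReal_pos.2 hC0).ne'
  refine ⟨⟨integrable_of_lintegral_ofReal hGm (fun z => gagliardoIntegrand_nonneg _ _ _) hG,
    integrable_of_lintegral_ofReal hHm (hardyIntegrand_nonneg _) hH,
    integrable_of_lintegral_ofReal hRm (remainderIntegrand_nonneg _) hR⟩, ?_⟩
  rw [hardyDifference, remainderTerm, integral_integral_eq_toReal hGm
    (gagliardoIntegrand_nonneg _) hG, integral_integral_eq_toReal hRm
    (fun x y => remainderIntegrand_nonneg _ (x, y)) hR,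
    integral_eq_lintegral_of_nonneg_ae (.of_forall (hardyIntegrand_nonneg _))
      hHm.aestronglyMeasurable]
  have h := ENNReal.toReal_mono hG.ne key
  rw [ENNReal.toReal_add (ENNReal.mul_lt_top hH ENNReal.ofReal_lt_top).ne
    (ENNReal.mul_lt_top ENNReal.ofReal_lt_top hR).ne, ENNReal.toReal_mul, ENNReal.toReal_mul,
    ENNReal.toReal_ofReal hC0.le,
    ENNReal.toReal_ofReal (hardyConst_pos hd hs hp hα hβ hne).le] at h
  rw [ge_iff_le, le_sub_iff_add_le]
  linarith

end Consequences

/-! ### Tools for sharpness: logarithmic profiles and logarithmic mass -/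

section Sharpness

/-- Convexity of x^p at the points |a|/(1-θ) and |b|/θ. As θ → 0 the coefficient of |a|^p tends to
1, so the main term loses nothing in the limit. -/
lemma abs_add_rpow_le {p θ : ℝ} (hp : 1 ≤ p) (hθ : θ ∈ Ioo (0 : ℝ) 1) (a b : ℝ) :
    |a + b| ^ p ≤ (1 - θ) ^ (1 - p) * |a| ^ p + θ ^ (1 - p) * |b| ^ p := by
  have h1 : 0 < 1 - θ := by linarith [hθ.2]
  have h := (convexOn_rpow hp).2 (mem_Ici.2 (div_nonneg (abs_nonneg a) h1.le))
    (mem_Ici.2 (div_nonneg (abs_nonneg b) hθ.1.le)) h1.le hθ.1.le (by ring)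
  simp only [smul_eq_mul] at h
  have key : ∀ {t c : ℝ}, 0 < t → 0 ≤ c → t * (c / t) ^ p = t ^ (1 - p) * c ^ p := by
    intro t c ht hc
    rw [Real.div_rpow hc ht.le, Real.rpow_sub ht, Real.rpow_one]
    ring
  rw [key h1 (abs_nonneg a), key hθ.1 (abs_nonneg b), mul_div_cancel₀ _ h1.ne',
    mul_div_cancel₀ _ hθ.1.ne'] at h
  exact (Real.rpow_le_rpow (abs_nonneg _) (abs_add_le a b) (by linarith)).trans h

/-- A smooth cutoff on the line together with its truncated Lipschitz bound. -/
lemma exists_plateau : ∃ χ : ℝ → ℝ, ContDiff ℝ 1 χ ∧ (∀ t, |t| ≤ 1 → χ t = 1) ∧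
    (∀ t, 2 ≤ |t| → χ t = 0) ∧ ∃ K, 0 ≤ K ∧ ∀ a b, |χ a - χ b| ≤ K * min 1 |a - b| := by
  let χ : ContDiffBump (0 : ℝ) := ⟨1, 2, one_pos, one_lt_two⟩
  have hχ : ContDiff ℝ 1 χ := χ.contDiff
  obtain ⟨L, hL⟩ := hχ.lipschitzWith_of_hasCompactSupport χ.hasCompactSupport one_ne_zero
  refine ⟨χ, hχ, fun t ht => χ.one_of_mem_closedBall (by simpa using ht),
    fun t ht => χ.zero_of_le_dist (by simpa using ht), max 1 L, le_max_of_le_left zero_le_one,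
    fun a b => ?_⟩
  have h1 : |χ a - χ b| ≤ 1 := abs_sub_le_iff.2
    ⟨by linarith [χ.le_one (x := a), χ.nonneg (x := b)],
      by linarith [χ.le_one (x := b), χ.nonneg (x := a)]⟩
  have h2 : |χ a - χ b| ≤ L * |a - b| := by simpa [Real.dist_eq] using hL.dist_le_mul a b
  rcases min_choice 1 |a - b| with h | h <;> rw [h]
  · linarith [le_max_left (1 : ℝ) L]
  · exact h2.trans (mul_le_mul_of_nonneg_right (le_max_right _ _) (abs_nonneg _))

/-- The increment of a slowly varying logarithmic profile, truncated at `1`. -/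
noncomputable def logStep (N r : ℝ) : ℝ := min 1 (|Real.log r| / N)

@[fun_prop]
lemma measurable_logStep (N : ℝ) : Measurable (logStep N) := by
  unfold logStep; fun_prop

lemma logStep_nonneg {N : ℝ} (hN : 0 ≤ N) (r : ℝ) : 0 ≤ logStep N r :=
  le_min zero_le_one (by positivity)

lemma logStep_inv (N r : ℝ) : logStep N r⁻¹ = logStep N r := by
  rw [logStep, logStep, Real.log_inv, abs_neg]

lemma logStep_le_one_sub {N r : ℝ} (hN : 1 ≤ N) (hr : 0 < r) :
    logStep N r ≤ 2 * |1 - r| * (max 1 r)⁻¹ := by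
  have h0 : logStep N r ≤ min 1 |Real.log r| :=
    min_le_min le_rfl (div_le_self (abs_nonneg _) hN)
  refine h0.trans ?_
  rw [← div_eq_mul_inv, le_div_iff₀ (lt_max_of_lt_left one_pos)]
  rcases le_total r 1 with h | h
  · rw [max_eq_left h, mul_one, abs_of_nonneg (sub_nonneg.2 h)]
    rcases le_total r (1 / 2) with h' | h'
    · exact (min_le_left _ _).trans (by linarith)
    · refine (min_le_right _ _).trans ?_
      rw [abs_of_nonpos (Real.log_nonpos hr.le h), ← Real.log_inv]
      refine (Real.log_le_sub_one_of_pos (inv_pos.2 hr)).trans ?_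
      rw [← one_div, div_sub_one hr.ne', div_le_iff₀ hr]
      nlinarith
  · rw [max_eq_right h, abs_of_nonpos (by linarith : 1 - r ≤ 0)]
    rcases le_total r 2 with h' | h'
    · have h1 : min 1 |Real.log r| ≤ r - 1 := by
        refine (min_le_right _ _).trans ?_
        rw [abs_of_nonneg (Real.log_nonneg h)]
        exact Real.log_le_sub_one_of_pos hr
      nlinarith
    · have h1 : min 1 |Real.log r| ≤ 1 := min_le_left _ _
      nlinarith

variable {E : Type*} [NormedAddCommGroup E] [InnerProductSpace ℝ E] [FiniteDimensional ℝ E]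
  [MeasurableSpace E] [BorelSpace E] [Nontrivial E]

/-- The energy of a slowly varying logarithmic profile vanishes in the limit. -/
lemma tendsto_kernelInt_logStep {e : E} (he : ‖e‖ = 1) {σ p b : ℝ} (hp : 0 < p) (hσp : σ < p)
    (hb : -σ < b) (hb' : b < Module.finrank ℝ E) :
    Filter.Tendsto (fun n : ℕ => kernelInt e ((Module.finrank ℝ E : ℝ) + σ)
      fun r => ENNReal.ofReal (logStep ((n : ℝ) + 1) r ^ p * r ^ (-b))) Filter.atTop (nhds 0) := by
  have hle : ∀ {N r : ℝ}, 1 ≤ N → 0 < r → ENNReal.ofReal (logStep N r ^ p * r ^ (-b)) ≤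
      ENNReal.ofReal (|1 - r| ^ p) * (ENNReal.ofReal (2 ^ p) *
        ENNReal.ofReal ((max 1 r) ^ (-p) * r ^ (-b))) := by
    intro N r hN hr
    have hm : 0 < max 1 r := lt_max_of_lt_left one_pos
    rw [← ENNReal.ofReal_mul (by positivity), ← ENNReal.ofReal_mul (by positivity)]
    apply ENNReal.ofReal_le_ofReal
    have h := Real.rpow_le_rpow (logStep_nonneg (by linarith) r) (logStep_le_one_sub hN hr) hp.le
    rw [Real.mul_rpow (by positivity) (by positivity), Real.mul_rpow (by norm_num) (abs_nonneg _),
      Real.inv_rpow hm.le, ← Real.rpow_neg hm.le] at h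
    refine (mul_le_mul_of_nonneg_right h (by positivity)).trans (le_of_eq ?_)
    ring
  have hmono : ∀ {n : ℕ} {r : ℝ}, ENNReal.ofReal (logStep ((n : ℝ) + 1) r ^ p * r ^ (-b)) ≤
      ENNReal.ofReal (logStep 1 r ^ p * |r ^ (-b)|) := by
    intro n r
    apply ENNReal.ofReal_le_ofReal
    have h1 : logStep ((n : ℝ) + 1) r ≤ logStep 1 r := by
      unfold logStep
      refine min_le_min le_rfl (div_le_div_of_nonneg_left (abs_nonneg _) one_pos ?_)
      linarith [n.cast_nonneg (α := ℝ)]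
    have h2 := Real.rpow_le_rpow (logStep_nonneg (by positivity) r) h1 hp.le
    have h3 := Real.rpow_nonneg (logStep_nonneg (N := (n : ℝ) + 1) (by positivity) r) p
    exact (mul_le_mul_of_nonneg_left (le_abs_self _) h3).trans
      (mul_le_mul_of_nonneg_right h2 (abs_nonneg _))
  have hzero : (∫⁻ _ : E, (0 : ℝ≥0∞)) = 0 := lintegral_zero
  rw [← hzero]
  -- The steps decrease in N, so the profile with N = 1 dominates; it is integrable because it is at
  -- most a multiple of |1-r|/max(1,r).
  refine tendsto_lintegral_of_dominated_convergence
    (fun z => ENNReal.ofReal (logStep 1 ‖z‖ ^ p * ‖z‖ ^ (-b)) *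
      ENNReal.ofReal (‖e - z‖ ^ (-((Module.finrank ℝ E : ℝ) + σ))))
    (fun n => by fun_prop) (fun n => .of_forall fun z => ?_) (ne_of_lt ?_) (.of_forall fun z => ?_)
  · refine mul_le_mul_left ?_ _
    have := hmono (n := n) (r := ‖z‖)
    rwa [abs_of_nonneg (Real.rpow_nonneg (norm_nonneg _) _)] at this
  · refine (kernelInt_le_of_dominated he hp.le fun r hr _ => hle le_rfl hr).trans_lt ?_
    rw [kernelInt_const_mul _ _ ENNReal.ofReal_ne_top]
    exact ENNReal.mul_lt_top ENNReal.ofReal_lt_top (kernelInt_lt_top he hp.le hσp hb hb')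
  · have h1 : Filter.Tendsto (fun n : ℕ => logStep ((n : ℝ) + 1) ‖z‖) Filter.atTop (nhds 0) := by
      have h2 : Filter.Tendsto (fun n : ℕ => |Real.log ‖z‖| / ((n : ℝ) + 1)) Filter.atTop
          (nhds 0) := tendsto_const_nhds.div_atTop
        (Filter.tendsto_atTop_add_const_right _ _ tendsto_natCast_atTop_atTop)
      exact tendsto_of_tendsto_of_tendsto_of_le_of_le tendsto_const_nhds h2
        (fun n => logStep_nonneg (by positivity) _) fun n => min_le_right _ _
    have h3 := (h1.rpow_const (Or.inr hp.le)).mul_const (‖z‖ ^ (-b))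
    rw [Real.zero_rpow hp.ne', zero_mul] at h3
    have h4 := ENNReal.Tendsto.mul_const (b := ENNReal.ofReal
      (‖e - z‖ ^ (-((Module.finrank ℝ E : ℝ) + σ)))) (ENNReal.tendsto_ofReal h3)
      (Or.inr ENNReal.ofReal_ne_top)
    simpa using h4

/-- The mass of `‖x‖^{-dim}` on the logarithmic annulus `a ≤ log ‖x‖ ≤ b`. -/
noncomputable def logMass (E : Type*) [NormedAddCommGroup E] [InnerProductSpace ℝ E]
    [FiniteDimensional ℝ E] [MeasurableSpace E] [BorelSpace E] (a b : ℝ) : ℝ≥0∞ :=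
  ∫⁻ x : E, (Icc a b).indicator 1 (Real.log ‖x‖) *
    ENNReal.ofReal (‖x‖ ^ (-(Module.finrank ℝ E : ℝ)))

omit [InnerProductSpace ℝ E] [FiniteDimensional ℝ E] [Nontrivial E] in
lemma measurable_logIndicator (a b : ℝ) :
    Measurable fun x : E => (Icc a b).indicator (1 : ℝ → ℝ≥0∞) (Real.log ‖x‖) :=
  (measurable_one.indicator measurableSet_Icc).comp (by fun_prop)

/-- The measure |x|^(-d) dx is invariant under dilations, and dilation by e^t translates log|x| by
t. -/
lemma logMass_add_right (a b t : ℝ) : logMass E (a + t) (b + t) = logMass E a b := by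
  have hm := (measurable_logIndicator (E := E) (a + t) (b + t))
  rw [logMass, lintegral_comp_smul_pos (by fun_prop) (Real.exp_pos t), logMass,
    ← lintegral_const_mul _ (by
      have := (hm.comp (measurable_const_smul (Real.exp t)))
      simp only [Function.comp_def] at this
      fun_prop)]
  apply lintegral_congr_ae
  filter_upwards [measure_eq_zero_iff_ae_notMem.1 (measure_singleton (0 : E))] with x hx
  have hx0 : 0 < ‖x‖ := norm_pos_iff.2 hx
  have he : 0 < Real.exp t := Real.exp_pos t
  rw [norm_smul, Real.norm_of_nonneg he.le, Real.log_mul he.ne' hx0.ne', Real.log_exp,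
    Real.mul_rpow he.le hx0.le, mul_left_comm, ← ENNReal.ofReal_mul (by positivity),
    ← mul_assoc (Real.exp t ^ _), Real.rpow_neg he.le, Real.rpow_natCast,
    mul_inv_cancel₀ (by positivity), one_mul]
  congr 1
  by_cases h : Real.log ‖x‖ ∈ Icc a b
  · rw [indicator_of_mem h, indicator_of_mem (by constructor <;> linarith [h.1, h.2])]; rfl
  · rw [indicator_of_notMem h, indicator_of_notMem]
    exact fun h' => h ⟨by linarith [h'.1], by linarith [h'.2]⟩

/-- Two translates of [-a, a] cover [-2a, 2a]. Hence the mass of the whole support of a test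
function is controlled by that of its plateau. -/
lemma logMass_doubling (a : ℝ) :
    logMass E (-(2 * a)) (2 * a) ≤ 2 * logMass E (-a) a := by
  have h1 := logMass_add_right (E := E) (-a) a a
  have h2 := logMass_add_right (E := E) (-a) a (-a)
  have hm := (measurable_logIndicator (E := E) (-a + a) (a + a))
  rw [two_mul (logMass E (-a) a)]
  nth_rewrite 1 [← h1]
  rw [← h2]
  rw [logMass, logMass, logMass, ← lintegral_add_left (by fun_prop)]
  refine lintegral_mono fun x => ?_
  rw [← add_mul]
  refine mul_le_mul_left ?_ _
  by_cases h : Real.log ‖x‖ ∈ Icc (-(2 * a)) (2 * a)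
  · rw [indicator_of_mem h, Pi.one_apply]
    rcases le_total 0 (Real.log ‖x‖) with h' | h'
    · rw [indicator_of_mem (show Real.log ‖x‖ ∈ Icc (-a + a) (a + a) from
        ⟨by linarith, by linarith [h.2]⟩)]
      exact le_self_add
    · rw [indicator_of_mem (show Real.log ‖x‖ ∈ Icc (-a + -a) (a + -a) from
        ⟨by linarith [h.1], by linarith⟩)]
      exact le_add_self
  · rw [indicator_of_notMem h]; exact zero_le

lemma logMass_pos {a : ℝ} (ha : 0 < a) : 0 < logMass E (-a) a := by
  obtain ⟨e, he⟩ : ∃ e : E, ‖e‖ = 1 := exists_norm_eq E zero_le_one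
  have hm := (measurable_logIndicator (E := E) (-a) a)
  rw [logMass, lintegral_pos_iff_support (by fun_prop)]
  have hc : ContinuousAt (fun x : E => Real.log ‖x‖) e :=
    continuous_norm.continuousAt.log (by rw [he]; exact one_ne_zero)
  have h1 : ∀ᶠ x in nhds e, Real.log ‖x‖ ∈ Ioo (-a) a :=
    hc.eventually (isOpen_Ioo.mem_nhds (by simp [he, ha]))
  have h2 : ∀ᶠ x in nhds e, x ≠ 0 := eventually_ne_nhds (by rintro rfl; simp at he)
  refine Measure.measure_pos_of_mem_nhds (μ := volume) (x := e) (Filter.mem_of_superset (h1.and h2) ?_)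
  rintro x ⟨hx1, hx2⟩
  have hx0 : 0 < ‖x‖ := norm_pos_iff.2 hx2
  rw [Function.mem_support, indicator_of_mem (Ioo_subset_Icc_self hx1), Pi.one_apply, one_mul,
    ne_eq, ENNReal.ofReal_eq_zero, not_le]
  positivity

end Sharpness

/-! ### Logarithmically truncated ground states -/

section TestFunctions

variable {d : ℕ} {s p α β g : ℝ} {χ : ℝ → ℝ}

/-- The ground state, cut off on a logarithmic scale. -/
noncomputable def testFn (χ : ℝ → ℝ) (g N : ℝ) (x : EuclideanSpace ℝ (Fin d)) : ℝ :=
  ‖x‖ ^ (-g) * χ (Real.log ‖x‖ / N)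

lemma plateau_eq_zero (h2 : ∀ t, 2 ≤ |t| → χ t = 0) {N t : ℝ} (hN : 0 < N)
    (ht : t ∉ Icc (-(2 * N)) (2 * N)) : χ (t / N) = 0 := by
  apply h2
  rw [abs_div, abs_of_pos hN, le_div_iff₀ hN]
  by_contra h
  exact ht (abs_le.1 (not_le.1 h).le)

lemma isCc1_testFn (hχ : ContDiff ℝ 1 χ) (h2 : ∀ t, 2 ≤ |t| → χ t = 0) (hg : g ≠ 0) {N : ℝ}
    (hN : 0 < N) {Ω : Set (EuclideanSpace ℝ (Fin d))} (hΩ : {0}ᶜ ⊆ Ω) :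
    IsCc1 Ω (testFn χ g N) := by
  have hz : ∀ x : EuclideanSpace ℝ (Fin d),
      x ∉ Metric.closedBall 0 (Real.exp (2 * N)) \ Metric.ball 0 (Real.exp (-(2 * N))) →
      testFn χ g N x = 0 := by
    intro x hx
    rcases eq_or_ne x 0 with rfl | hx0
    -- The value at the origin is 0 only through 0^(-g) = 0 for g ≠ 0: the cutoff does not help,
    -- since log 0 = 0 by convention.
    · rw [testFn, norm_zero, Real.zero_rpow (neg_ne_zero.2 hg), zero_mul]
    · have hx1 : 0 < ‖x‖ := norm_pos_iff.2 hx0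
      rw [testFn, plateau_eq_zero h2 hN, mul_zero]
      rintro ⟨h, h'⟩
      refine hx ⟨?_, ?_⟩
      · rw [mem_closedBall_zero_iff]
        exact (Real.log_le_iff_le_exp hx1).1 h'
      · rw [mem_ball_zero_iff, not_lt]
        exact (Real.le_log_iff_exp_le hx1).1 h
  have hK : IsCompact (Metric.closedBall (0 : EuclideanSpace ℝ (Fin d)) (Real.exp (2 * N)) \
      Metric.ball 0 (Real.exp (-(2 * N)))) := (isCompact_closedBall _ _).diff Metric.isOpen_ball
  refine ⟨contDiff_iff_contDiffAt.2 fun x => ?_, HasCompactSupport.intro hK fun x hx => hz x hx, ?_⟩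
  · rcases eq_or_ne x 0 with rfl | hx0
    · refine (contDiffAt_const (c := (0 : ℝ))).congr_of_eventuallyEq ?_
      filter_upwards [Metric.ball_mem_nhds (0 : EuclideanSpace ℝ (Fin d))
        (Real.exp_pos (-(2 * N)))] with x hx
      exact hz x fun h => h.2 hx
    · have hn : ContDiffAt ℝ 1 (fun x : EuclideanSpace ℝ (Fin d) => ‖x‖) x := contDiffAt_norm ℝ hx0
      have hn0 : ‖x‖ ≠ 0 := norm_ne_zero_iff.2 hx0
      exact (hn.rpow_const_of_ne hn0).mul
        (hχ.contDiffAt.comp x ((hn.log hn0).div_const N))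
  · refine fun x hx => hΩ fun h => ?_
    have hx' := closure_minimal (s := Function.support (testFn χ g N))
      (fun y hy => by_contra fun h => hy (hz y h)) hK.isClosed hx
    rw [mem_singleton_iff.1 h] at hx'
    exact hx'.2 (Metric.mem_ball_self (Real.exp_pos _))

/-- A discrete product rule: the increment is u(x)(1-(Y/X)^(-g)) plus Y^(-g) times the increment of
the cutoff, and `abs_add_rpow_le` separates the two. -/
lemma testFn_increment_le (hp : 1 ≤ p) {θ K N X Y : ℝ} (hθ : θ ∈ Ioo (0 : ℝ) 1) (hK : 0 ≤ K)
    (hN : 0 < N) (hχK : ∀ a b, |χ a - χ b| ≤ K * min 1 |a - b|) (hX : 0 < X) (hY : 0 < Y) :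
    ‖X ^ (-g) * χ (Real.log X / N) - Y ^ (-g) * χ (Real.log Y / N)‖ ^ p ≤
      (1 - θ) ^ (1 - p) * (‖X ^ (-g) * χ (Real.log X / N)‖ ^ p * |1 - (Y / X) ^ (-g)| ^ p) +
      θ ^ (1 - p) * K ^ p * (Y ^ (-(g * p)) * logStep N (Y / X) ^ p) := by
  have hp0 : 0 ≤ p := by linarith
  have hXg : 0 < X ^ (-g) := Real.rpow_pos_of_pos hX _
  have hYg : 0 < Y ^ (-g) := Real.rpow_pos_of_pos hY _
  have e1 : X ^ (-g) * χ (Real.log X / N) - Y ^ (-g) * χ (Real.log Y / N) =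
      X ^ (-g) * χ (Real.log X / N) * (1 - (Y / X) ^ (-g)) +
        Y ^ (-g) * (χ (Real.log X / N) - χ (Real.log Y / N)) := by
    rw [Real.div_rpow hY.le hX.le]
    field_simp
    ring
  have h1 := abs_add_rpow_le hp hθ (X ^ (-g) * χ (Real.log X / N) * (1 - (Y / X) ^ (-g)))
    (Y ^ (-g) * (χ (Real.log X / N) - χ (Real.log Y / N)))
  rw [← e1, abs_mul, Real.mul_rpow (abs_nonneg _) (abs_nonneg _), abs_mul (Y ^ (-g)),
    abs_of_pos hYg, Real.mul_rpow hYg.le (abs_nonneg _), ← Real.rpow_mul hY.le] at h1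
  have h2 : |χ (Real.log X / N) - χ (Real.log Y / N)| ^ p ≤ K ^ p * logStep N (Y / X) ^ p := by
    rw [← Real.mul_rpow hK (logStep_nonneg hN.le _)]
    refine Real.rpow_le_rpow (abs_nonneg _) ((hχK _ _).trans (le_of_eq ?_)) hp0
    rw [logStep, ← sub_div, abs_div, abs_of_pos hN, Real.log_div hY.ne' hX.ne', abs_sub_comm]
  rw [Real.norm_eq_abs, Real.norm_eq_abs]
  refine h1.trans (add_le_add_right ?_ _)
  have hθp : 0 < θ ^ (1 - p) := Real.rpow_pos_of_pos hθ.1 _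
  rw [mul_assoc, show -g * p = -(g * p) by ring]
  refine mul_le_mul_of_nonneg_left ?_ hθp.le
  have := mul_le_mul_of_nonneg_left h2 (Real.rpow_nonneg hY.le (-(g * p)))
  linarith

/-- By `ofReal_hardyConst` the kernel factor is exactly 𝒞, so the main part of the energy is 𝒞 times
the Hardy integral. -/
lemma lintegral_testFn_main [Nontrivial (EuclideanSpace ℝ (Fin d))]
    {u : EuclideanSpace ℝ (Fin d) → ℝ} (hu : Measurable u)
    {e : EuclideanSpace ℝ (Fin d)} (he : ‖e‖ = 1) :
    ∫⁻ z : EuclideanSpace ℝ (Fin d) × EuclideanSpace ℝ (Fin d),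
      ENNReal.ofReal (‖u z.1‖ ^ p * |1 - (‖z.2‖ / ‖z.1‖) ^ (-g)| ^ p *
        weight ((d : ℝ) + s * p) α β z) =
    (∫⁻ x, ENNReal.ofReal (hardyIntegrand s p α β u x)) * kernelInt e ((d : ℝ) + s * p)
      fun r => ENNReal.ofReal (|1 - r ^ (-g)| ^ p * r ^ (-β)) := by
  have h := lintegral_prod_ratio (G := fun x : EuclideanSpace ℝ (Fin d) =>
      ENNReal.ofReal (‖u x‖ ^ p * ‖x‖ ^ (-α - β))) (by fun_prop)
    (f := fun r => ENNReal.ofReal (|1 - r ^ (-g)| ^ p * r ^ (-β))) (by fun_prop) he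
    ((d : ℝ) + s * p)
  rw [finrank_euclideanSpace_fin] at h
  rw [lintegral_hardyIntegrand, ← h]
  apply lintegral_congr_ae
  filter_upwards [ae_prod_ne_zero] with z hz
  have hz1 : 0 < ‖z.1‖ := norm_pos_iff.2 hz.1
  have hz2 : 0 < ‖z.2‖ := norm_pos_iff.2 hz.2
  rw [← ENNReal.ofReal_mul (by positivity), ← ENNReal.ofReal_mul (by positivity), weight,
    show -α - β = -α + -β by ring, Real.rpow_add hz1, Real.div_rpow hz2.le hz1.le (-β)]
  congr 1
  have := (Real.rpow_pos_of_pos hz1 (-β)).ne'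
  field_simp

lemma lintegral_logStep_fst [Nontrivial (EuclideanSpace ℝ (Fin d))]
    (hg : g * p = (d : ℝ) - α - β - s * p) {N : ℝ} (hN : 0 ≤ N) (a b : ℝ)
    {e : EuclideanSpace ℝ (Fin d)} (he : ‖e‖ = 1) :
    ∫⁻ z : EuclideanSpace ℝ (Fin d) × EuclideanSpace ℝ (Fin d),
      (Icc a b).indicator 1 (Real.log ‖z.1‖) *
      ENNReal.ofReal (‖z.2‖ ^ (-(g * p)) * logStep N (‖z.2‖ / ‖z.1‖) ^ p *
        weight ((d : ℝ) + s * p) α β z) =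
    logMass (EuclideanSpace ℝ (Fin d)) a b * kernelInt e ((d : ℝ) + s * p)
      fun r => ENNReal.ofReal (logStep N r ^ p * r ^ (-(g * p + β))) := by
  have hm := measurable_logIndicator (E := EuclideanSpace ℝ (Fin d)) a b
  have h := lintegral_prod_ratio (G := fun x : EuclideanSpace ℝ (Fin d) =>
      (Icc a b).indicator 1 (Real.log ‖x‖) * ENNReal.ofReal (‖x‖ ^ (-(g * p) - α - β)))
      (by fun_prop) (f := fun r => ENNReal.ofReal (logStep N r ^ p * r ^ (-(g * p + β))))
      (by fun_prop) he ((d : ℝ) + s * p)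
  have hmass : logMass (EuclideanSpace ℝ (Fin d)) a b = ∫⁻ x : EuclideanSpace ℝ (Fin d),
      (Icc a b).indicator 1 (Real.log ‖x‖) * ENNReal.ofReal (‖x‖ ^ (-(g * p) - α - β)) *
        ENNReal.ofReal (‖x‖ ^ ((Module.finrank ℝ (EuclideanSpace ℝ (Fin d)) : ℝ) -
          ((d : ℝ) + s * p))) := by
    apply lintegral_congr_ae
    filter_upwards [measure_eq_zero_iff_ae_notMem.1
      (measure_singleton (0 : EuclideanSpace ℝ (Fin d)))] with x hx
    rw [mul_assoc, ← ENNReal.ofReal_mul (by positivity), ← Real.rpow_add (norm_pos_iff.2 hx),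
      finrank_euclideanSpace_fin]
    congr 3; linarith
  rw [hmass, ← h]
  apply lintegral_congr_ae
  filter_upwards [ae_prod_ne_zero] with z hz
  have hz1 : 0 < ‖z.1‖ := norm_pos_iff.2 hz.1
  have hz2 : 0 < ‖z.2‖ := norm_pos_iff.2 hz.2
  have hl := Real.rpow_nonneg (logStep_nonneg hN (‖z.2‖ / ‖z.1‖)) p
  rw [mul_assoc ((Icc a b).indicator _ _), ← ENNReal.ofReal_mul (by positivity),
    ← ENNReal.ofReal_mul (by positivity), weight, show -(g * p) - α - β = -α + -(g * p + β) by ring,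
    Real.rpow_add hz1, Real.div_rpow hz2.le hz1.le (-(g * p + β)),
    show -(g * p + β) = -(g * p) + -β by ring, Real.rpow_add hz2]
  congr 2
  have := (Real.rpow_pos_of_pos hz1 (-(g * p) + -β)).ne'
  field_simp

lemma lintegral_logStep_snd [Nontrivial (EuclideanSpace ℝ (Fin d))]
    (hg : g * p = (d : ℝ) - α - β - s * p) {N : ℝ} (hN : 0 ≤ N) (a b : ℝ)
    {e : EuclideanSpace ℝ (Fin d)} (he : ‖e‖ = 1) :
    ∫⁻ z : EuclideanSpace ℝ (Fin d) × EuclideanSpace ℝ (Fin d),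
      (Icc a b).indicator 1 (Real.log ‖z.2‖) *
      ENNReal.ofReal (‖z.2‖ ^ (-(g * p)) * logStep N (‖z.2‖ / ‖z.1‖) ^ p *
        weight ((d : ℝ) + s * p) α β z) =
    logMass (EuclideanSpace ℝ (Fin d)) a b * kernelInt e ((d : ℝ) + s * p)
      fun r => ENNReal.ofReal (logStep N r ^ p * r ^ (-α)) := by
  -- Exchanging x and y puts |·|^(-gp) on the wrong point; shifting the weights to β+gp and α-gp,
  -- with the same sum, moves it back.
  have h := lintegral_logStep_fst (s := s) (g := g) (p := p) (α := β + g * p) (β := α - g * p)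
    (by linarith) hN a b he
  rw [show g * p + (α - g * p) = α by ring] at h
  rw [← h, Measure.volume_eq_prod, ← lintegral_prod_swap]
  apply lintegral_congr_ae
  rw [← Measure.volume_eq_prod]
  filter_upwards [ae_prod_ne_zero] with z hz
  have hz1 : 0 < ‖z.1‖ := norm_pos_iff.2 hz.1
  have hz2 : 0 < ‖z.2‖ := norm_pos_iff.2 hz.2
  rw [Prod.fst_swap, Prod.snd_swap, weight_swap, ← inv_div, logStep_inv, weight, weight,
    show -(β + g * p) = -(g * p) + -β by ring, show -(α - g * p) = -α + g * p by ring,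
    Real.rpow_add hz1, Real.rpow_add hz2, Real.rpow_neg hz2.le (g * p)]
  congr 2
  have := (Real.rpow_pos_of_pos hz2 (g * p)).ne'
  field_simp

end TestFunctions

/-! ### Optimality of the constant -/

section SharpConstant

variable {d : ℕ} {s p α β g : ℝ} {χ : ℝ → ℝ}

lemma lintegral_gagliardo_testFn_le [Nontrivial (EuclideanSpace ℝ (Fin d))] (hp : 1 ≤ p)
    (hg : g * p = (d : ℝ) - α - β - s * p) (hχ : Continuous χ) (h2 : ∀ t, 2 ≤ |t| → χ t = 0)
    {θ K N : ℝ} (hθ : θ ∈ Ioo (0 : ℝ) 1) (hK : 0 ≤ K) (hN : 0 < N)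
    (hχK : ∀ a b, |χ a - χ b| ≤ K * min 1 |a - b|)
    {e : EuclideanSpace ℝ (Fin d)} (he : ‖e‖ = 1) :
    ∫⁻ z : EuclideanSpace ℝ (Fin d) × EuclideanSpace ℝ (Fin d),
      ENNReal.ofReal (gagliardoIntegrand s p α β (testFn χ g N) z.1 z.2) ≤
    ENNReal.ofReal ((1 - θ) ^ (1 - p)) *
      ((∫⁻ x : EuclideanSpace ℝ (Fin d),
        ENNReal.ofReal (hardyIntegrand s p α β (testFn χ g N) x)) *
      kernelInt e ((d : ℝ) + s * p) fun r => ENNReal.ofReal (|1 - r ^ (-g)| ^ p * r ^ (-β))) +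
    ENNReal.ofReal (θ ^ (1 - p) * K ^ p) *
      (logMass (EuclideanSpace ℝ (Fin d)) (-(2 * N)) (2 * N) *
        ((kernelInt e ((d : ℝ) + s * p)
          fun r => ENNReal.ofReal (logStep N r ^ p * r ^ (-(g * p + β)))) +
        kernelInt e ((d : ℝ) + s * p)
          fun r => ENNReal.ofReal (logStep N r ^ p * r ^ (-α)))) := by
  have hp0 : 0 < p := by linarith
  have hum : Measurable (testFn χ g N : EuclideanSpace ℝ (Fin d) → ℝ) := by
    have := hχ.measurable
    unfold testFn
    fun_prop
  have hm := measurable_logIndicator (E := EuclideanSpace ℝ (Fin d)) (-(2 * N)) (2 * N)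
  have hm1 : Measurable fun z : EuclideanSpace ℝ (Fin d) × EuclideanSpace ℝ (Fin d) =>
    (Icc (-(2 * N)) (2 * N)).indicator (1 : ℝ → ℝ≥0∞) (Real.log ‖z.1‖) := hm.comp measurable_fst
  have hm2 : Measurable fun z : EuclideanSpace ℝ (Fin d) × EuclideanSpace ℝ (Fin d) =>
    (Icc (-(2 * N)) (2 * N)).indicator (1 : ℝ → ℝ≥0∞) (Real.log ‖z.2‖) := hm.comp measurable_snd
  have hA : 0 < (1 - θ) ^ (1 - p) := Real.rpow_pos_of_pos (by linarith [hθ.2]) _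
  have hB : 0 ≤ θ ^ (1 - p) * K ^ p :=
    mul_nonneg (Real.rpow_nonneg hθ.1.le _) (Real.rpow_nonneg hK _)
  rw [mul_add (logMass _ _ _), ← lintegral_testFn_main hum he,
    ← lintegral_logStep_fst hg hN.le _ _ he, ← lintegral_logStep_snd hg hN.le _ _ he,
    ← lintegral_add_left (by fun_prop), ← lintegral_const_mul _ (by fun_prop),
    ← lintegral_const_mul _ (by fun_prop), ← lintegral_add_left (by fun_prop)]
  apply lintegral_mono_ae
  filter_upwards [ae_prod_ne_zero] with z hz
  have hz1 : 0 < ‖z.1‖ := norm_pos_iff.2 hz.1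
  have hz2 : 0 < ‖z.2‖ := norm_pos_iff.2 hz.2
  have hw := weight_nonneg ((d : ℝ) + s * p) α β z
  have hl := Real.rpow_nonneg (logStep_nonneg hN.le (‖z.2‖ / ‖z.1‖)) p
  rw [← add_mul, gagliardoIntegrand_eq]
  by_cases hzS : Real.log ‖z.1‖ ∉ Icc (-(2 * N)) (2 * N) ∧ Real.log ‖z.2‖ ∉ Icc (-(2 * N)) (2 * N)
  · rw [testFn, testFn, plateau_eq_zero h2 hN hzS.1, plateau_eq_zero h2 hN hzS.2, mul_zero,
      mul_zero, sub_zero, norm_zero, Real.zero_rpow hp0.ne', zero_mul, ENNReal.ofReal_zero]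
    exact zero_le
  have h5 : (1 : ℝ≥0∞) ≤ (Icc (-(2 * N)) (2 * N)).indicator 1 (Real.log ‖z.1‖) +
      (Icc (-(2 * N)) (2 * N)).indicator 1 (Real.log ‖z.2‖) := by
    rcases not_and_or.1 hzS with h | h
    · rw [indicator_of_mem (not_not.1 h)]; exact le_self_add
    · rw [indicator_of_mem (not_not.1 h) (f := 1)]; exact le_add_self
  refine le_trans ?_ (add_le_add_right (mul_le_mul_right (mul_le_mul_left h5 _) _) _)
  rw [one_mul, ← ENNReal.ofReal_mul hA.le, ← ENNReal.ofReal_mul hB,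
    ← ENNReal.ofReal_add (by positivity) (by positivity)]
  apply ENNReal.ofReal_le_ofReal
  have h := mul_le_mul_of_nonneg_right
    (testFn_increment_le (g := g) hp hθ hK hN hχK hz1 hz2) hw
  simp only [testFn]
  linarith

/-- On the plateau u = |x|^(-g), and |x|^(-gp-sp-α-β) = |x|^(-d). -/
lemma logMass_le_lintegral_hardy [Nontrivial (EuclideanSpace ℝ (Fin d))]
    (hg : g * p = (d : ℝ) - α - β - s * p) (h1 : ∀ t, |t| ≤ 1 → χ t = 1) {N : ℝ} (hN : 0 < N) :
    logMass (EuclideanSpace ℝ (Fin d)) (-N) N ≤ ∫⁻ x : EuclideanSpace ℝ (Fin d),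
      ENNReal.ofReal (hardyIntegrand s p α β (testFn χ g N) x) := by
  apply lintegral_mono_ae
  filter_upwards [measure_eq_zero_iff_ae_notMem.1
    (measure_singleton (0 : EuclideanSpace ℝ (Fin d)))] with x hx
  have hx0 : 0 < ‖x‖ := norm_pos_iff.2 hx
  by_cases h : Real.log ‖x‖ ∈ Icc (-N) N
  · rw [indicator_of_mem h, Pi.one_apply, one_mul, hardyIntegrand, testFn, h1, mul_one,
      Real.norm_of_nonneg (by positivity), ← Real.rpow_mul hx0.le, ← Real.rpow_sub hx0,
      finrank_euclideanSpace_fin]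
    · apply le_of_eq
      congr 2; linarith
    · rw [abs_div, abs_of_pos hN, div_le_one hN]
      exact abs_le.2 h
  · rw [indicator_of_notMem h, zero_mul]; exact zero_le

/-- The constant of the Hardy inequality cannot be improved. -/
theorem le_hardyConst (hd : 1 ≤ d) (hs : s ∈ Ioo (0 : ℝ) 1) (hp : p ∈ Ioo (1 : ℝ) 2)
    (hα : α ∈ Ioo (-(s * p)) (d : ℝ)) (hβ : β ∈ Ioo (-(s * p)) (d : ℝ))
    {Ω : Set (EuclideanSpace ℝ (Fin d))}
    (hΩ : (s * p + α + β < d ∧ Ω = univ) ∨ ((d : ℝ) < s * p + α + β ∧ Ω = {0}ᶜ)) {c : ℝ}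
    (hc : ∀ u : EuclideanSpace ℝ (Fin d) → ℝ, IsCc1 Ω u → 0 ≤ hardyDifference s p α β c u) :
    c ≤ hardyConst d s p α β := by
  have : Nonempty (Fin d) := ⟨⟨0, hd⟩⟩
  have hp0 : 0 < p := by linarith [hp.1]
  have hsp : 0 < s * p := mul_pos hs.1 hp0
  have hne : s * p + α + β ≠ d := by
    rcases hΩ with h | h
    · exact h.1.ne
    · exact h.1.ne'
  have hΩ0 : ({0}ᶜ : Set (EuclideanSpace ℝ (Fin d))) ⊆ Ω := by
    rcases hΩ with h | h
    · rw [h.2]; exact subset_univ _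
    · rw [h.2]
  set g := ((d : ℝ) - α - β - s * p) / p with hgdef
  have hg : g * p = (d : ℝ) - α - β - s * p := by rw [hgdef]; field_simp
  have hg0 : g ≠ 0 := by
    intro h
    rw [h, zero_mul] at hg
    exact hne (by linarith)
  have he : ‖EuclideanSpace.single (⟨0, hd⟩ : Fin d) (1 : ℝ)‖ = 1 := by simp
  set e := EuclideanSpace.single (⟨0, hd⟩ : Fin d) (1 : ℝ)
  have hpos := hardyConst_pos hd hs hp hα hβ hne
  rcases le_or_gt c 0 with hc0 | hc0
  · exact hc0.trans hpos.le
  obtain ⟨χ, hχ, h1, h2, K, hK, hχK⟩ := exists_plateau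
  have hconst := ofReal_hardyConst hd hs hp hα hβ he hg
  set ε : ℝ → ℝ≥0∞ := fun N => (kernelInt e ((d : ℝ) + s * p)
      fun r => ENNReal.ofReal (logStep N r ^ p * r ^ (-(g * p + β)))) +
    kernelInt e ((d : ℝ) + s * p) fun r => ENNReal.ofReal (logStep N r ^ p * r ^ (-α)) with hε
  -- Division by the Hardy integral H of the test function. The error carries the mass of the
  -- support, at most 2H by doubling, which explains the factor 2.
  have hstep : ∀ θ ∈ Ioo (0 : ℝ) 1, ∀ N, 0 < N → ENNReal.ofReal c ≤
      ENNReal.ofReal ((1 - θ) ^ (1 - p)) * ENNReal.ofReal (hardyConst d s p α β) +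
        ENNReal.ofReal (θ ^ (1 - p) * K ^ p) * 2 * ε N := by
    intro θ hθ N hN
    have hu : IsCc1 Ω (testFn χ g N) := isCc1_testFn hχ h2 hg0 hN hΩ0
    obtain ⟨hG, hH⟩ := lintegral_lt_top_of_isCc1 hd hs hp hα hβ hΩ hu
    have hup := lintegral_gagliardo_testFn_le hp.1.le hg hχ.continuous h2 hθ hK hN hχK he
    have hlow := logMass_le_lintegral_hardy (d := d) hg h1 hN
    have hdiff := hc _ hu
    rw [hardyDifference, integral_integral_eq_toReal
      (measurable_gagliardoIntegrand hu.1.continuous) (gagliardoIntegrand_nonneg _) hG,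
      integral_eq_lintegral_of_nonneg_ae (.of_forall (hardyIntegrand_nonneg _))
        (measurable_hardyIntegrand hu.1.continuous).aestronglyMeasurable, sub_nonneg] at hdiff
    rw [← hconst] at hup
    set H := ∫⁻ x : EuclideanSpace ℝ (Fin d),
      ENNReal.ofReal (hardyIntegrand s p α β (testFn χ g N) x)
    have hcH : H * ENNReal.ofReal c ≤ ∫⁻ z : EuclideanSpace ℝ (Fin d) × EuclideanSpace ℝ (Fin d),
        ENNReal.ofReal (gagliardoIntegrand s p α β (testFn χ g N) z.1 z.2) := by
      rw [← ENNReal.ofReal_toReal hG.ne, ← ENNReal.ofReal_toReal hH.ne,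
        ← ENNReal.ofReal_mul ENNReal.toReal_nonneg, mul_comm]
      exact ENNReal.ofReal_le_ofReal hdiff
    have hH0 : H ≠ 0 := ((logMass_pos hN).trans_le hlow).ne'
    have hmass : logMass (EuclideanSpace ℝ (Fin d)) (-(2 * N)) (2 * N) ≤ 2 * H :=
      (logMass_doubling N).trans (mul_le_mul_right hlow _)
    refine (ENNReal.mul_le_mul_iff_right hH0 hH.ne).1 ((hcH.trans hup).trans ?_)
    refine (add_le_add_right (mul_le_mul_right (mul_le_mul_left hmass _) _) _).trans
      (le_of_eq ?_)
    ring
  have hε0 : Filter.Tendsto (fun n : ℕ => ε ((n : ℝ) + 1)) Filter.atTop (nhds 0) := by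
    have ht : ∀ b : ℝ, -(s * p) < b → b < d → Filter.Tendsto (fun n : ℕ =>
        kernelInt e ((d : ℝ) + s * p) fun r =>
          ENNReal.ofReal (logStep ((n : ℝ) + 1) r ^ p * r ^ (-b))) Filter.atTop (nhds 0) := by
      intro b hb hb'
      have := tendsto_kernelInt_logStep (σ := s * p) (b := b) he hp0 (by nlinarith [hs.2]) hb
        (by rwa [finrank_euclideanSpace_fin])
      rwa [finrank_euclideanSpace_fin] at this
    have := (ht (g * p + β) (by linarith [hα.2]) (by linarith [hα.1])).add (ht α hα.1 hα.2)
    rwa [add_zero] at this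
  -- First N → ∞ with θ fixed, since the error coefficient θ^(1-p) K^p may blow up as θ → 0; only
  -- afterwards θ → 0.
  have hθstep : ∀ θ ∈ Ioo (0 : ℝ) 1, c ≤ (1 - θ) ^ (1 - p) * hardyConst d s p α β := by
    intro θ hθ
    have hA : 0 ≤ (1 - θ) ^ (1 - p) := Real.rpow_nonneg (by linarith [hθ.2]) _
    have hl := (ENNReal.Tendsto.const_mul hε0 (Or.inr (ENNReal.mul_ne_top
      (ENNReal.ofReal_ne_top (r := θ ^ (1 - p) * K ^ p)) (ENNReal.ofNat_ne_top (n := 2))))).const_add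
      (ENNReal.ofReal ((1 - θ) ^ (1 - p)) * ENNReal.ofReal (hardyConst d s p α β))
    rw [mul_zero, add_zero] at hl
    have h := ge_of_tendsto' hl fun n : ℕ => hstep θ hθ ((n : ℝ) + 1) (by positivity)
    rw [← ENNReal.ofReal_mul hA] at h
    exact (ENNReal.ofReal_le_ofReal_iff (mul_nonneg hA hpos.le)).1 h
  have hlim : Filter.Tendsto (fun θ : ℝ => (1 - θ) ^ (1 - p) * hardyConst d s p α β)
      (nhdsWithin 0 (Ioi 0)) (nhds ((1 - 0) ^ (1 - p) * hardyConst d s p α β)) := by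
    refine Filter.Tendsto.mono_left ?_ nhdsWithin_le_nhds
    have h : ContinuousAt (fun θ : ℝ => (1 - θ) ^ (1 - p) * hardyConst d s p α β) 0 :=
      ((continuousAt_const.sub continuousAt_id).rpow_const (Or.inl (by norm_num))).mul
        continuousAt_const
    exact h
  rw [sub_zero, Real.one_rpow, one_mul] at hlim
  exact ge_of_tendsto hlim (by
    filter_upwards [Ioo_mem_nhdsGT (zero_lt_one (α := ℝ))] with θ hθ using hθstep θ hθ)

end SharpConstant

end FracHardy

/-! ### Assembly of the theorem -/

theorem mainTheorem2 (d : ℕ) (hd : 1 ≤ d) (s p α β : ℝ)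
    (hs : s ∈ Set.Ioo (0 : ℝ) 1) (hp : p ∈ Set.Ioo (1 : ℝ) 2)
    (hα : α ∈ Set.Ioo (-(s * p)) (d : ℝ)) (hβ : β ∈ Set.Ioo (-(s * p)) (d : ℝ))
    (hαβ : α + β ∈ Set.Ioo (-(s * p)) (d : ℝ))
    (Ω : Set (EuclideanSpace ℝ (Fin d)))
    (hΩ : (s * p + α + β < d ∧ Ω = Set.univ) ∨ ((d : ℝ) < s * p + α + β ∧ Ω = {0}ᶜ)) :
    -- the constant of the Hardy term is positive
    0 < hardyConst d s p α β ∧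
    -- real-valued functions
    (∀ u : EuclideanSpace ℝ (Fin d) → ℝ, IsCc1 Ω u →
      IntegralsConverge s p α β u (transform s p α β u) ∧
      hardyDifference s p α β (hardyConst d s p α β) u ≥
        remainderConst p * remainderTerm s p α β (transform s p α β u)) ∧
    -- nonnegative functions
    (∀ u : EuclideanSpace ℝ (Fin d) → ℝ, IsCc1 Ω u → (∀ x, 0 ≤ u x) →
      hardyDifference s p α β (hardyConst d s p α β) u ≥
        (p - 1) * remainderTerm s p α β (transform s p α β u)) ∧
    -- complex-valued functions
    (∀ u : EuclideanSpace ℝ (Fin d) → ℂ, IsCc1 Ω u →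
      IntegralsConverge s p α β u (transform s p α β (fun x => ‖u x‖)) ∧
      hardyDifference s p α β (hardyConst d s p α β) u ≥
        remainderConst p * remainderTerm s p α β (transform s p α β (fun x => ‖u x‖)) ∧
      hardyDifference s p α β (hardyConst d s p α β) u ≥
        (p - 1) * remainderTerm s p α β (transform s p α β (fun x => ‖u x‖))) ∧
    -- sharpness: no larger constant keeps the left-hand side nonnegative
    (∀ c : ℝ, (∀ u : EuclideanSpace ℝ (Fin d) → ℝ, IsCc1 Ω u →
      0 ≤ hardyDifference s p α β c u) → c ≤ hardyConst d s p α β) := by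
  have hp0 : 0 < p - 1 := by linarith [hp.1]
  have hne : s * p + α + β ≠ d := by
    rcases hΩ with h | h
    · exact h.1.ne
    · exact h.1.ne'
  have hC := FracHardy.remainderConst_le hp
  -- The comparison function |u| is nonnegative, so the constant p-1 is available; the bound with
  -- C_p then follows from C_p ≤ p-1 and nonnegativity of the remainder.
  have complex : ∀ u : EuclideanSpace ℝ (Fin d) → ℂ, IsCc1 Ω u →
      IntegralsConverge s p α β u (transform s p α β (fun x => ‖u x‖)) ∧
      hardyDifference s p α β (hardyConst d s p α β) u ≥
        (p - 1) * remainderTerm s p α β (transform s p α β (fun x => ‖u x‖)) := by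
    intro u hu
    obtain ⟨hG, hH⟩ := FracHardy.lintegral_lt_top_of_isCc1 hd hs hp hα hβ hΩ hu
    exact FracHardy.hardyDifference_ge hd hs hp hα hβ hne hp0 le_rfl hu.1.continuous
      hu.1.continuous.norm (fun x y => Or.inl (mul_nonneg (norm_nonneg _) (norm_nonneg _))) hG
      (FracHardy.lintegral_gagliardo_norm_le (by linarith) u) hH fun x => norm_norm (u x)
  refine ⟨FracHardy.hardyConst_pos hd hs hp hα hβ hne, fun u hu => ?_, fun u hu hu0 => ?_,
    fun u hu => ⟨(complex u hu).1, le_trans ?_ (complex u hu).2, (complex u hu).2⟩,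
    fun c hc => FracHardy.le_hardyConst hd hs hp hα hβ hΩ hc⟩
  · obtain ⟨hG, hH⟩ := FracHardy.lintegral_lt_top_of_isCc1 hd hs hp hα hβ hΩ hu
    exact FracHardy.hardyDifference_ge hd hs hp hα hβ hne (FracHardy.remainderConst_pos hp) hC
      hu.1.continuous hu.1.continuous (fun x y => Or.inr le_rfl) hG le_rfl hH fun x => rfl
  · obtain ⟨hG, hH⟩ := FracHardy.lintegral_lt_top_of_isCc1 hd hs hp hα hβ hΩ hu
    exact (FracHardy.hardyDifference_ge hd hs hp hα hβ hne hp0 le_rfl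
      hu.1.continuous hu.1.continuous (fun x y => Or.inl (mul_nonneg (hu0 x) (hu0 y))) hG le_rfl hH
      fun x => rfl).2
  · exact mul_le_mul_of_nonneg_right hC (integral_nonneg fun x => integral_nonneg fun y =>
      FracHardy.remainderIntegrand_nonneg _ (x, y))
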